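/- Fix integers $B\ge 1$ and $K\ge 1$, a discrete prior $p_0=\sum_{k=1}^K p_k\,\delta_{\mathbf a_k}$ on $\mathbb R^B$ ($p_k\ge 0$, $\sum_k p_k=1$, $\mathbf a_k\in\mathbb R^B$), a measurement rate $\alpha>0$, and integers $M=M_L\ge 0$ with $M_L/(LB)\to\alpha$ as $L\to\infty$. For $\Delta>0$ and $L\ge 1$ let $\mathbf S=(\mathbf S_1,\dots,\mathbf S_L)\in\mathbb R^{LB}$ have i.i.d. sections $\mathbf S_l\sim p_0$ (denote its law by $P_0$), let $\mathbf\Phi\in\mathbb R^{M\times LB}$ have i.i.d. entries $\mathcal N(0,1/L)$, let $\mathbf Z\in\mathbb R^M$ have i.i.d. entries $\mathcal N(0,1)$, all independent, and let $\mathbf Y=\mathbf\Phi\mathbf S+\sqrt\Delta\,\mathbf Z$. Given $\mathbf\Phi$, put $P(\mathbf y|\mathbf x)=(2\pi\Delta)^{-M/2}\exp(-\|\mathbf\Phi\mathbf x-\mathbf y\|^2/(2\Delta))$ and $P(\mathbf y)=\int P(\mathbf y|\mathbf x)\,dP_0(\mathbf x)$, and let $\langle\mathbf X\rangle=\frac{1}{P(\mathbf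 Y)}\int \mathbf x\,P(\mathbf Y|\mathbf x)\,dP_0(\mathbf x)$ be the posterior mean. Define the mutual information and the MMSE per section by $$i_L(\Delta)=\frac1L\,\mathbb E\Big[\ln\frac{P(\mathbf Y|\mathbf S)}{P(\mathbf Y)}\Big],\qquad E_L(\Delta)=\frac1L\,\mathbb E\big[\|\mathbf S-\langle\mathbf X\rangle\|^2\big].$$ Then $i(\Delta)=\lim_{L\to\infty}i_L(\Delta)$ exists for every $\Delta>0$, and for Lebesgue-almost every $\Delta>0$ the limit $E=E(\Delta)=\lim_{L\to\infty}E_L(\Delta)$ exists, $i$ is differentiable at $\Delta$ as a function of $\Delta^{-1}$, and $$\frac{di}{d\Delta^{-1}}=\frac{\alpha B}{2}\,\frac{E}{1+E/\Delta}.$$ -/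

import Mathlib

open MeasureTheory ProbabilityTheory Filter
open scoped Topology

noncomputable section

namespace RLE

/-- A discrete prior `p₀ = ∑ₖ pₖ δ_{aₖ}` on `ℝ^B` with finitely many atoms. -/
structure DiscretePrior (B : ℕ) where
  /-- number of terms -/
  K : ℕ
  /-- the weights `pₖ` -/
  weight : Fin K → ℝ
  /-- the atoms `aₖ` -/
  atom : Fin K → Fin B → ℝ
  weight_nonneg : ∀ k, 0 ≤ weight k
  weight_sum : ∑ k, weight k = 1

variable {B : ℕ}

/-- The law `p₀` of one section. -/
def DiscretePrior.sectionLaw (P : DiscretePrior B) : Measure (Fin B → ℝ) :=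
  ∑ k, ENNReal.ofReal (P.weight k) • Measure.dirac (P.atom k)

/-- The law `P₀` of a signal made of `L` i.i.d. sections; `s l b` is the `b`-th component
of the `l`-th section. -/
def DiscretePrior.signalLaw (P : DiscretePrior B) (L : ℕ) : Measure (Fin L → Fin B → ℝ) :=
  Measure.pi fun _ => P.sectionLaw

/-- The law of an `M × (LB)` matrix with i.i.d. entries `𝒩(0, 1/L)`. Columns are indexed
by (section, component). -/
def matrixLaw (M L B : ℕ) : Measure (Fin M → Fin L → Fin B → ℝ) :=
  Measure.pi fun _ => Measure.pi fun _ => Measure.pi fun _ => gaussianReal 0 (1 / (L : NNReal))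

/-- The law of the standardized noise: `M` i.i.d. `𝒩(0, 1)` components. -/
def noiseLaw (M : ℕ) : Measure (Fin M → ℝ) :=
  Measure.pi fun _ => gaussianReal 0 1

/-- The joint law of the independent triple (matrix `Φ`, signal `S`, noise `Z`). -/
def jointLaw (P : DiscretePrior B) (L M : ℕ) :
    Measure ((Fin M → Fin L → Fin B → ℝ) × (Fin L → Fin B → ℝ) × (Fin M → ℝ)) :=
  (matrixLaw M L B).prod ((P.signalLaw L).prod (noiseLaw M))

/-- The matrix-vector product `φ x`. -/
def project {L M : ℕ} (φ : Fin M → Fin L → Fin B → ℝ) (x : Fin L → Fin B → ℝ) : Fin M → ℝ :=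
  fun μ => ∑ l, ∑ b, φ μ l b * x l b

/-- The measurement `y = φ s + √Δ z`. -/
def measurement {L M : ℕ} (Δ : ℝ) (φ : Fin M → Fin L → Fin B → ℝ) (s : Fin L → Fin B → ℝ)
    (z : Fin M → ℝ) : Fin M → ℝ :=
  fun μ => project φ s μ + z μ * √Δ

/-- The likelihood `P(y | x) = (2πΔ)^{-M/2} exp(-‖φ x - y‖² / (2Δ))`, given the matrix `φ`. -/
def likelihood {L M : ℕ} (Δ : ℝ) (φ : Fin M → Fin L → Fin B → ℝ) (y : Fin M → ℝ)
    (x : Fin L → Fin B → ℝ) : ℝ :=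
  (2 * Real.pi * Δ) ^ (-(M : ℝ) / 2) *
    Real.exp (-(∑ μ, (project φ x μ - y μ) ^ 2) / (2 * Δ))

/-- The marginal density `P(y) = ∫ P(y | x) dP₀(x)`, given the matrix `φ`. -/
def evidence (P : DiscretePrior B) {L M : ℕ} (Δ : ℝ) (φ : Fin M → Fin L → Fin B → ℝ)
    (y : Fin M → ℝ) : ℝ :=
  ∫ x, likelihood Δ φ y x ∂(P.signalLaw L)

/-- The posterior mean (MMSE estimator) `⟨X⟩`, for the posterior
`P(x | y) = P(y | x) P₀(x) / P(y)`. -/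
def posteriorMean (P : DiscretePrior B) {L M : ℕ} (Δ : ℝ) (φ : Fin M → Fin L → Fin B → ℝ)
    (y : Fin M → ℝ) : Fin L → Fin B → ℝ :=
  fun l b => (∫ x, likelihood Δ φ y x * x l b ∂(P.signalLaw L)) / evidence P Δ φ y

/-- The mutual information per section `i_L = (1/L) 𝔼[ln (P(Y | X) / P(Y))]`, with `L` sections,
`M` measurements and noise variance `Δ`. -/
def mutualInfo (P : DiscretePrior B) (L M : ℕ) (Δ : ℝ) : ℝ :=
  1 / (L : ℝ) * ∫ ω, (fun (φ : Fin M → Fin L → Fin B → ℝ) s z =>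
    Real.log (likelihood Δ φ (measurement Δ φ s z) s / evidence P Δ φ (measurement Δ φ s z)))
    ω.1 ω.2.1 ω.2.2 ∂(jointLaw P L M)

/-- The MMSE per section `E_L = (1/L) 𝔼[‖S - ⟨X⟩‖²]` (Euclidean norm), with `L` sections,
`M` measurements and noise variance `Δ`. -/
def mmse (P : DiscretePrior B) (L M : ℕ) (Δ : ℝ) : ℝ :=
  1 / (L : ℝ) * ∫ ω, (fun (φ : Fin M → Fin L → Fin B → ℝ) s z =>
    ∑ l, ∑ b, (s l b - posteriorMean P Δ φ (measurement Δ φ s z) l b) ^ 2)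
    ω.1 ω.2.1 ω.2.2 ∂(jointLaw P L M)

end RLE

end

/-!
The existence of the limit and the formula for its derivative are proved together, by comparing the
free energies of the finite systems with an approximate first-order partial differential equation.

*Side channel.* With `h = 1 / √Δ` and a second parameter `g`, let the observer also see
`g S + Z'` for an independent standard Gaussian `Z'`. Let `f_L(h, g)` be the free energy
(the mutual information) per section and `e_L(h, g)` the mean square error of `S` per section; the
quantities of the theorem are their values at `g = 0`. Gaussian integration by parts, combined with
the Nishimori identity (a signal drawn from the posterior is distributed like the true one), gives
`∂f_L/∂g = g e_L` and `∂f_L/∂h = h y_L`, where `y_L` is the error on `Φ S` per section. Adding noise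
degrades estimation, so `e_L` decreases in `g` and in `h` (`Signal.sigErr_antitone`).

*Relation between the errors.* Integration by parts in the entries of `Φ` writes `h L y_L` as the
average of a product of `h T`, where `T` is a bounded overlap with mean `e_L`,
and of `‖Z‖² - h (w · Z)`, where `w = Φ (X - S)`. Were the second factor equal to its mean
`M - h² L y_L`, the outcome would be `y_L = a e_L / (1 + h² e_L)` with `a = lim M / L = α B`
(`Signal.measErr_relation`). Its deviation is controlled in `h`-average, uniformly in `g`
(`corrFluct`): the thermal part is the second derivative of the log-partition function, whose
integral over `h` is of order `M`; the disorder part follows from the convexity of the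
log-partition function (up to a correction of order `M`) and from a variance bound of order `M + L`,
which combines the Gaussian Poincaré inequality with the Efron–Stein inequality for the discrete
signal. Hence `∂f_L/∂h = h a e_L / (1 + h² e_L)` up to an error whose `h`-average tends to zero,
while `∂f_L/∂g = g e_L`, and `f_L(0, ·)` does not depend on `L` (`Signal.isApproxSolution`).

*Uniqueness.* For two indices let `w` be the difference of the potentials. Subtracting the equations
gives the transport equation `g ∂w/∂h = a h β ∂w/∂g` up to the defect, with the speed
`β = 1 / ((1 + h² e_1)(1 + h² e_2))`. The errors decrease in `g`, so `β` increases in `g`. That is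
the sign for which the integral of `w²` against the weight `g exp (-g² - a h²)` satisfies a
closed estimate (`energy_le`): the potentials form a Cauchy sequence, and `i` exists.

*Errors.* The function `r ↦ i (1 / r)` is a limit of functions with derivative close to
`(a / 2) e_L / (1 + r e_L)`, and the effective error `e_L / (1 + h² e_L)` decreases in `h`. At each
point where the (concave) limit is differentiable, and so almost everywhere, difference quotients
on both sides squeeze the effective error, hence `e_L` itself, to a limit
(`IsApproxSolution.limit`).
-/

noncomputable section

namespace RLE

/-! ### Functions of polynomial growth -/

/-- A continuous real function bounded by a power of `1 + ‖v‖`. The random functions whose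
Gaussian expectations are taken below belong to this class, which settles their integrability and
differentiation under the integral. -/
def PolyGrowth {V : Type*} [NormedAddCommGroup V] (f : V → ℝ) : Prop :=
  Continuous f ∧ ∃ (C : ℝ) (n : ℕ), ∀ v, |f v| ≤ C * (1 + ‖v‖) ^ n

namespace PolyGrowth

variable {V W : Type*} [NormedAddCommGroup V] [NormedAddCommGroup W] {f g : V → ℝ}

lemma exists_bound (hf : PolyGrowth f) :
    ∃ (C : ℝ) (n : ℕ), 0 ≤ C ∧ ∀ v, |f v| ≤ C * (1 + ‖v‖) ^ n := by
  obtain ⟨-, C, n, h⟩ := hf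
  refine ⟨C, n, ?_, h⟩
  have := (abs_nonneg _).trans (h 0)
  simpa using this

lemma of_le (hf : Continuous f) (hg : PolyGrowth g) (h : ∀ v, |f v| ≤ g v) : PolyGrowth f := by
  obtain ⟨-, C, n, hC⟩ := hg
  exact ⟨hf, C, n, fun v => (h v).trans ((le_abs_self _).trans (hC v))⟩

lemma const (c : ℝ) : PolyGrowth (fun _ : V => c) :=
  ⟨continuous_const, |c|, 0, fun v => by simp⟩

lemma norm : PolyGrowth (fun v : V => ‖v‖) :=
  ⟨continuous_norm, 1, 1, fun v => by simp⟩

lemma add (hf : PolyGrowth f) (hg : PolyGrowth g) : PolyGrowth (fun v => f v + g v) := by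
  obtain ⟨C, n, hC, h⟩ := hf.exists_bound
  obtain ⟨D, m, hD, k⟩ := hg.exists_bound
  refine ⟨hf.1.add hg.1, C + D, n + m, fun v => ?_⟩
  have h1 : (1 : ℝ) ≤ 1 + ‖v‖ := by linarith [norm_nonneg v]
  have h2 : (1 + ‖v‖) ^ n ≤ (1 + ‖v‖) ^ (n + m) := pow_le_pow_right₀ h1 (by omega)
  have h3 : (1 + ‖v‖) ^ m ≤ (1 + ‖v‖) ^ (n + m) := pow_le_pow_right₀ h1 (by omega)
  calc |f v + g v| ≤ |f v| + |g v| := abs_add_le _ _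
    _ ≤ C * (1 + ‖v‖) ^ n + D * (1 + ‖v‖) ^ m := add_le_add (h v) (k v)
    _ ≤ C * (1 + ‖v‖) ^ (n + m) + D * (1 + ‖v‖) ^ (n + m) := by gcongr
    _ = _ := by ring

lemma mul (hf : PolyGrowth f) (hg : PolyGrowth g) : PolyGrowth (fun v => f v * g v) := by
  obtain ⟨C, n, hC, h⟩ := hf.exists_bound
  obtain ⟨D, m, hD, k⟩ := hg.exists_bound
  refine ⟨hf.1.mul hg.1, C * D, n + m, fun v => ?_⟩
  calc |f v * g v| = |f v| * |g v| := abs_mul _ _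
    _ ≤ (C * (1 + ‖v‖) ^ n) * (D * (1 + ‖v‖) ^ m) :=
        mul_le_mul (h v) (k v) (abs_nonneg _) (by positivity)
    _ = _ := by ring

lemma neg (hf : PolyGrowth f) : PolyGrowth (fun v => -f v) := by
  simpa using (const (-1)).mul hf

lemma sub (hf : PolyGrowth f) (hg : PolyGrowth g) : PolyGrowth (fun v => f v - g v) := by
  simpa [sub_eq_add_neg] using hf.add hg.neg

lemma const_mul (c : ℝ) (hf : PolyGrowth f) : PolyGrowth (fun v => c * f v) := (const c).mul hf

lemma div_const (hf : PolyGrowth f) (c : ℝ) : PolyGrowth (fun v => f v / c) := by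
  simpa [div_eq_mul_inv] using hf.mul (const c⁻¹)

lemma pow (hf : PolyGrowth f) (n : ℕ) : PolyGrowth (fun v => f v ^ n) := by
  induction n with
  | zero => simpa using const 1
  | succ n ih => simpa [pow_succ] using ih.mul hf

lemma abs (hf : PolyGrowth f) : PolyGrowth (fun v => |f v|) := by
  obtain ⟨hc, C, n, h⟩ := hf
  exact ⟨hc.abs, C, n, fun v => by simpa using h v⟩

lemma sum {ι : Type*} (s : Finset ι) {f : ι → V → ℝ} (hf : ∀ i ∈ s, PolyGrowth (f i)) :
    PolyGrowth (fun v => ∑ i ∈ s, f i v) := by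
  classical
  induction s using Finset.induction_on with
  | empty => simpa using const 0
  | insert a s ha ih =>
    simp only [Finset.sum_insert ha]
    exact (hf a (by simp)).add (ih fun i hi => hf i (by simp [hi]))

lemma comp (hf : PolyGrowth f) {u : W → V} (hu : Continuous u)
    (hn : PolyGrowth (fun v => ‖u v‖)) : PolyGrowth (fun v => f (u v)) := by
  obtain ⟨C, n, hC, h⟩ := hf.exists_bound
  exact of_le (hf.1.comp hu) ((((const 1).add hn).pow n).const_mul C) (fun v => h (u v))

lemma norm_comp_fst : PolyGrowth (fun v : V × W => ‖v.1‖) :=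
  of_le (by fun_prop) norm fun v => by simpa using norm_fst_le v

lemma norm_comp_snd : PolyGrowth (fun v : V × W => ‖v.2‖) :=
  of_le (by fun_prop) norm fun v => by simpa using norm_snd_le v

lemma comp_fst (hf : PolyGrowth f) : PolyGrowth (fun v : V × W => f v.1) :=
  hf.comp continuous_fst norm_comp_fst

lemma comp_snd (hf : PolyGrowth f) : PolyGrowth (fun v : W × V => f v.2) :=
  hf.comp continuous_snd norm_comp_snd

lemma slice_left {f : W × V → ℝ} (hf : PolyGrowth f) (t : W) : PolyGrowth (fun v => f (t, v)) :=
  hf.comp (by fun_prop) (of_le (by fun_prop) ((const ‖t‖).add norm) fun v => by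
    rw [abs_norm]
    exact max_le_add_of_nonneg (norm_nonneg _) (norm_nonneg _))

lemma slice_right {f : V × W → ℝ} (hf : PolyGrowth f) (t : W) : PolyGrowth (fun v => f (v, t)) :=
  hf.comp (by fun_prop) (of_le (by fun_prop) (norm.add (const ‖t‖)) fun v => by
    rw [abs_norm]
    exact max_le_add_of_nonneg (norm_nonneg _) (norm_nonneg _))

lemma of_eval {J : Type*} [Fintype J] (j : J) : PolyGrowth (fun v : J → ℝ => v j) :=
  of_le (by fun_prop) norm fun v => norm_le_pi_norm v j

lemma id_real : PolyGrowth (fun t : ℝ => t) := of_le continuous_id norm fun _ => le_rfl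

lemma comp_pi {J : Type*} [Fintype J] {f : (J → ℝ) → ℝ} (hf : PolyGrowth f) {u : V → J → ℝ}
    (hu : ∀ j, PolyGrowth (fun v => u v j)) : PolyGrowth (fun v => f (u v)) := by
  refine hf.comp (continuous_pi fun j => (hu j).1) ?_
  refine of_le (continuous_pi fun j => (hu j).1).norm
    (sum Finset.univ fun j _ => (hu j).abs) fun v => ?_
  rw [abs_norm]
  refine (pi_norm_le_iff_of_nonneg (Finset.sum_nonneg fun j _ => abs_nonneg _)).2 fun j => ?_
  exact Finset.single_le_sum (f := fun j => |u v j|) (fun j _ => abs_nonneg _) (Finset.mem_univ j)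

lemma comp_prod {V' : Type*} [NormedAddCommGroup V'] {f : V × W → ℝ} (hf : PolyGrowth f)
    {a : V' → V} {b : V' → W} (ha : Continuous a) (hb : Continuous b)
    (ha' : PolyGrowth (fun v => ‖a v‖)) (hb' : PolyGrowth (fun v => ‖b v‖)) :
    PolyGrowth (fun v => f (a v, b v)) :=
  hf.comp (by fun_prop) (of_le (by fun_prop) (ha'.add hb') fun v => by
    rw [abs_norm]
    exact max_le_add_of_nonneg (norm_nonneg _) (norm_nonneg _))

lemma bound_on_ball {f : W × V → ℝ} {C : ℝ} {n : ℕ} (hC : 0 ≤ C)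
    (h : ∀ v, |f v| ≤ C * (1 + ‖v‖) ^ n) {t₀ t : W} (ht : t ∈ Metric.ball t₀ 1) (v : V) :
    ‖f (t, v)‖ ≤ C * (2 + ‖t₀‖) ^ n * (1 + ‖v‖) ^ n := by
  have h1 : ‖t‖ ≤ ‖t₀‖ + 1 := by
    have h2 := norm_le_norm_add_norm_sub' t t₀
    rw [mem_ball_iff_norm] at ht
    linarith
  have h3 : ‖(t, v)‖ ≤ ‖t‖ + ‖v‖ := max_le_add_of_nonneg (norm_nonneg _) (norm_nonneg _)
  have h4 : 1 + ‖(t, v)‖ ≤ (2 + ‖t₀‖) * (1 + ‖v‖) := by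
    nlinarith [norm_nonneg v, norm_nonneg t₀, mul_nonneg (norm_nonneg t₀) (norm_nonneg v)]
  calc ‖f (t, v)‖ ≤ C * (1 + ‖(t, v)‖) ^ n := h _
    _ ≤ C * ((2 + ‖t₀‖) * (1 + ‖v‖)) ^ n := by gcongr
    _ = _ := by rw [mul_pow]; ring

variable [NormedSpace ℝ V] [MeasurableSpace V] [BorelSpace V] [CompleteSpace V]
  [SecondCountableTopology V]

lemma integrable_one_add_norm_pow (μ : Measure V) [IsGaussian μ] (n : ℕ) :
    Integrable (fun v => (1 + ‖v‖) ^ n) μ := by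
  have h : MemLp (fun v : V => 1 + ‖v‖) n μ :=
    (memLp_const (1 : ℝ)).add (IsGaussian.memLp_id μ n (by simp)).norm
  refine h.integrable_norm_pow'.congr (ae_of_all _ fun v => ?_)
  simp only [Real.norm_eq_abs]
  rw [abs_of_nonneg (by positivity)]

/-- Functions of polynomial growth are integrable for Gaussian measures, by Fernique's theorem. -/
lemma integrable (hf : PolyGrowth f) (μ : Measure V) [IsGaussian μ] : Integrable f μ := by
  obtain ⟨C, n, hC, h⟩ := hf.exists_bound
  exact ((integrable_one_add_norm_pow μ n).const_mul C).mono' hf.1.aestronglyMeasurable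
    (ae_of_all _ h)

lemma continuous_integral {f : W × V → ℝ} (hf : PolyGrowth f) (μ : Measure V) [IsGaussian μ] :
    Continuous (fun t => ∫ v, f (t, v) ∂μ) := by
  obtain ⟨C, n, hC, h⟩ := hf.exists_bound
  refine continuous_iff_continuousAt.2 fun t₀ => ?_
  refine continuousAt_of_dominated (bound := fun v => C * (2 + ‖t₀‖) ^ n * (1 + ‖v‖) ^ n)
    ?_ ?_ ?_ ?_
  · exact Eventually.of_forall fun t => (hf.slice_left t).1.aestronglyMeasurable
  · filter_upwards [Metric.ball_mem_nhds t₀ one_pos] with t ht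
    exact ae_of_all _ fun v => bound_on_ball hC h ht v
  · exact (integrable_one_add_norm_pow μ n).const_mul _
  · exact ae_of_all _ fun v => (hf.1.comp (by fun_prop)).continuousAt

/-- Differentiation under a Gaussian integral. -/
lemma hasDerivAt_integral {f f' : ℝ × V → ℝ} (hf : PolyGrowth f) (hf' : PolyGrowth f')
    (μ : Measure V) [IsGaussian μ]
    (hd : ∀ t v, HasDerivAt (fun t => f (t, v)) (f' (t, v)) t) (t₀ : ℝ) :
    HasDerivAt (fun t => ∫ v, f (t, v) ∂μ) (∫ v, f' (t₀, v) ∂μ) t₀ := by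
  obtain ⟨C, n, hC, h⟩ := hf'.exists_bound
  refine (hasDerivAt_integral_of_dominated_loc_of_deriv_le (F := fun t v => f (t, v))
    (F' := fun t v => f' (t, v)) (bound := fun v => C * (2 + ‖t₀‖) ^ n * (1 + ‖v‖) ^ n)
    (Metric.ball_mem_nhds t₀ one_pos) ?_ ?_ ?_ ?_ ?_ ?_).2
  · exact Eventually.of_forall fun t => (hf.slice_left t).1.aestronglyMeasurable
  · exact (hf.slice_left t₀).integrable μ
  · exact (hf'.slice_left t₀).1.aestronglyMeasurable
  · exact ae_of_all _ fun v t ht => bound_on_ball hC h ht v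
  · exact (integrable_one_add_norm_pow μ n).const_mul _
  · exact ae_of_all _ fun v t _ => hd t v

end PolyGrowth

/-! ### The standard Gaussian measure on a finite product -/

/-- The law of a family of i.i.d. standard Gaussian variables indexed by `J`. -/
def stdGauss (J : Type*) [Fintype J] : Measure (J → ℝ) := Measure.pi fun _ => gaussianReal 0 1

section
variable {J : Type*} [Fintype J]

instance : IsProbabilityMeasure (stdGauss J) := by unfold stdGauss; infer_instance

instance : IsGaussian (stdGauss J) := by
  have h := iIndepFun.hasGaussianLaw (P := stdGauss J) (X := fun (j : J) (ω : J → ℝ) => ω j)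
    (fun j => ⟨by
      unfold stdGauss
      have := (measurePreserving_eval (fun _ : J => gaussianReal 0 1) j).map_eq
      rw [show (fun ω : J → ℝ => ω j) = Function.eval j from rfl, this]
      infer_instance⟩)
    (iIndepFun_pi (μ := fun _ : J => gaussianReal 0 1) (X := fun _ => id) fun _ => aemeasurable_id)
  have h2 := h.isGaussian_map
  have h3 : (fun (ω : J → ℝ) (j : J) => ω j) = id := rfl
  rwa [h3, Measure.map_id] at h2

/-- Resampling one coordinate preserves the law. -/
lemma stdGauss_map_update [DecidableEq J] (j : J) :
    ((stdGauss J).prod (gaussianReal 0 1)).map (fun q : (J → ℝ) × ℝ => Function.update q.1 j q.2) =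
      stdGauss J := by
  symm
  have hm : Measurable (fun q : (J → ℝ) × ℝ => Function.update q.1 j q.2) := by
    refine measurable_pi_lambda _ fun i => ?_
    by_cases h : i = j
    · subst h; simpa using measurable_snd
    · simp only [Function.update_of_ne h]; fun_prop
  unfold stdGauss
  refine Measure.pi_eq fun s hs => ?_
  rw [Measure.map_apply hm (MeasurableSet.univ_pi hs)]
  have : (fun q : (J → ℝ) × ℝ => Function.update q.1 j q.2) ⁻¹' (Set.univ.pi s) =
      (Set.univ.pi (Function.update s j Set.univ)) ×ˢ s j := by
    ext q
    simp only [Set.mem_preimage, Set.mem_pi, Set.mem_univ, true_implies, Set.mem_prod]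
    constructor
    · intro h
      refine ⟨fun i => ?_, by simpa using h j⟩
      by_cases hi : i = j
      · subst hi; simp
      · simpa [Function.update_of_ne hi] using h i
    · rintro ⟨h1, h2⟩ i
      by_cases hi : i = j
      · subst hi; simpa using h2
      · simpa [Function.update_of_ne hi] using h1 i
  rw [this, Measure.prod_prod, Measure.pi_pi,
    ← Finset.mul_prod_erase Finset.univ (fun i => gaussianReal 0 1 (s i)) (Finset.mem_univ j),
    ← Finset.mul_prod_erase Finset.univ (fun i => gaussianReal 0 1 (Function.update s j Set.univ i))
      (Finset.mem_univ j), mul_comm]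
  congr 1
  simp only [Function.update_self, measure_univ, one_mul]
  refine Finset.prod_congr rfl fun i hi => ?_
  rw [Function.update_of_ne (Finset.ne_of_mem_erase hi)]

lemma integral_mul_gaussianReal {f f' : ℝ → ℝ} (hf : PolyGrowth f) (hf' : PolyGrowth f')
    (hd : ∀ t, HasDerivAt f (f' t) t) :
    ∫ t, t * f t ∂(gaussianReal 0 1) = ∫ t, f' t ∂(gaussianReal 0 1) := by
  have key : ∀ {h : ℝ → ℝ}, PolyGrowth h →
      Integrable (fun t => h t * gaussianPDFReal 0 1 t) := by
    intro h hh
    have := hh.integrable (gaussianReal 0 1)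
    rw [gaussianReal_of_var_ne_zero _ one_ne_zero,
      integrable_withDensity_iff_integrable_smul' (measurable_gaussianPDF _ _)
        (ae_of_all _ fun _ => gaussianPDF_lt_top)] at this
    refine this.congr (ae_of_all _ fun t => ?_)
    simp [toReal_gaussianPDF, mul_comm]
  have hpdf : ∀ t, HasDerivAt (gaussianPDFReal 0 1) (-t * gaussianPDFReal 0 1 t) t := by
    intro t
    have h1 : HasDerivAt (fun t : ℝ => -(t - 0) ^ 2 / (2 * ((1 : NNReal) : ℝ))) (-t) t := by
      have := (((hasDerivAt_id t).sub_const 0).pow 2).neg.div_const (2 * ((1 : NNReal) : ℝ))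
      refine this.congr_deriv ?_
      simp
      ring
    have h2 := (h1.exp).const_mul (√(2 * Real.pi * ((1 : NNReal) : ℝ)))⁻¹
    rw [gaussianPDFReal_def]
    refine h2.congr_deriv ?_
    ring
  have h := integral_mul_deriv_eq_deriv_mul_of_integrable (u := f) (u' := f')
    (v := gaussianPDFReal 0 1) (v' := fun t => -t * gaussianPDFReal 0 1 t)
    (fun t _ => hd t) (fun t _ => hpdf t)
    ((key (hf.mul PolyGrowth.id_real.neg)).congr (ae_of_all _ fun t => by
      simp only [Pi.mul_apply]; ring))
    (key hf') (key hf)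
  rw [integral_gaussianReal_eq_integral_smul one_ne_zero,
    integral_gaussianReal_eq_integral_smul one_ne_zero]
  simp only [smul_eq_mul]
  have e1 : ∫ t, gaussianPDFReal 0 1 t * (t * f t) = - ∫ t, f t * (-t * gaussianPDFReal 0 1 t) := by
    rw [← integral_neg]; congr 1; ext t; ring
  rw [e1, h, neg_neg]
  congr 1; ext t; ring

lemma PolyGrowth.update [DecidableEq J] (j : J) {f : (J → ℝ) → ℝ} (hf : PolyGrowth f) :
    PolyGrowth (fun q : (J → ℝ) × ℝ => f (Function.update q.1 j q.2)) := by
  refine hf.comp_pi fun i => ?_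
  by_cases h : i = j
  · subst h
    simpa using PolyGrowth.id_real.comp_snd
  · simpa [Function.update_of_ne h] using (PolyGrowth.of_eval i).comp_fst

lemma integral_stdGauss_update [DecidableEq J] (j : J) {f : (J → ℝ) → ℝ} (hf : PolyGrowth f) :
    ∫ ω, f ω ∂(stdGauss J) =
      ∫ ω, ∫ t, f (Function.update ω j t) ∂(gaussianReal 0 1) ∂(stdGauss J) := by
  conv_lhs => rw [← stdGauss_map_update j]
  have hc : Continuous (fun q : (J → ℝ) × ℝ => Function.update q.1 j q.2) := by fun_prop
  rw [integral_map hc.measurable.aemeasurable hf.1.aestronglyMeasurable, integral_prod]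
  exact (hf.update j).integrable _

/-- **Gaussian integration by parts** (Stein's lemma) in one coordinate. -/
lemma integral_eval_mul_stdGauss [DecidableEq J] (j : J) {f f' : (J → ℝ) → ℝ} (hf : PolyGrowth f)
    (hf' : PolyGrowth f')
    (hd : ∀ ω t, HasDerivAt (fun t => f (Function.update ω j t)) (f' (Function.update ω j t)) t) :
    ∫ ω, ω j * f ω ∂(stdGauss J) = ∫ ω, f' ω ∂(stdGauss J) := by
  rw [integral_stdGauss_update j ((PolyGrowth.of_eval j).mul hf), integral_stdGauss_update j hf']
  congr 1
  ext ω
  simp only [Function.update_self]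
  exact integral_mul_gaussianReal ((hf.update j).slice_left ω) ((hf'.update j).slice_left ω) (hd ω)

lemma integral_eval_stdGauss (j : J) : ∫ ω, ω j ∂(stdGauss J) = 0 := by
  classical
  simpa using integral_eval_mul_stdGauss j (PolyGrowth.const 1) (PolyGrowth.const 0)
    (fun ω t => hasDerivAt_const t _)

lemma integral_id_stdGauss : (stdGauss J)[id] = 0 := by
  ext j
  have h := eval_integral (μ := stdGauss J) (f := id)
    (fun j => (PolyGrowth.of_eval j).integrable _) j
  rw [h]
  simpa using integral_eval_stdGauss j

lemma hasDerivAt_update_eval {J : Type*} [Fintype J] [DecidableEq J] (ω : J → ℝ) (i j : J) (t : ℝ) :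
    HasDerivAt (fun t => Function.update ω j t i) ((Pi.single j 1 : J → ℝ) i) t :=
  (hasDerivAt_pi.1 (hasDerivAt_update ω j t)) i

lemma integral_sq_linear_stdGauss (a : J → ℝ) :
    ∫ ω, (∑ j, a j * ω j) ^ 2 ∂(stdGauss J) = ∑ j, a j ^ 2 := by
  classical
  have hP : PolyGrowth (fun ω : J → ℝ => ∑ i, a i * ω i) :=
    PolyGrowth.sum _ fun i _ => (PolyGrowth.of_eval i).const_mul _
  have h1 : ∀ j, ∫ ω, ω j * (∑ i, a i * ω i) ∂(stdGauss J) = a j := by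
    intro j
    rw [integral_eval_mul_stdGauss j (f' := fun _ => a j) hP (PolyGrowth.const _)]
    · simp
    · intro ω t
      have := HasDerivAt.fun_sum (u := Finset.univ) fun i _ =>
        (hasDerivAt_update_eval ω i j t).const_mul (a i)
      refine this.congr_deriv ?_
      simp [Pi.single_apply]
  have h2 : ∀ ω : J → ℝ, (∑ j, a j * ω j) ^ 2 = ∑ j, a j * (ω j * ∑ i, a i * ω i) := by
    intro ω
    rw [sq, Finset.sum_mul]
    exact Finset.sum_congr rfl fun j _ => by ring
  simp_rw [h2]
  rw [integral_finsetSum _ fun j _ =>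
    (((PolyGrowth.of_eval j).mul hP).const_mul _).integrable _]
  refine Finset.sum_congr rfl fun j _ => ?_
  rw [integral_const_mul, h1]; ring


/-- The shift of a standard Gaussian vector by `a` has density `exp (a · y - |a|² / 2)`. -/
lemma stdGauss_map_add (a : J → ℝ) :
    (stdGauss J).map (fun ω => ω + a) = (stdGauss J).withDensity
      (fun y => ENNReal.ofReal (Real.exp (∑ j, (a j * y j - a j ^ 2 / 2)))) := by
  have h1 : ∀ c : ℝ, (gaussianReal 0 1).map (fun t => t + c) = (gaussianReal 0 1).withDensity
      (fun t => ENNReal.ofReal (Real.exp (c * t - c ^ 2 / 2))) := by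
    intro c
    rw [gaussianReal_map_add_const, gaussianReal_of_var_ne_zero _ one_ne_zero,
      gaussianReal_of_var_ne_zero _ one_ne_zero,
      ← withDensity_mul _ (measurable_gaussianPDF _ _) (by fun_prop)]
    congr 1
    ext t
    simp only [Pi.mul_apply, gaussianPDF]
    rw [← ENNReal.ofReal_mul (gaussianPDFReal_nonneg _ _ _)]
    congr 1
    simp only [gaussianPDFReal_def]
    conv_rhs => rw [mul_assoc, ← Real.exp_add]
    congr 2
    simp
    ring
  have hint : ∀ (s : Set ℝ) (c : ℝ), MeasurableSet s → Integrable
      (fun t => s.indicator (fun t => Real.exp (c * t - c ^ 2 / 2)) t) (gaussianReal 0 1) := by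
    intro s c hs
    refine Integrable.indicator ?_ hs
    have := (integrable_exp_mul_gaussianReal (μ := 0) (v := 1) c).mul_const
      (Real.exp (-(c ^ 2 / 2)))
    refine this.congr (ae_of_all _ fun t => ?_)
    simp only
    rw [← Real.exp_add]; congr 1
  have h2 : (stdGauss J).map (fun ω => ω + a) =
      Measure.pi fun j => (gaussianReal 0 1).map (fun t => t + a j) := by
    unfold stdGauss
    rw [← Measure.pi_map_pi fun j => by fun_prop]
    rfl
  rw [h2]
  refine Measure.pi_eq fun s hs => ?_
  rw [withDensity_apply _ (MeasurableSet.univ_pi hs),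
    ← lintegral_indicator (MeasurableSet.univ_pi hs)]
  have h3 : ∀ y : J → ℝ, (Set.univ.pi s).indicator (fun y : J → ℝ =>
      ENNReal.ofReal (Real.exp (∑ j, (a j * y j - a j ^ 2 / 2)))) y =
      ENNReal.ofReal (∏ j, (s j).indicator (fun t => Real.exp (a j * t - a j ^ 2 / 2)) (y j)) := by
    intro y
    by_cases hy : y ∈ Set.univ.pi s
    · rw [Set.indicator_of_mem hy, Real.exp_sum]
      congr 1
      refine Finset.prod_congr rfl fun j _ => ?_
      rw [Set.indicator_of_mem (hy j (Set.mem_univ j))]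
    · rw [Set.indicator_of_notMem hy]
      simp only [Set.mem_pi, Set.mem_univ, true_implies, not_forall] at hy
      obtain ⟨j, hj⟩ := hy
      rw [Finset.prod_eq_zero (Finset.mem_univ j) (Set.indicator_of_notMem hj _)]
      simp
  simp_rw [h3]
  have hnn : ∀ j t, 0 ≤ (s j).indicator (fun t => Real.exp (a j * t - a j ^ 2 / 2)) t :=
    fun j t => Set.indicator_nonneg (fun _ _ => (Real.exp_pos _).le) _
  rw [← ofReal_integral_eq_lintegral_ofReal]
  · unfold stdGauss
    rw [integral_fintype_prod_eq_prod
      (fun j t => (s j).indicator (fun t => Real.exp (a j * t - a j ^ 2 / 2)) t),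
      ENNReal.ofReal_prod_of_nonneg fun j _ => integral_nonneg (hnn j)]
    refine Finset.prod_congr rfl fun j _ => ?_
    rw [h1, withDensity_apply _ (hs j), ← lintegral_indicator (hs j),
      ofReal_integral_eq_lintegral_ofReal (hint _ _ (hs j)) (ae_of_all _ (hnn j))]
    congr 1
    ext t
    by_cases ht : t ∈ s j <;> simp [ht]
  · exact Integrable.fintype_prod fun j => hint _ _ (hs j)
  · exact ae_of_all _ fun y => Finset.prod_nonneg fun j _ => hnn j _

lemma integral_add_stdGauss (a : J → ℝ) {f : (J → ℝ) → ℝ} (hf : PolyGrowth f) :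
    Integrable (fun y => Real.exp (∑ j, (a j * y j - a j ^ 2 / 2)) * f y) (stdGauss J) ∧
    ∫ ω, f (ω + a) ∂(stdGauss J) =
      ∫ y, Real.exp (∑ j, (a j * y j - a j ^ 2 / 2)) * f y ∂(stdGauss J) := by
  have hm : Measurable fun y : J → ℝ =>
      ENNReal.ofReal (Real.exp (∑ j, (a j * y j - a j ^ 2 / 2))) := by fun_prop
  have hma : Measurable fun ω : J → ℝ => ω + a := by fun_prop
  constructor
  · have h : Integrable f ((stdGauss J).map (fun ω => ω + a)) := by
      rw [integrable_map_measure hf.1.aestronglyMeasurable hma.aemeasurable]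
      exact (hf.comp_pi fun j => (PolyGrowth.of_eval j).add (PolyGrowth.const (a j))).integrable _
    rw [stdGauss_map_add, integrable_withDensity_iff_integrable_smul' hm
      (ae_of_all _ fun _ => ENNReal.ofReal_lt_top)] at h
    refine h.congr (ae_of_all _ fun y => ?_)
    simp [ENNReal.toReal_ofReal (Real.exp_pos _).le]
  · rw [← integral_map hma.aemeasurable hf.1.aestronglyMeasurable, stdGauss_map_add,
      integral_withDensity_eq_integral_toReal_smul hm (ae_of_all _ fun _ => ENNReal.ofReal_lt_top)]
    refine integral_congr_ae (ae_of_all _ fun y => ?_)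
    simp [ENNReal.toReal_ofReal (Real.exp_pos _).le]

/-- A coordinatewise mixture `c ω + s ω'` with `c² + s² = 1` of two independent standard Gaussian
vectors is a standard Gaussian vector. -/
lemma stdGauss_map_mix (c s : J → ℝ) (h : ∀ j, c j ^ 2 + s j ^ 2 = 1) :
    ((stdGauss J).prod (stdGauss J)).map (fun q j => c j * q.1 j + s j * q.2 j) = stdGauss J := by
  have h1 : ∀ a b : ℝ, a ^ 2 + b ^ 2 = 1 →
      ((gaussianReal 0 1).prod (gaussianReal 0 1)).map (fun q : ℝ × ℝ => a * q.1 + b * q.2) =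
        gaussianReal 0 1 := by
    intro a b hab
    have e := gaussianReal_conv_gaussianReal (m₁ := a * 0) (m₂ := b * 0)
      (v₁ := .mk (a ^ 2) (sq_nonneg _) * 1) (v₂ := .mk (b ^ 2) (sq_nonneg _) * 1)
    rw [← gaussianReal_map_const_mul, ← gaussianReal_map_const_mul, Measure.conv,
      Measure.map_prod_map _ _ (by fun_prop) (by fun_prop), Measure.map_map (by fun_prop)
        (by fun_prop)] at e
    have e2 : ((fun x : ℝ × ℝ => x.1 + x.2) ∘ Prod.map (fun x => a * x) fun x => b * x) =
        fun q : ℝ × ℝ => a * q.1 + b * q.2 := rfl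
    rw [e2] at e
    rw [e]
    congr 1
    · simp
    · ext; simpa using hab
  have h2 := (measurePreserving_arrowProdEquivProdArrow ℝ ℝ J (fun _ => gaussianReal 0 1)
    (fun _ => gaussianReal 0 1)).map_eq
  unfold stdGauss
  rw [← h2, Measure.map_map (by fun_prop) (by fun_prop)]
  have h3 := Measure.pi_map_pi (μ := fun _ : J => (gaussianReal 0 1).prod (gaussianReal 0 1))
    (f := fun j (q : ℝ × ℝ) => c j * q.1 + s j * q.2) (fun j => by fun_prop)
  simp_rw [h1 _ _ (h _)] at h3
  rw [← h3]
  rfl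

lemma integral_mix_stdGauss (c s : J → ℝ) (h : ∀ j, c j ^ 2 + s j ^ 2 = 1) {f : (J → ℝ) → ℝ}
    (hf : PolyGrowth f) :
    ∫ q : (J → ℝ) × (J → ℝ), f (fun j => c j * q.1 j + s j * q.2 j)
      ∂((stdGauss J).prod (stdGauss J)) = ∫ ω, f ω ∂(stdGauss J) := by
  conv_rhs => rw [← stdGauss_map_mix c s h]
  rw [integral_map (by fun_prop) hf.1.aestronglyMeasurable]

/-- **Gaussian Poincaré inequality**, with the gradient `d` of `f` specified by the chain rule along
curves. The correlation `Q θ = 𝔼 f(ω) f(cos θ ω + sin θ ω')` interpolates between `𝔼 f²` and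
`(𝔼 f)²`, and integration by parts bounds its derivative by `sin θ` times the Dirichlet energy. -/
lemma poincare_stdGauss {f : (J → ℝ) → ℝ} {d : J → (J → ℝ) → ℝ} (hf : PolyGrowth f)
    (hd : ∀ j, PolyGrowth (d j))
    (hfd : ∀ (u : ℝ → J → ℝ) (u' : J → ℝ) (t : ℝ), (∀ j, HasDerivAt (fun t => u t j) (u' j) t) →
      HasDerivAt (fun t => f (u t)) (∑ j, u' j * d j (u t)) t) :
    ∫ ω, f ω ^ 2 ∂(stdGauss J) - (∫ ω, f ω ∂(stdGauss J)) ^ 2 ≤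
      ∑ j, ∫ ω, d j ω ^ 2 ∂(stdGauss J) := by
  classical
  set γ := stdGauss J with hγ
  set D := ∑ j, ∫ ω, d j ω ^ 2 ∂γ with hD
  let W := (J → ℝ) × (J → ℝ)
  have hcos : PolyGrowth (fun v : ℝ × W => Real.cos v.1) :=
    .of_le (by fun_prop) (.const 1) fun v => Real.abs_cos_le_one _
  have hsin : PolyGrowth (fun v : ℝ × W => Real.sin v.1) :=
    .of_le (by fun_prop) (.const 1) fun v => Real.abs_sin_le_one _
  have he1 : ∀ j, PolyGrowth (fun v : ℝ × W => v.2.1 j) := fun j =>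
    ((PolyGrowth.of_eval j).comp_fst (W := J → ℝ)).comp_snd
  have he2 : ∀ j, PolyGrowth (fun v : ℝ × W => v.2.2 j) := fun j =>
    ((PolyGrowth.of_eval j).comp_snd (W := J → ℝ)).comp_snd
  let rot : ℝ × W → J → ℝ := fun v j => Real.cos v.1 * v.2.1 j + Real.sin v.1 * v.2.2 j
  have hrot : ∀ j, PolyGrowth (fun v => rot v j) := fun j =>
    (hcos.mul (he1 j)).add (hsin.mul (he2 j))
  let q : ℝ × W → ℝ := fun v => f v.2.1 * f (rot v)
  let q' : ℝ × W → ℝ := fun v => f v.2.1 *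
    ∑ j, (-Real.sin v.1 * v.2.1 j + Real.cos v.1 * v.2.2 j) * d j (rot v)
  have hf1 : PolyGrowth (fun v : ℝ × W => f v.2.1) := (hf.comp_fst (W := J → ℝ)).comp_snd
  have hq : PolyGrowth q := hf1.mul (hf.comp_pi hrot)
  have hq' : PolyGrowth q' := hf1.mul (.sum _ fun j _ =>
    (((hsin.neg).mul (he1 j)).add (hcos.mul (he2 j))).mul ((hd j).comp_pi hrot))
  have hder : ∀ θ v, HasDerivAt (fun θ => q (θ, v)) (q' (θ, v)) θ := by
    intro θ v
    have h : ∀ j, HasDerivAt (fun θ => rot (θ, v) j)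
        (-Real.sin θ * v.1 j + Real.cos θ * v.2 j) θ := fun j =>
      ((Real.hasDerivAt_cos θ).mul_const (v.1 j)).fun_add
        ((Real.hasDerivAt_sin θ).mul_const (v.2 j))
    exact (hfd (fun θ => rot (θ, v)) _ θ h).const_mul (f v.1)
  have hQ := PolyGrowth.hasDerivAt_integral hq hq' (γ.prod γ) hder
  -- undo the rotation, then integrate by parts in the second variable
  have hQ' : ∀ θ, ∫ v, q' (θ, v) ∂(γ.prod γ) = -Real.sin θ * ∑ j, ∫ v : W, d j v.1 *
      d j (fun j => Real.cos θ * v.1 j + -Real.sin θ * v.2 j) ∂(γ.prod γ) := by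
    intro θ
    let bk : W → J → ℝ := fun v j => Real.cos θ * v.1 j + -Real.sin θ * v.2 j
    have hbk : ∀ j, PolyGrowth (fun v => bk v j) := fun j =>
      (((PolyGrowth.of_eval j).comp_fst).const_mul _).add
        (((PolyGrowth.of_eval j).comp_snd).const_mul _)
    have hterm : ∀ j, PolyGrowth (fun v : W => d j v.1 * (v.2 j * f (bk v))) := fun j =>
      ((hd j).comp_fst).mul (((PolyGrowth.of_eval j).comp_snd).mul (hf.comp_pi hbk))
    have hterm2 : ∀ j, PolyGrowth (fun v : W => d j v.1 * d j (bk v)) := fun j =>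
      ((hd j).comp_fst).mul ((hd j).comp_pi hbk)
    let H : W → ℝ := fun v => ∑ j, d j v.1 * (v.2 j * f (bk v))
    have hH : PolyGrowth H := .sum _ fun j _ => hterm j
    have e1 : ∫ v, q' (θ, v) ∂(γ.prod γ) = ∫ v, H v ∂(γ.prod γ) := by
      have hr := IsGaussian.map_rotation_eq_self (μ := γ) integral_id_stdGauss θ
      conv_rhs => rw [← hr]
      rw [integral_map (by fun_prop) hH.1.aestronglyMeasurable]
      refine integral_congr_ae (ae_of_all _ fun v => ?_)
      have hcs := Real.sin_sq_add_cos_sq θ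
      have hb : bk (ContinuousLinearMap.rotation θ v) = v.1 := by
        ext j
        simp only [bk, ContinuousLinearMap.rotation_apply, Pi.add_apply, Pi.smul_apply,
          smul_eq_mul]
        linear_combination (v.1 j) * hcs
      simp only [q', H, hb, Finset.mul_sum]
      refine Finset.sum_congr rfl fun j _ => ?_
      have hr1 : (ContinuousLinearMap.rotation θ v).1 = rot (θ, v) := by
        ext j; simp [rot, ContinuousLinearMap.rotation_apply]
      have hr2 : (ContinuousLinearMap.rotation θ v).2 j =
          -Real.sin θ * v.1 j + Real.cos θ * v.2 j := by
        simp [ContinuousLinearMap.rotation_apply]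
      rw [hr1, hr2]; ring
    rw [e1]
    simp only [H]
    rw [integral_finsetSum _ fun j _ => (hterm j).integrable _, Finset.mul_sum]
    refine Finset.sum_congr rfl fun j _ => ?_
    rw [integral_prod _ ((hterm j).integrable _), integral_prod _ ((hterm2 j).integrable _),
      ← integral_const_mul]
    congr 1
    ext a
    simp only
    rw [integral_const_mul, integral_const_mul,
      integral_eval_mul_stdGauss j (f' := fun b => -Real.sin θ * d j (bk (a, b)))
        ((hf.comp_pi hbk).slice_left a) (((hd j).comp_pi hbk).slice_left a |>.const_mul _),
      integral_const_mul]
    · ring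
    · intro b t
      refine (hfd (fun t => bk (a, Function.update b j t))
        (fun i => -Real.sin θ * (Pi.single j 1 : J → ℝ) i) t fun i => ?_).congr_deriv ?_
      · exact ((hasDerivAt_update_eval b i j t).const_mul (-Real.sin θ)).const_add
          (Real.cos θ * a i)
      · simp [Pi.single_apply]
  -- both factors have the law of `d j`, so the correlation is at most the energy
  have hbound : ∀ θ, ∑ j, ∫ v : W, d j v.1 *
      d j (fun j => Real.cos θ * v.1 j + -Real.sin θ * v.2 j) ∂(γ.prod γ) ≤ D := by
    intro θ
    refine Finset.sum_le_sum fun j _ => ?_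
    have hbk : ∀ j, PolyGrowth (fun v : W => Real.cos θ * v.1 j + -Real.sin θ * v.2 j) := fun j =>
      (((PolyGrowth.of_eval j).comp_fst).const_mul _).add
        (((PolyGrowth.of_eval j).comp_snd).const_mul _)
    have h1 : ∫ v : W, d j v.1 ^ 2 ∂(γ.prod γ) = ∫ ω, d j ω ^ 2 ∂γ := by
      rw [integral_prod _ (((hd j).pow 2).comp_fst.integrable _)]
      simp
    have h2 : ∫ v : W, d j (fun j => Real.cos θ * v.1 j + -Real.sin θ * v.2 j) ^ 2 ∂(γ.prod γ) =
        ∫ ω, d j ω ^ 2 ∂γ :=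
      integral_mix_stdGauss (fun _ => Real.cos θ) (fun _ => -Real.sin θ)
        (fun _ => by rw [neg_sq]; exact Real.cos_sq_add_sin_sq θ) ((hd j).pow 2)
    have h3 : ∫ v : W, d j v.1 * d j (fun j => Real.cos θ * v.1 j + -Real.sin θ * v.2 j)
        ∂(γ.prod γ) ≤ ∫ v : W, (d j v.1 ^ 2 / 2 +
          d j (fun j => Real.cos θ * v.1 j + -Real.sin θ * v.2 j) ^ 2 / 2) ∂(γ.prod γ) := by
      refine integral_mono (((hd j).comp_fst.mul ((hd j).comp_pi hbk)).integrable _)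
        ((((hd j).pow 2).comp_fst.div_const 2).add
          ((((hd j).comp_pi hbk).pow 2).div_const 2) |>.integrable _) fun v => ?_
      simp only
      nlinarith [sq_nonneg (d j v.1 - d j (fun j => Real.cos θ * v.1 j + -Real.sin θ * v.2 j))]
    rw [integral_add ((((hd j).pow 2).comp_fst.div_const 2).integrable _)
      (((((hd j).comp_pi hbk).pow 2).div_const 2).integrable _), integral_div, integral_div,
      h1, h2] at h3
    linarith
  have hmono : MonotoneOn (fun θ => ∫ v, q (θ, v) ∂(γ.prod γ) - D * Real.cos θ)
      (Set.Icc 0 (Real.pi / 2)) := by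
    have hdd : ∀ θ, HasDerivAt (fun θ => ∫ v, q (θ, v) ∂(γ.prod γ) - D * Real.cos θ)
        (∫ v, q' (θ, v) ∂(γ.prod γ) - D * -Real.sin θ) θ := fun θ =>
      (hQ θ).sub ((Real.hasDerivAt_cos θ).const_mul D)
    refine monotoneOn_of_deriv_nonneg (convex_Icc _ _)
      (fun θ _ => (hdd θ).continuousAt.continuousWithinAt)
      (fun θ _ => (hdd θ).differentiableAt.differentiableWithinAt) fun θ hθ => ?_
    rw [interior_Icc] at hθ
    have hs : 0 ≤ Real.sin θ := Real.sin_nonneg_of_nonneg_of_le_pi hθ.1.le (by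
      linarith [hθ.2, Real.pi_pos])
    rw [(hdd θ).deriv, hQ' θ]
    nlinarith [hbound θ]
  -- compare `θ = 0` with `θ = π / 2`
  have hfin := hmono (Set.left_mem_Icc.2 (by positivity)) (Set.right_mem_Icc.2 (by positivity))
    (by positivity)
  have h0 : ∫ v, q (0, v) ∂(γ.prod γ) = ∫ ω, f ω ^ 2 ∂γ := by
    rw [integral_prod _ ((hq.slice_left 0).integrable _)]
    simp [q, rot, sq]
  have h1 : ∫ v, q (Real.pi / 2, v) ∂(γ.prod γ) = (∫ ω, f ω ∂γ) ^ 2 := by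
    have : ∀ v : W, q (Real.pi / 2, v) = f v.1 * f v.2 := fun v => by simp [q, rot]
    simp_rw [this]
    rw [integral_prod_mul, sq]
  simp only [h0, h1, Real.cos_zero, Real.cos_pi_div_two, mul_one, mul_zero, sub_zero] at hfin
  linarith

end

/-! ### Gibbs averages over a finite set -/

section Gibbs

variable {Ω : Type*} [Fintype Ω] {p e q r : Ω → ℝ}

/-- A probability weight on a finite set. -/
structure IsWeight (p : Ω → ℝ) : Prop where
  nonneg : ∀ x, 0 ≤ p x
  sum_eq : ∑ x, p x = 1

/-- The partition function `∑ p e^e`. -/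
def partitionFn (p e : Ω → ℝ) : ℝ := ∑ x, p x * Real.exp (e x)

/-- The average of `q` under the probability proportional to `p e^e`. -/
def gibbs (p e q : Ω → ℝ) : ℝ := (∑ x, p x * Real.exp (e x) * q x) / partitionFn p e

lemma IsWeight.le_one (hp : IsWeight p) (x : Ω) : p x ≤ 1 := by
  rw [← hp.sum_eq]
  exact Finset.single_le_sum (fun x _ => hp.nonneg x) (Finset.mem_univ x)

lemma partitionFn_bounds (hp : ∀ x, 0 ≤ p x) :
    (∑ x, p x) * Real.exp (-∑ x, |e x|) ≤ partitionFn p e ∧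
      partitionFn p e ≤ (∑ x, p x) * Real.exp (∑ x, |e x|) := by
  have h : ∀ x, |e x| ≤ ∑ x, |e x| := fun x =>
    Finset.single_le_sum (f := fun x => |e x|) (fun x _ => abs_nonneg _) (Finset.mem_univ x)
  unfold partitionFn
  rw [Finset.sum_mul, Finset.sum_mul]
  constructor <;> refine Finset.sum_le_sum fun x _ => mul_le_mul_of_nonneg_left ?_ (hp x) <;>
    rw [Real.exp_le_exp]
  · linarith [h x, neg_abs_le (e x)]
  · linarith [h x, le_abs_self (e x)]

lemma partitionFn_pos_of_sum_pos (hp : ∀ x, 0 ≤ p x) (hs : 0 < ∑ x, p x) : 0 < partitionFn p e :=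
  (mul_pos hs (Real.exp_pos _)).trans_le (partitionFn_bounds hp).1

lemma partitionFn_pos (hp : IsWeight p) : 0 < partitionFn p e :=
  partitionFn_pos_of_sum_pos hp.nonneg (by simp [hp.sum_eq])

lemma abs_log_partitionFn_le (hp : ∀ x, 0 ≤ p x) (hs : 0 < ∑ x, p x) :
    |Real.log (partitionFn p e)| ≤ |Real.log (∑ x, p x)| + ∑ x, |e x| := by
  obtain ⟨h1, h2⟩ := partitionFn_bounds (e := e) hp
  have h3 := Real.log_le_log (mul_pos hs (Real.exp_pos _)) h1
  have h4 := Real.log_le_log (partitionFn_pos_of_sum_pos hp hs) h2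
  rw [Real.log_mul hs.ne' (Real.exp_pos _).ne', Real.log_exp] at h3 h4
  rw [abs_le]
  constructor
  · linarith [neg_abs_le (Real.log (∑ x, p x))]
  · linarith [le_abs_self (Real.log (∑ x, p x))]

lemma gibbs_add : gibbs p e (fun x => q x + r x) = gibbs p e q + gibbs p e r := by
  simp only [gibbs, mul_add, Finset.sum_add_distrib, add_div]

lemma gibbs_sub : gibbs p e (fun x => q x - r x) = gibbs p e q - gibbs p e r := by
  simp only [gibbs, mul_sub, Finset.sum_sub_distrib, sub_div]

lemma gibbs_const_mul (a : ℝ) : gibbs p e (fun x => a * q x) = a * gibbs p e q := by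
  simp only [gibbs, ← mul_div_assoc, Finset.mul_sum]
  congr 1
  exact Finset.sum_congr rfl fun x _ => by ring

lemma gibbs_mul_const (a : ℝ) : gibbs p e (fun x => q x * a) = gibbs p e q * a := by
  simp_rw [mul_comm _ a]
  exact gibbs_const_mul a

lemma gibbs_sum {ι : Type*} (s : Finset ι) (q : ι → Ω → ℝ) :
    gibbs p e (fun x => ∑ i ∈ s, q i x) = ∑ i ∈ s, gibbs p e (q i) := by
  simp only [gibbs, Finset.mul_sum, ← Finset.sum_div]
  rw [Finset.sum_comm]

lemma gibbs_const (hp : IsWeight p) (a : ℝ) : gibbs p e (fun _ => a) = a := by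
  unfold gibbs
  rw [← Finset.sum_mul, ← partitionFn]
  field_simp [(partitionFn_pos hp (e := e)).ne']

lemma gibbs_mono (hp : IsWeight p) (h : ∀ x, q x ≤ r x) : gibbs p e q ≤ gibbs p e r :=
  div_le_div_of_nonneg_right (Finset.sum_le_sum fun x _ =>
    mul_le_mul_of_nonneg_left (h x) (mul_nonneg (hp.nonneg x) (Real.exp_pos _).le))
    (partitionFn_pos hp).le

lemma gibbs_nonneg (hp : IsWeight p) (h : ∀ x, 0 ≤ q x) : 0 ≤ gibbs p e q := by
  rw [← gibbs_const (e := e) hp 0]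
  exact gibbs_mono hp h

lemma abs_gibbs_le (hp : IsWeight p) : |gibbs p e q| ≤ gibbs p e (fun x => |q x|) := by
  rw [abs_le]
  constructor
  · have h := gibbs_mono (e := e) hp fun x => neg_abs_le (q x)
    have h2 := gibbs_const_mul (p := p) (e := e) (q := fun x => |q x|) (-1)
    simp only [neg_mul, one_mul] at h2
    rwa [h2] at h
  · exact gibbs_mono hp fun x => le_abs_self _

lemma abs_gibbs_le_sum (hp : IsWeight p) : |gibbs p e q| ≤ ∑ x, |q x| := by
  refine (abs_gibbs_le hp).trans ?_
  rw [← gibbs_const (e := e) hp (∑ x, |q x|)]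
  exact gibbs_mono hp fun x =>
    Finset.single_le_sum (f := fun x => |q x|) (fun x _ => abs_nonneg _) (Finset.mem_univ x)

lemma gibbs_sq_sub_eq (hp : IsWeight p) :
    gibbs p e (fun x => (q x - gibbs p e q) ^ 2) =
      gibbs p e (fun x => q x ^ 2) - gibbs p e q ^ 2 := by
  have h : (fun x => (q x - gibbs p e q) ^ 2) =
      fun x => (q x ^ 2 - (2 * gibbs p e q) * q x) + gibbs p e q ^ 2 := by ext x; ring
  rw [h, gibbs_add, gibbs_sub, gibbs_const_mul, gibbs_const hp]
  ring

lemma sq_gibbs_le (hp : IsWeight p) : gibbs p e q ^ 2 ≤ gibbs p e (fun x => q x ^ 2) := by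
  have := gibbs_sq_sub_eq (e := e) (q := q) hp
  have h := gibbs_nonneg (e := e) (q := fun x => (q x - gibbs p e q) ^ 2) hp fun x => sq_nonneg _
  linarith

/-- Adding a constant to the exponent does not change the average. -/
lemma gibbs_exponent_add_const (e : Ω → ℝ) (a : ℝ) :
    gibbs p (fun x => e x + a) q = gibbs p e q := by
  have h1 : ∑ x, p x * Real.exp (e x + a) * q x = Real.exp a * ∑ x, p x * Real.exp (e x) * q x := by
    rw [Finset.mul_sum]
    exact Finset.sum_congr rfl fun x _ => by rw [Real.exp_add]; ring
  have h2 : partitionFn p (fun x => e x + a) = Real.exp a * partitionFn p e := by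
    unfold partitionFn
    rw [Finset.mul_sum]
    exact Finset.sum_congr rfl fun x _ => by rw [Real.exp_add]; ring
  unfold gibbs
  rw [h1, h2, mul_div_mul_left _ _ (Real.exp_pos a).ne']

section Calculus

variable {e' q' : Ω → ℝ} {t : ℝ}

lemma hasDerivAt_partitionFn {e : ℝ → Ω → ℝ} (he : ∀ x, HasDerivAt (fun t => e t x) (e' x) t) :
    HasDerivAt (fun t => partitionFn p (e t)) (∑ x, p x * Real.exp (e t x) * e' x) t := by
  unfold partitionFn
  refine HasDerivAt.fun_sum fun x _ => ?_
  refine ((he x).exp.const_mul (p x)).congr_deriv (by ring)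

lemma hasDerivAt_log_partitionFn (hp : IsWeight p) {e : ℝ → Ω → ℝ}
    (he : ∀ x, HasDerivAt (fun t => e t x) (e' x) t) :
    HasDerivAt (fun t => Real.log (partitionFn p (e t))) (gibbs p (e t) e') t :=
  (hasDerivAt_partitionFn he).log (partitionFn_pos hp).ne'

lemma hasDerivAt_gibbs (hp : IsWeight p) {e q : ℝ → Ω → ℝ}
    (he : ∀ x, HasDerivAt (fun t => e t x) (e' x) t)
    (hq : ∀ x, HasDerivAt (fun t => q t x) (q' x) t) :
    HasDerivAt (fun t => gibbs p (e t) (q t))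
      (gibbs p (e t) q' + gibbs p (e t) (fun x => q t x * e' x) -
        gibbs p (e t) (q t) * gibbs p (e t) e') t := by
  have hZ := (partitionFn_pos hp (e := e t)).ne'
  have h1 : HasDerivAt (fun t => ∑ x, p x * Real.exp (e t x) * q t x)
      (∑ x, (p x * Real.exp (e t x) * q' x + p x * Real.exp (e t x) * (q t x * e' x))) t := by
    refine HasDerivAt.fun_sum fun x _ => ?_
    refine (((he x).exp.const_mul (p x)).fun_mul (hq x)).congr_deriv (by ring)
  refine (h1.div (hasDerivAt_partitionFn he) hZ).congr_deriv ?_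
  rw [Finset.sum_add_distrib]
  unfold gibbs
  field_simp

end Calculus

section Growth

variable {V : Type*} [NormedAddCommGroup V] {e q : Ω → V → ℝ}

lemma PolyGrowth.log_partitionFn (hp : ∀ x, 0 ≤ p x) (hs : 0 < ∑ x, p x)
    (he : ∀ x, PolyGrowth (e x)) :
    PolyGrowth (fun v => Real.log (partitionFn p (fun x => e x v))) := by
  have hc := fun x => (he x).1
  refine .of_le ?_ ((PolyGrowth.const |Real.log (∑ x, p x)|).add
    (.sum Finset.univ fun x _ => (he x).abs)) fun v => abs_log_partitionFn_le hp hs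
  refine Continuous.log ?_ fun v => (partitionFn_pos_of_sum_pos hp hs).ne'
  unfold partitionFn
  fun_prop

lemma PolyGrowth.gibbs (hp : IsWeight p) (he : ∀ x, PolyGrowth (e x))
    (hq : ∀ x, PolyGrowth (q x)) :
    PolyGrowth (fun v => RLE.gibbs p (fun x => e x v) (fun x => q x v)) := by
  have hc := fun x => (he x).1
  have hc2 := fun x => (hq x).1
  refine .of_le ?_ (.sum Finset.univ fun x _ => (hq x).abs) fun v => abs_gibbs_le_sum hp
  unfold RLE.gibbs
  refine Continuous.div (by fun_prop) ?_ fun v => (partitionFn_pos hp).ne'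
  unfold partitionFn
  fun_prop

end Growth

end Gibbs

/-! ### Expectations over a finite signal and a Gaussian vector -/

section Expect

variable {Ω J : Type*} [Fintype Ω] [Fintype J] {p : Ω → ℝ} {f g : Ω → (J → ℝ) → ℝ}

/-- The expectation of `f s ω` for `s` of law `p` and `ω` an independent standard Gaussian
vector. -/
def expect (p : Ω → ℝ) (f : Ω → (J → ℝ) → ℝ) : ℝ := ∑ s, p s * ∫ ω, f s ω ∂(stdGauss J)

lemma expect_add (hf : ∀ s, PolyGrowth (f s)) (hg : ∀ s, PolyGrowth (g s)) :
    expect p (fun s ω => f s ω + g s ω) = expect p f + expect p g := by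
  simp only [expect, ← Finset.sum_add_distrib, ← mul_add]
  refine Finset.sum_congr rfl fun s _ => ?_
  rw [integral_add ((hf s).integrable _) ((hg s).integrable _)]

lemma expect_sub (hf : ∀ s, PolyGrowth (f s)) (hg : ∀ s, PolyGrowth (g s)) :
    expect p (fun s ω => f s ω - g s ω) = expect p f - expect p g := by
  simp only [expect, ← Finset.sum_sub_distrib, ← mul_sub]
  refine Finset.sum_congr rfl fun s _ => ?_
  rw [integral_sub ((hf s).integrable _) ((hg s).integrable _)]

lemma expect_const_mul (a : ℝ) : expect p (fun s ω => a * f s ω) = a * expect p f := by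
  simp only [expect, Finset.mul_sum]
  refine Finset.sum_congr rfl fun s _ => ?_
  rw [integral_const_mul]; ring

lemma expect_sum {ι : Type*} (t : Finset ι) {f : ι → Ω → (J → ℝ) → ℝ}
    (hf : ∀ i s, PolyGrowth (f i s)) :
    expect p (fun s ω => ∑ i ∈ t, f i s ω) = ∑ i ∈ t, expect p (f i) := by
  simp only [expect]
  rw [Finset.sum_comm]
  refine Finset.sum_congr rfl fun s _ => ?_
  rw [integral_finsetSum _ fun i _ => (hf i s).integrable _, Finset.mul_sum]

lemma expect_const (hp : IsWeight p) (a : ℝ) : expect p (fun _ (_ : J → ℝ) => a) = a := by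
  simp [expect, ← Finset.sum_mul, hp.sum_eq]

lemma expect_mono (hp : IsWeight p) (hf : ∀ s, PolyGrowth (f s)) (hg : ∀ s, PolyGrowth (g s))
    (h : ∀ s ω, f s ω ≤ g s ω) : expect p f ≤ expect p g :=
  Finset.sum_le_sum fun s _ => mul_le_mul_of_nonneg_left
    (integral_mono ((hf s).integrable _) ((hg s).integrable _) (h s)) (hp.nonneg s)

lemma expect_nonneg (hp : IsWeight p) (h : ∀ s ω, 0 ≤ f s ω) : 0 ≤ expect p f :=
  Finset.sum_nonneg fun s _ => mul_nonneg (hp.nonneg s) (integral_nonneg (h s))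

lemma abs_expect_le (hp : IsWeight p) (hf : ∀ s, PolyGrowth (f s)) :
    |expect p f| ≤ expect p (fun s ω => |f s ω|) := by
  rw [abs_le]
  constructor
  · have h := expect_mono (p := p) hp (fun s => (hf s).abs.neg) hf fun s ω => neg_abs_le (f s ω)
    have h2 := expect_const_mul (p := p) (f := fun s ω => |f s ω|) (-1)
    simp only [neg_mul, one_mul] at h2
    rwa [h2] at h
  · exact expect_mono hp hf (fun s => (hf s).abs) fun s ω => le_abs_self _

lemma sq_expect_le (hp : IsWeight p) (hf : ∀ s, PolyGrowth (f s)) :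
    expect p f ^ 2 ≤ expect p (fun s ω => f s ω ^ 2) := by
  have h : 0 ≤ expect p (fun s ω => (f s ω - expect p f) ^ 2) :=
    expect_nonneg hp fun s ω => sq_nonneg _
  have h2 : (fun s ω => (f s ω - expect p f) ^ 2) =
      fun s ω => (f s ω ^ 2 - (2 * expect p f) * f s ω) + expect p f ^ 2 := by
    ext s ω; ring
  rw [h2, expect_add (fun s => ((hf s).pow 2).sub ((hf s).const_mul _)) (fun s => .const _),
    expect_sub (fun s => (hf s).pow 2) (fun s => (hf s).const_mul _), expect_const_mul,
    expect_const hp] at h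
  linarith

lemma expect_abs_le_sqrt (hp : IsWeight p) (hf : ∀ s, PolyGrowth (f s)) :
    expect p (fun s ω => |f s ω|) ≤ √(expect p (fun s ω => f s ω ^ 2)) := by
  refine Real.le_sqrt_of_sq_le ((sq_expect_le hp fun s => (hf s).abs).trans (le_of_eq ?_))
  simp only [sq_abs]

end Expect

/-! ### The linear Gaussian model with a side channel -/

/-- A signal with finitely many values: the `s`-th value `X s` has probability `p s`; `c` is the
standard deviation of the entries of the measurement matrix. -/
structure Signal (Ω N : Type*) [Fintype Ω] where
  /-- the probabilities -/
  p : Ω → ℝ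
  /-- the values -/
  X : Ω → N → ℝ
  /-- the scale of the matrix entries -/
  c : ℝ
  isWeight : IsWeight p

/-- Gaussian coordinates of the model with `R` rows: the entries of the (standardized) matrix,
the noise of the measurements, the noise of the side channel. -/
abbrev Coord (R N : Type*) := (R × N) ⊕ (R ⊕ N)

section Exponent

variable {R N : Type*} [Fintype R] [Fintype N]

/-- The vector `Φ v`, for the matrix `Φ` with entries `c ω_{μ i}`. -/
def field (c : ℝ) (v : N → ℝ) (ω : Coord R N → ℝ) (μ : R) : ℝ :=
  c * ∑ i, ω (.inl (μ, i)) * v i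

/-- The exponent of the posterior weight of a configuration at displacement `v` from the signal:
`h` is the square root of the signal-to-noise ratio of the measurements, `g` that of the side
channel. -/
def expo (c : ℝ) (t : ℝ × ℝ) (ω : Coord R N → ℝ) (v : N → ℝ) : ℝ :=
  ∑ μ, (t.1 * field c v ω μ * ω (.inr (.inl μ)) - (t.1 * field c v ω μ) ^ 2 / 2) +
    ∑ i, (t.2 * v i * ω (.inr (.inr i)) - (t.2 * v i) ^ 2 / 2)

/-- The derivative of `expo` in `h`. -/
def expoDerivMeas (c h : ℝ) (ω : Coord R N → ℝ) (v : N → ℝ) : ℝ :=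
  ∑ μ, (field c v ω μ * ω (.inr (.inl μ)) - h * field c v ω μ ^ 2)

/-- The derivative of `expo` in `g`. -/
def expoDerivSide (g : ℝ) (ω : Coord R N → ℝ) (v : N → ℝ) : ℝ :=
  ∑ i, (v i * ω (.inr (.inr i)) - g * v i ^ 2)

/-- The gradient of `expo` in the Gaussian coordinates. -/
def expoGrad (c : ℝ) (t : ℝ × ℝ) (ω : Coord R N → ℝ) (v : N → ℝ) : Coord R N → ℝ
  | .inl (μ, i) => t.1 * c * v i * (ω (.inr (.inl μ)) - t.1 * field c v ω μ)
  | .inr (.inl μ) => t.1 * field c v ω μ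
  | .inr (.inr i) => t.2 * v i

lemma hasDerivAt_expo_meas (c : ℝ) (g : ℝ) (ω : Coord R N → ℝ) (v : N → ℝ) (h : ℝ) :
    HasDerivAt (fun h => expo c (h, g) ω v) (expoDerivMeas c h ω v) h := by
  have H : HasDerivAt (fun h => ∑ μ, (h * field c v ω μ * ω (.inr (.inl μ)) -
      (h * field c v ω μ) ^ 2 / 2)) (expoDerivMeas c h ω v) h := by
    refine HasDerivAt.fun_sum fun μ _ => HasDerivAt.congr_deriv
      ((((hasDerivAt_id h).mul_const (field c v ω μ)).mul_const (ω (.inr (.inl μ)))).fun_sub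
      ((((hasDerivAt_id h).mul_const (field c v ω μ)).pow 2).div_const 2)) ?_
    simp
    ring
  simp only [expo]
  exact H.add_const _

lemma hasDerivAt_expo_side (c : ℝ) (h : ℝ) (ω : Coord R N → ℝ) (v : N → ℝ) (g : ℝ) :
    HasDerivAt (fun g => expo c (h, g) ω v) (expoDerivSide g ω v) g := by
  have H : HasDerivAt (fun g => ∑ i, (g * v i * ω (.inr (.inr i)) - (g * v i) ^ 2 / 2))
      (expoDerivSide g ω v) g := by
    refine HasDerivAt.fun_sum fun i _ => HasDerivAt.congr_deriv
      ((((hasDerivAt_id g).mul_const (v i)).mul_const (ω (.inr (.inr i)))).fun_sub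
      ((((hasDerivAt_id g).mul_const (v i)).pow 2).div_const 2)) ?_
    simp
    ring
  simp only [expo]
  exact H.const_add _

lemma hasDerivAt_expoDerivMeas (c : ℝ) (ω : Coord R N → ℝ) (v : N → ℝ) (h : ℝ) :
    HasDerivAt (fun h => expoDerivMeas c h ω v) (-∑ μ, field c v ω μ ^ 2) h := by
  unfold expoDerivMeas
  rw [← Finset.sum_neg_distrib]
  refine HasDerivAt.fun_sum fun μ _ => ?_
  refine HasDerivAt.congr_deriv
    (((hasDerivAt_id h).mul_const (field c v ω μ ^ 2)).const_sub _) ?_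
  simp

lemma hasDerivAt_field {R N : Type*} [Fintype N] (c : ℝ) (v : N → ℝ) {u : ℝ → Coord R N → ℝ}
    {u' : Coord R N → ℝ} {t : ℝ}
    (hu : ∀ j, HasDerivAt (fun t => u t j) (u' j) t) (μ : R) :
    HasDerivAt (fun t => field c v (u t) μ) (field c v u' μ) t := by
  unfold field
  exact (HasDerivAt.fun_sum fun i _ => (hu (.inl (μ, i))).mul_const (v i)).const_mul c

lemma hasDerivAt_expo_curve (c : ℝ) (k : ℝ × ℝ) (v : N → ℝ) {u : ℝ → Coord R N → ℝ}
    {u' : Coord R N → ℝ} {t : ℝ} (hu : ∀ j, HasDerivAt (fun t => u t j) (u' j) t) :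
    HasDerivAt (fun t => expo c k (u t) v) (∑ j, u' j * expoGrad c k (u t) v j) t := by
  have h1 : HasDerivAt (fun t => expo c k (u t) v)
      (∑ μ, (k.1 * field c v u' μ * u t (.inr (.inl μ)) + k.1 * field c v (u t) μ *
        u' (.inr (.inl μ)) - k.1 ^ 2 * field c v (u t) μ * field c v u' μ) +
        ∑ i, k.2 * v i * u' (.inr (.inr i))) t := by
    unfold expo
    refine HasDerivAt.fun_add (HasDerivAt.fun_sum fun μ _ => ?_)
      (HasDerivAt.fun_sum fun i _ => ?_)
    · refine HasDerivAt.congr_deriv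
        ((((hasDerivAt_field c v hu μ).const_mul k.1).fun_mul (hu (.inr (.inl μ)))).fun_sub
        ((((hasDerivAt_field c v hu μ).const_mul k.1).fun_pow 2).div_const 2)) ?_
      simp
      ring
    · exact ((hu (.inr (.inr i))).const_mul (k.2 * v i)).sub_const _
  refine h1.congr_deriv ?_
  rw [Fintype.sum_sum_type, Fintype.sum_sum_type, Fintype.sum_prod_type, ← add_assoc,
    ← Finset.sum_add_distrib]
  congr 1
  · refine Finset.sum_congr rfl fun μ _ => ?_
    simp only [expoGrad]
    have : ∑ i, u' (.inl (μ, i)) * (k.1 * c * v i *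
        (u t (.inr (.inl μ)) - k.1 * field c v (u t) μ)) =
        k.1 * (u t (.inr (.inl μ)) - k.1 * field c v (u t) μ) * field c v u' μ := by
      rw [field.eq_def c v u', Finset.mul_sum, Finset.mul_sum]
      exact Finset.sum_congr rfl fun i _ => by ring
    rw [this]
    ring
  · exact Finset.sum_congr rfl fun i _ => by simp only [expoGrad]; ring

lemma PolyGrowth.field (c : ℝ) (v : N → ℝ) (μ : R) :
    PolyGrowth (fun ω : Coord R N → ℝ => RLE.field c v ω μ) :=
  (PolyGrowth.sum _ fun _ _ => (PolyGrowth.of_eval _).mul (.const _)).const_mul _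

/-- Functions of the signal-to-noise parameters and of the Gaussian coordinates live on this
space. -/
abbrev ParamSpace (R N : Type*) := (ℝ × ℝ) × (Coord R N → ℝ)

lemma PolyGrowth.param_fst : PolyGrowth (fun v : ParamSpace R N => v.1.1) :=
  (PolyGrowth.id_real.comp_fst (W := ℝ)).comp_fst

lemma PolyGrowth.param_snd : PolyGrowth (fun v : ParamSpace R N => v.1.2) :=
  (PolyGrowth.id_real.comp_snd (W := ℝ)).comp_fst

lemma PolyGrowth.coord (j : Coord R N) : PolyGrowth (fun v : ParamSpace R N => v.2 j) :=
  (PolyGrowth.of_eval j).comp_snd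

lemma PolyGrowth.expo (c : ℝ) (v : N → ℝ) :
    PolyGrowth (fun z : ParamSpace R N => RLE.expo c z.1 z.2 v) := by
  have hf : ∀ μ, PolyGrowth (fun z : ParamSpace R N => z.1.1 * RLE.field c v z.2 μ) := fun μ =>
    param_fst.mul (PolyGrowth.field c v μ).comp_snd
  have hg : ∀ i, PolyGrowth (fun z : ParamSpace R N => z.1.2 * v i) := fun i =>
    param_snd.mul (.const _)
  exact (PolyGrowth.sum _ fun μ _ => ((hf μ).mul (coord _)).sub (((hf μ).pow 2).div_const 2)).add
    (PolyGrowth.sum _ fun i _ => ((hg i).mul (coord _)).sub (((hg i).pow 2).div_const 2))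

lemma PolyGrowth.expoDerivMeas (c : ℝ) (v : N → ℝ) :
    PolyGrowth (fun z : ParamSpace R N => RLE.expoDerivMeas c z.1.1 z.2 v) :=
  PolyGrowth.sum _ fun μ _ => ((PolyGrowth.field c v μ).comp_snd.mul (coord _)).sub
    (param_fst.mul ((PolyGrowth.field c v μ).comp_snd.pow 2))

lemma PolyGrowth.expoDerivSide (v : N → ℝ) :
    PolyGrowth (fun z : ParamSpace R N => RLE.expoDerivSide z.1.2 z.2 v) :=
  PolyGrowth.sum _ fun i _ => ((PolyGrowth.const (v i)).mul (coord _)).sub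
    (param_snd.mul (.const _))

lemma PolyGrowth.expoGrad (c : ℝ) (v : N → ℝ) (j : Coord R N) :
    PolyGrowth (fun z : ParamSpace R N => RLE.expoGrad c z.1 z.2 v j) := by
  match j with
  | .inl (μ, i) =>
    exact (((param_fst.mul (.const c)).mul (.const (v i))).mul
      ((coord _).sub (param_fst.mul (PolyGrowth.field c v μ).comp_snd)))
  | .inr (.inl μ) => exact param_fst.mul (PolyGrowth.field c v μ).comp_snd
  | .inr (.inr i) => exact param_snd.mul (.const _)

lemma PolyGrowth.slice_meas {W : Type*} [NormedAddCommGroup W] {f : (ℝ × ℝ) × W → ℝ}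
    (hf : PolyGrowth f) (g : ℝ) : PolyGrowth (fun v : ℝ × W => f ((v.1, g), v.2)) :=
  hf.comp_prod (a := fun v : ℝ × W => (v.1, g)) (by fun_prop) continuous_snd
    (.of_le (by fun_prop) (PolyGrowth.norm_comp_fst.add (.const ‖g‖)) fun v => by
      rw [abs_norm]; exact max_le_add_of_nonneg (norm_nonneg _) (norm_nonneg _))
    PolyGrowth.norm_comp_snd

lemma PolyGrowth.slice_side {W : Type*} [NormedAddCommGroup W] {f : (ℝ × ℝ) × W → ℝ}
    (hf : PolyGrowth f) (h : ℝ) : PolyGrowth (fun v : ℝ × W => f ((h, v.1), v.2)) :=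
  hf.comp_prod (a := fun v : ℝ × W => (h, v.1)) (by fun_prop) continuous_snd
    (.of_le (by fun_prop) ((PolyGrowth.const ‖h‖).add PolyGrowth.norm_comp_fst) fun v => by
      rw [abs_norm]; exact max_le_add_of_nonneg (norm_nonneg _) (norm_nonneg _))
    PolyGrowth.norm_comp_snd

end Exponent

namespace Signal

variable {Ω R N : Type*} [Fintype Ω] [Fintype R] [Fintype N] (𝒮 : Signal Ω N)

/-- The displacement of the configuration `x` from the signal `s`. -/
def disp (s x : Ω) : N → ℝ := fun i => 𝒮.X x i - 𝒮.X s i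

/-- The posterior average of `q` when the signal is `s`. -/
def post (t : ℝ × ℝ) (s : Ω) (ω : Coord R N → ℝ) (q : Ω → ℝ) : ℝ :=
  gibbs 𝒮.p (fun x => expo 𝒮.c t ω (𝒮.disp s x)) q

/-- The log-partition function of the posterior, normalized so that the signal itself has
exponent `0`. -/
def logZ (t : ℝ × ℝ) (s : Ω) (ω : Coord R N → ℝ) : ℝ :=
  Real.log (partitionFn 𝒮.p (fun x => expo 𝒮.c t ω (𝒮.disp s x)))

lemma polyGrowth_post {q : Ω → ParamSpace R N → ℝ} (hq : ∀ x, PolyGrowth (q x)) (s : Ω) :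
    PolyGrowth (fun v : ParamSpace R N => 𝒮.post v.1 s v.2 (fun x => q x v)) :=
  PolyGrowth.gibbs 𝒮.isWeight (fun x => PolyGrowth.expo 𝒮.c (𝒮.disp s x)) hq

lemma polyGrowth_logZ (s : Ω) : PolyGrowth (fun v : ParamSpace R N => 𝒮.logZ v.1 s v.2) :=
  PolyGrowth.log_partitionFn 𝒮.isWeight.nonneg (by rw [𝒮.isWeight.sum_eq]; exact one_pos)
    (fun x => PolyGrowth.expo 𝒮.c (𝒮.disp s x))

lemma polyGrowth_post_slice (t : ℝ × ℝ) {q : Ω → (Coord R N → ℝ) → ℝ}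
    (hq : ∀ x, PolyGrowth (q x)) (s : Ω) :
    PolyGrowth (fun ω : Coord R N → ℝ => 𝒮.post t s ω (fun x => q x ω)) :=
  (𝒮.polyGrowth_post (fun x => (hq x).comp_snd) s).slice_left t

lemma hasDerivAt_logZ_meas (s : Ω) (ω : Coord R N → ℝ) (g h : ℝ) :
    HasDerivAt (fun h => 𝒮.logZ (h, g) s ω)
      (𝒮.post (h, g) s ω fun x => expoDerivMeas 𝒮.c h ω (𝒮.disp s x)) h :=
  hasDerivAt_log_partitionFn 𝒮.isWeight fun x => hasDerivAt_expo_meas 𝒮.c g ω (𝒮.disp s x) h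

lemma hasDerivAt_logZ_side (s : Ω) (ω : Coord R N → ℝ) (h g : ℝ) :
    HasDerivAt (fun g => 𝒮.logZ (h, g) s ω)
      (𝒮.post (h, g) s ω fun x => expoDerivSide g ω (𝒮.disp s x)) g :=
  hasDerivAt_log_partitionFn 𝒮.isWeight fun x => hasDerivAt_expo_side 𝒮.c h ω (𝒮.disp s x) g

lemma hasDerivAt_post_meas (s : Ω) (ω : Coord R N → ℝ) (g h : ℝ) :
    HasDerivAt (fun h => 𝒮.post (h, g) s ω fun x => expoDerivMeas 𝒮.c h ω (𝒮.disp s x))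
      (𝒮.post (h, g) s ω (fun x => expoDerivMeas 𝒮.c h ω (𝒮.disp s x) ^ 2) -
        (𝒮.post (h, g) s ω fun x => expoDerivMeas 𝒮.c h ω (𝒮.disp s x)) ^ 2 -
        𝒮.post (h, g) s ω (fun x => ∑ μ, field 𝒮.c (𝒮.disp s x) ω μ ^ 2)) h := by
  refine (hasDerivAt_gibbs 𝒮.isWeight (fun x => hasDerivAt_expo_meas 𝒮.c g ω (𝒮.disp s x) h)
    (fun x => hasDerivAt_expoDerivMeas 𝒮.c ω (𝒮.disp s x) h)).congr_deriv ?_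
  have h1 := gibbs_const_mul (p := 𝒮.p) (e := fun x => expo 𝒮.c (h, g) ω (𝒮.disp s x))
    (q := fun x => ∑ μ, field 𝒮.c (𝒮.disp s x) ω μ ^ 2) (-1)
  simp only [neg_mul, one_mul] at h1
  rw [h1]
  simp only [post, sq]
  ring

lemma hasDerivAt_logZ_curve (t : ℝ × ℝ) (s : Ω) {u : ℝ → Coord R N → ℝ} {u' : Coord R N → ℝ}
    {τ : ℝ} (hu : ∀ j, HasDerivAt (fun τ => u τ j) (u' j) τ) :
    HasDerivAt (fun τ => 𝒮.logZ t s (u τ))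
      (∑ j, u' j * 𝒮.post t s (u τ) fun x => expoGrad 𝒮.c t (u τ) (𝒮.disp s x) j) τ := by
  refine (hasDerivAt_log_partitionFn 𝒮.isWeight fun x =>
    hasDerivAt_expo_curve 𝒮.c t (𝒮.disp s x) hu).congr_deriv ?_
  rw [gibbs_sum]
  exact Finset.sum_congr rfl fun j _ => gibbs_const_mul _

variable [DecidableEq R] [DecidableEq N]

/-- Gaussian integration by parts for a posterior average, along a coordinate on which the
observable does not depend. -/
lemma integral_eval_mul_post (t : ℝ × ℝ) (s : Ω) (j : Coord R N) {q : Ω → (Coord R N → ℝ) → ℝ}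
    (hq : ∀ x, PolyGrowth (q x)) (hj : ∀ x ω a, q x (Function.update ω j a) = q x ω) :
    ∫ ω, ω j * 𝒮.post t s ω (fun x => q x ω) ∂(stdGauss (Coord R N)) =
      ∫ ω, (𝒮.post t s ω (fun x => q x ω * expoGrad 𝒮.c t ω (𝒮.disp s x) j) -
        𝒮.post t s ω (fun x => q x ω) *
          𝒮.post t s ω (fun x => expoGrad 𝒮.c t ω (𝒮.disp s x) j)) ∂(stdGauss (Coord R N)) := by
  have hg : ∀ x, PolyGrowth (fun ω : Coord R N → ℝ => expoGrad 𝒮.c t ω (𝒮.disp s x) j) := fun x =>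
    (PolyGrowth.expoGrad 𝒮.c (𝒮.disp s x) j).slice_left t
  refine integral_eval_mul_stdGauss j (𝒮.polyGrowth_post_slice t hq s)
    ((𝒮.polyGrowth_post_slice t (fun x => (hq x).mul (hg x)) s).sub
      ((𝒮.polyGrowth_post_slice t hq s).mul (𝒮.polyGrowth_post_slice t hg s))) fun ω a => ?_
  have he : ∀ x, HasDerivAt (fun a => expo 𝒮.c t (Function.update ω j a) (𝒮.disp s x))
      (expoGrad 𝒮.c t (Function.update ω j a) (𝒮.disp s x) j) a := fun x =>
    (hasDerivAt_expo_curve 𝒮.c t (𝒮.disp s x) fun i => hasDerivAt_update_eval ω i j a).congr_deriv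
      (by simp [Pi.single_apply])
  have hq0 : ∀ x, HasDerivAt (fun a => q x (Function.update ω j a)) 0 a := fun x => by
    simp_rw [hj]; exact hasDerivAt_const _ _
  refine (hasDerivAt_gibbs 𝒮.isWeight he hq0).congr_deriv ?_
  rw [gibbs_const 𝒮.isWeight, zero_add]
  rfl

end Signal

lemma integral_stdGauss_sum {A B : Type*} [Fintype A] [Fintype B] {f : (A ⊕ B → ℝ) → ℝ}
    (hf : PolyGrowth f) :
    Integrable (fun φ => ∫ z, f (Sum.elim φ z) ∂(stdGauss B)) (stdGauss A) ∧
    ∫ ω, f ω ∂(stdGauss (A ⊕ B)) = ∫ φ, ∫ z, f (Sum.elim φ z) ∂(stdGauss B) ∂(stdGauss A) := by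
  have h := measurePreserving_sumPiEquivProdPi_symm (X := fun _ : A ⊕ B => ℝ)
    (fun _ : A ⊕ B => gaussianReal 0 1)
  have he : ∀ q : (A → ℝ) × (B → ℝ),
      (MeasurableEquiv.sumPiEquivProdPi (fun _ : A ⊕ B => ℝ)).symm q = Sum.elim q.1 q.2 := by
    intro q; ext j; cases j <;> rfl
  have hP : PolyGrowth (fun q : (A → ℝ) × (B → ℝ) => f (Sum.elim q.1 q.2)) := by
    refine hf.comp_pi fun j => ?_
    cases j with
    | inl a => exact (PolyGrowth.of_eval a).comp_fst
    | inr b => exact (PolyGrowth.of_eval b).comp_snd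
  have hi := hP.integrable ((stdGauss A).prod (stdGauss B))
  refine ⟨hi.integral_prod_left, ?_⟩
  rw [← integral_prod _ hi]
  have h2 := h.integral_comp (MeasurableEquiv.measurableEmbedding _) f
  unfold stdGauss
  rw [← h2]
  simp_rw [he]

namespace Signal

variable {Ω R N : Type*} [Fintype Ω] [Fintype R] [Fintype N] (𝒮 : Signal Ω N)

/-! ### The Nishimori identity -/

/-- The observed data: the matrix, and the noisy outputs of both channels for the signal `s`. -/
def obs (t : ℝ × ℝ) (s : Ω) (ω : Coord R N → ℝ) : Coord R N → ℝ
  | .inl a => ω (.inl a)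
  | .inr (.inl μ) => ω (.inr (.inl μ)) + t.1 * field 𝒮.c (𝒮.X s) ω μ
  | .inr (.inr i) => ω (.inr (.inr i)) + t.2 * 𝒮.X s i

lemma field_obs (t : ℝ × ℝ) (s : Ω) (ω : Coord R N → ℝ) (c : ℝ) (v : N → ℝ) :
    field c v (𝒮.obs t s ω) = field c v ω := rfl

lemma field_disp (s x : Ω) (ω : Coord R N → ℝ) (μ : R) :
    field 𝒮.c (𝒮.disp s x) ω μ = field 𝒮.c (𝒮.X x) ω μ - field 𝒮.c (𝒮.X s) ω μ := by
  simp only [field, disp, mul_sub, Finset.sum_sub_distrib]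

lemma expo_disp (t : ℝ × ℝ) (s x : Ω) (ω : Coord R N → ℝ) :
    expo 𝒮.c t ω (𝒮.disp s x) = expo 𝒮.c t (𝒮.obs t s ω) (𝒮.X x) +
      -expo 𝒮.c t (𝒮.obs t s ω) (𝒮.X s) := by
  simp only [expo, field_obs, field_disp]
  simp only [obs, disp]
  rw [neg_add, ← Finset.sum_neg_distrib, ← Finset.sum_neg_distrib, add_add_add_comm,
    ← Finset.sum_add_distrib, ← Finset.sum_add_distrib]
  congr 1 <;> exact Finset.sum_congr rfl fun _ _ => by ring

/-- The posterior is a function of the observed data. -/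
lemma post_eq_gibbs_obs (t : ℝ × ℝ) (s : Ω) (ω : Coord R N → ℝ) (q : Ω → ℝ) :
    𝒮.post t s ω q = gibbs 𝒮.p (fun x => expo 𝒮.c t (𝒮.obs t s ω) (𝒮.X x)) q := by
  unfold post
  simp_rw [expo_disp]
  exact gibbs_exponent_add_const _ _

lemma polyGrowth_obs (t : ℝ × ℝ) (s : Ω) (j : Coord R N) :
    PolyGrowth (fun ω => 𝒮.obs t s ω j) := by
  match j with
  | .inl a => exact PolyGrowth.of_eval _
  | .inr (.inl μ) => exact (PolyGrowth.of_eval _).add ((PolyGrowth.field _ _ _).const_mul _)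
  | .inr (.inr i) => exact (PolyGrowth.of_eval _).add (.const _)

/-- **Nishimori identity**: jointly with the data, a sample from the posterior has the same law as
the signal. -/
lemma nishimori (t : ℝ × ℝ) {Ψ : Ω → (Coord R N → ℝ) → ℝ} (hΨ : ∀ x, PolyGrowth (Ψ x)) :
    expect 𝒮.p (fun s ω => Ψ s (𝒮.obs t s ω)) =
      expect 𝒮.p (fun s ω => 𝒮.post t s ω fun x => Ψ x (𝒮.obs t s ω)) := by
  simp_rw [post_eq_gibbs_obs]
  let G : (Coord R N → ℝ) → ℝ := fun y => gibbs 𝒮.p (fun x => expo 𝒮.c t y (𝒮.X x)) fun x => Ψ x y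
  have hG : PolyGrowth G := PolyGrowth.gibbs 𝒮.isWeight
    (fun x => (PolyGrowth.expo 𝒮.c (𝒮.X x)).slice_left t) hΨ
  let a : (R × N → ℝ) → Ω → (R ⊕ N → ℝ) := fun φ s =>
    Sum.elim (fun μ => t.1 * field 𝒮.c (𝒮.X s) (Sum.elim φ 0) μ) (fun i => t.2 * 𝒮.X s i)
  have hobs : ∀ φ s z, 𝒮.obs t s (Sum.elim φ z) = Sum.elim φ (z + a φ s) := by
    intro φ s z
    ext j
    match j with
    | .inl _ => rfl
    | .inr (.inl _) => rfl
    | .inr (.inr _) => rfl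
  have hexpo : ∀ φ s z, ∑ j, (a φ s j * z j - a φ s j ^ 2 / 2) =
      expo 𝒮.c t (Sum.elim φ z) (𝒮.X s) := by
    intro φ s z
    rw [Fintype.sum_sum_type]
    rfl
  have hsl : ∀ {f : (Coord R N → ℝ) → ℝ}, PolyGrowth f → ∀ φ : R × N → ℝ,
      PolyGrowth (fun z : R ⊕ N → ℝ => f (Sum.elim φ z)) := by
    intro f hf φ
    refine hf.comp_pi fun j => ?_
    cases j with
    | inl b => exact PolyGrowth.const _
    | inr b => exact PolyGrowth.of_eval b
  -- for a fixed matrix, shift the noise by the signal; both sides become integrals over the data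
  have key : ∀ φ, ∑ s, 𝒮.p s * ∫ z, Ψ s (𝒮.obs t s (Sum.elim φ z)) ∂(stdGauss (R ⊕ N)) =
      ∑ s, 𝒮.p s * ∫ z, G (𝒮.obs t s (Sum.elim φ z)) ∂(stdGauss (R ⊕ N)) := by
    intro φ
    have h1 := fun s => integral_add_stdGauss (a φ s) (hsl (hΨ s) φ)
    have h2 := fun s => integral_add_stdGauss (a φ s) (hsl hG φ)
    simp_rw [hobs]
    have e1 := fun s => (h1 s).2
    have e2 := fun s => (h2 s).2
    simp_rw [e1, e2, ← integral_const_mul]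
    rw [← integral_finsetSum _ fun s _ => (h1 s).1.const_mul _,
      ← integral_finsetSum _ fun s _ => (h2 s).1.const_mul _]
    congr 1
    ext z
    simp_rw [hexpo, ← mul_assoc]
    rw [← Finset.sum_mul]
    have hZ := (partitionFn_pos 𝒮.isWeight
      (e := fun x => expo 𝒮.c t (Sum.elim φ z) (𝒮.X x))).ne'
    simp only [G, gibbs]
    rw [← mul_div_assoc, eq_div_iff hZ, partitionFn]
    ring
  have hcomp : ∀ {f : (Coord R N → ℝ) → ℝ}, PolyGrowth f → ∀ s,
      PolyGrowth (fun ω => f (𝒮.obs t s ω)) := fun hf s => hf.comp_pi (𝒮.polyGrowth_obs t s)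
  unfold expect
  have f1 := fun s => integral_stdGauss_sum (hcomp (hΨ s) s)
  have f2 := fun s => integral_stdGauss_sum (hcomp hG s)
  calc _ = ∫ φ, ∑ s, 𝒮.p s * ∫ z, Ψ s (𝒮.obs t s (Sum.elim φ z)) ∂(stdGauss (R ⊕ N))
        ∂(stdGauss (R × N)) := by
        rw [integral_finsetSum _ fun s _ => (f1 s).1.const_mul _]
        refine Finset.sum_congr rfl fun s _ => ?_
        rw [(f1 s).2, integral_const_mul]
    _ = ∫ φ, ∑ s, 𝒮.p s * ∫ z, G (𝒮.obs t s (Sum.elim φ z)) ∂(stdGauss (R ⊕ N))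
        ∂(stdGauss (R × N)) := by simp_rw [key]
    _ = _ := by
        rw [integral_finsetSum _ fun s _ => (f2 s).1.const_mul _]
        refine Finset.sum_congr rfl fun s _ => ?_
        rw [integral_const_mul]
        congr 1
        exact (f2 s).2.symm

section Observable

variable {q : Ω → (Coord R N → ℝ) → ℝ} (t : ℝ × ℝ)

/-- The mean square error of the posterior mean is the expected posterior variance. -/
lemma expect_sq_post_sub (hq : ∀ x, PolyGrowth (q x))
    (hobs : ∀ x s ω, q x (𝒮.obs t s ω) = q x ω) :
    expect 𝒮.p (fun s ω => (𝒮.post t s ω fun x => q x ω - q s ω) ^ 2) =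
      expect 𝒮.p (fun s ω => (𝒮.post t s ω fun x => (q x ω - q s ω) ^ 2) -
        (𝒮.post t s ω fun x => q x ω - q s ω) ^ 2) := by
  let A : (Coord R N → ℝ) → ℝ := fun y => gibbs 𝒮.p (fun x => expo 𝒮.c t y (𝒮.X x)) fun x => q x y
  have hA : PolyGrowth A := PolyGrowth.gibbs 𝒮.isWeight
    (fun x => (PolyGrowth.expo 𝒮.c (𝒮.X x)).slice_left t) hq
  have hAo : ∀ s ω, A (𝒮.obs t s ω) = 𝒮.post t s ω (fun x => q x ω) := by
    intro s ω
    simp only [A, hobs, post_eq_gibbs_obs]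
  have n1 := 𝒮.nishimori t (Ψ := fun x y => q x y ^ 2) fun x => (hq x).pow 2
  have n2 := 𝒮.nishimori t (Ψ := fun x y => A y * q x y) fun x => hA.mul (hq x)
  simp only [hobs, hAo] at n1 n2
  have hp1 : ∀ s, PolyGrowth (fun ω : Coord R N → ℝ => 𝒮.post t s ω fun x => q x ω) :=
    fun s => 𝒮.polyGrowth_post_slice t hq s
  have hp2 : ∀ s, PolyGrowth (fun ω : Coord R N → ℝ => 𝒮.post t s ω fun x => q x ω ^ 2) :=
    fun s => 𝒮.polyGrowth_post_slice t (fun x => (hq x).pow 2) s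
  have e0 : ∀ (s : Ω) (ω : Coord R N → ℝ), (𝒮.post t s ω fun x => q x ω - q s ω) =
      𝒮.post t s ω (fun x => q x ω) - q s ω := by
    intro s ω
    unfold post
    rw [gibbs_sub, gibbs_const 𝒮.isWeight]
  have e1 : ∀ (s : Ω) (ω : Coord R N → ℝ), (𝒮.post t s ω fun x => (q x ω - q s ω) ^ 2) =
      𝒮.post t s ω (fun x => q x ω ^ 2) - (2 * q s ω) * 𝒮.post t s ω (fun x => q x ω) +
        q s ω ^ 2 := by
    intro s ω
    have : (fun x => (q x ω - q s ω) ^ 2) =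
        fun x => (q x ω ^ 2 - (2 * q s ω) * q x ω) + q s ω ^ 2 := by ext x; ring
    unfold post
    rw [this, gibbs_add, gibbs_sub, gibbs_const 𝒮.isWeight, gibbs_const_mul]
  have e2 : ∀ (s : Ω) (ω : Coord R N → ℝ),
      (𝒮.post t s ω fun x => 𝒮.post t s ω (fun x => q x ω) * q x ω) =
        𝒮.post t s ω (fun x => q x ω) ^ 2 := by
    intro s ω
    rw [sq]
    exact gibbs_const_mul _
  simp only [e2] at n2
  simp only [e0, e1]
  have c1 : (fun (s : Ω) (ω : Coord R N → ℝ) => (𝒮.post t s ω (fun x => q x ω) - q s ω) ^ 2) =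
      fun s ω => (𝒮.post t s ω (fun x => q x ω) ^ 2 -
        2 * (𝒮.post t s ω (fun x => q x ω) * q s ω)) + q s ω ^ 2 := by ext s ω; ring
  have c2 : (fun (s : Ω) (ω : Coord R N → ℝ) => 𝒮.post t s ω (fun x => q x ω ^ 2) -
      (2 * q s ω) * 𝒮.post t s ω (fun x => q x ω) + q s ω ^ 2 -
        (𝒮.post t s ω (fun x => q x ω) - q s ω) ^ 2) =
      fun s ω => 𝒮.post t s ω (fun x => q x ω ^ 2) - 𝒮.post t s ω (fun x => q x ω) ^ 2 := by
    ext s ω; ring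
  rw [c1, c2, expect_add (fun s => ((hp1 s).pow 2).sub (((hp1 s).mul (hq s)).const_mul _))
    (fun s => (hq s).pow 2), expect_sub (fun s => (hp1 s).pow 2)
    (fun s => ((hp1 s).mul (hq s)).const_mul _), expect_const_mul,
    expect_sub hp2 (fun s => (hp1 s).pow 2), n1, n2]
  ring

lemma expect_post_sq_sub_le (hq : ∀ x, PolyGrowth (q x))
    (hobs : ∀ x s ω, q x (𝒮.obs t s ω) = q x ω) :
    expect 𝒮.p (fun s ω => 𝒮.post t s ω fun x => (q x ω - q s ω) ^ 2) ≤
      4 * expect 𝒮.p (fun s ω => q s ω ^ 2) := by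
  have n1 := 𝒮.nishimori t (Ψ := fun x y => q x y ^ 2) fun x => (hq x).pow 2
  simp only [hobs] at n1
  have hp2 : ∀ s, PolyGrowth (fun ω : Coord R N → ℝ => 𝒮.post t s ω fun x => q x ω ^ 2) :=
    fun s => 𝒮.polyGrowth_post_slice t (fun x => (hq x).pow 2) s
  have h1 : expect 𝒮.p (fun s ω => 𝒮.post t s ω fun x => (q x ω - q s ω) ^ 2) ≤
      expect 𝒮.p (fun s ω => 2 * 𝒮.post t s ω (fun x => q x ω ^ 2) + 2 * q s ω ^ 2) := by
    refine expect_mono 𝒮.isWeight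
      (fun s => 𝒮.polyGrowth_post_slice t (fun x => ((hq x).sub (hq s)).pow 2) s)
      (fun s => ((hp2 s).const_mul _).add (((hq s).pow 2).const_mul _)) fun s ω => ?_
    unfold post
    rw [← gibbs_const_mul, ← gibbs_const (e := fun x => expo 𝒮.c t ω (𝒮.disp s x)) 𝒮.isWeight
      (2 * q s ω ^ 2), ← gibbs_add]
    refine gibbs_mono 𝒮.isWeight fun x => ?_
    nlinarith [sq_nonneg (q x ω + q s ω)]
  rw [expect_add (fun s => (hp2 s).const_mul _) (fun s => ((hq s).pow 2).const_mul _),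
    expect_const_mul, expect_const_mul, ← n1] at h1
  linarith

end Observable

end Signal

section Expect

variable {Ω J : Type*} [Fintype Ω] [Fintype J] {p : Ω → ℝ}

lemma hasDerivAt_expect {f f' : Ω → ℝ × (J → ℝ) → ℝ} (hf : ∀ s, PolyGrowth (f s))
    (hf' : ∀ s, PolyGrowth (f' s))
    (hd : ∀ s t ω, HasDerivAt (fun t => f s (t, ω)) (f' s (t, ω)) t) (t : ℝ) :
    HasDerivAt (fun t => expect p (fun s ω => f s (t, ω))) (expect p fun s ω => f' s (t, ω)) t :=
  HasDerivAt.fun_sum fun s _ =>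
    (PolyGrowth.hasDerivAt_integral (hf s) (hf' s) (stdGauss J) (hd s) t).const_mul (p s)

lemma continuous_expect {T : Type*} [NormedAddCommGroup T] {f : Ω → T × (J → ℝ) → ℝ}
    (hf : ∀ s, PolyGrowth (f s)) : Continuous (fun t => expect p (fun s ω => f s (t, ω))) :=
  continuous_finsetSum _ fun s _ =>
    ((hf s).continuous_integral (stdGauss J)).const_mul (p s)

end Expect

namespace Signal

variable {Ω R N : Type*} [Fintype Ω] [Fintype R] [Fintype N] (𝒮 : Signal Ω N)

/-! ### Monotonicity of the mean square error under degradation -/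

/-- The posterior mean is the optimal estimator in mean square. -/
lemma expect_sq_post_sub_le (t : ℝ × ℝ) (q : Ω → ℝ) {K : (Coord R N → ℝ) → ℝ}
    (hK : PolyGrowth K) :
    expect 𝒮.p (fun s (ω : Coord R N → ℝ) => (𝒮.post t s ω q - q s) ^ 2) ≤
      expect 𝒮.p (fun s ω => (K (𝒮.obs t s ω) - q s) ^ 2) := by
  let A : (Coord R N → ℝ) → ℝ := fun y => gibbs 𝒮.p (fun x => expo 𝒮.c t y (𝒮.X x)) q
  have hA : PolyGrowth A := PolyGrowth.gibbs 𝒮.isWeight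
    (fun x => (PolyGrowth.expo 𝒮.c (𝒮.X x)).slice_left t) fun x => .const _
  have hAo : ∀ s ω, A (𝒮.obs t s ω) = 𝒮.post t s ω q := fun s ω =>
    (𝒮.post_eq_gibbs_obs t s ω q).symm
  have n := 𝒮.nishimori t (Ψ := fun x y => (K y - A y) * (A y - q x))
    fun x => (hK.sub hA).mul (hA.sub (.const _))
  -- the error of the posterior mean is orthogonal to every function of the data
  have hz : ∀ (s : Ω) (ω : Coord R N → ℝ), (𝒮.post t s ω fun x =>
      (K (𝒮.obs t s ω) - A (𝒮.obs t s ω)) * (A (𝒮.obs t s ω) - q x)) = 0 := by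
    intro s ω
    unfold post
    rw [gibbs_const_mul, gibbs_sub, gibbs_const 𝒮.isWeight, hAo]
    unfold post
    ring
  simp only [hz, expect_const 𝒮.isWeight] at n
  have hAc := fun s => hA.comp_pi (𝒮.polyGrowth_obs t s)
  have hKc := fun s => hK.comp_pi (𝒮.polyGrowth_obs t s)
  have hcross : ∀ s, PolyGrowth (fun ω : Coord R N → ℝ =>
      2 * ((K (𝒮.obs t s ω) - A (𝒮.obs t s ω)) * (A (𝒮.obs t s ω) - q s))) := fun s =>
    (((hKc s).sub (hAc s)).mul ((hAc s).sub (.const _))).const_mul _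
  have h1 : expect 𝒮.p (fun s (ω : Coord R N → ℝ) => (A (𝒮.obs t s ω) - q s) ^ 2 +
      2 * ((K (𝒮.obs t s ω) - A (𝒮.obs t s ω)) * (A (𝒮.obs t s ω) - q s))) ≤
      expect 𝒮.p (fun s ω => (K (𝒮.obs t s ω) - q s) ^ 2) :=
    expect_mono 𝒮.isWeight (fun s => (((hAc s).sub (.const _)).pow 2).add (hcross s))
      (fun s => ((hKc s).sub (.const _)).pow 2) fun s ω => by
        nlinarith [sq_nonneg (K (𝒮.obs t s ω) - A (𝒮.obs t s ω))]
  rw [expect_add (fun s => ((hAc s).sub (.const _)).pow 2) hcross, expect_const_mul, n] at h1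
  simp only [hAo, mul_zero, add_zero] at h1
  exact h1

/-- Lowering the signal-to-noise ratios amounts to mixing fresh noise into the data, so it can only
increase the mean square error. -/
lemma expect_sq_post_sub_antitone (t : ℝ × ℝ) {a b : ℝ} (ha : a ^ 2 ≤ 1) (hb : b ^ 2 ≤ 1)
    (q : Ω → ℝ) :
    expect 𝒮.p (fun s (ω : Coord R N → ℝ) => (𝒮.post t s ω q - q s) ^ 2) ≤
      expect 𝒮.p (fun s (ω : Coord R N → ℝ) =>
        (𝒮.post (a * t.1, b * t.2) s ω q - q s) ^ 2) := by
  let t' : ℝ × ℝ := (a * t.1, b * t.2)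
  -- mixing weights: the matrix is kept, the noises are multiplied by `a` and `b` and topped up
  let cc : Coord R N → ℝ := Sum.elim (fun _ => 1) (Sum.elim (fun _ => a) (fun _ => b))
  let ss : Coord R N → ℝ :=
    Sum.elim (fun _ => 0) (Sum.elim (fun _ => √(1 - a ^ 2)) (fun _ => √(1 - b ^ 2)))
  have hcs : ∀ j, cc j ^ 2 + ss j ^ 2 = 1 := by
    intro j
    match j with
    | .inl _ => simp [cc, ss]
    | .inr (.inl _) =>
      simp only [cc, ss, Sum.elim_inr, Sum.elim_inl]
      rw [Real.sq_sqrt (by linarith)]; ring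
    | .inr (.inr _) =>
      simp only [cc, ss, Sum.elim_inr]
      rw [Real.sq_sqrt (by linarith)]; ring
  let mix : (Coord R N → ℝ) → (Coord R N → ℝ) → Coord R N → ℝ := fun y z j =>
    cc j * y j + ss j * z j
  have hfield : ∀ y z (v : N → ℝ) μ, field 𝒮.c v (mix y z) μ = field 𝒮.c v y μ := by
    intro y z v μ
    simp [field, mix, cc, ss]
  have hmix : ∀ s ω z, 𝒮.obs t' s (mix ω z) = mix (𝒮.obs t s ω) z := by
    intro s ω z
    ext j
    match j with
    | .inl _ => rfl
    | .inr (.inl μ) =>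
      simp only [obs, hfield]
      simp only [mix, cc, ss, t', obs, Sum.elim_inr, Sum.elim_inl]
      ring
    | .inr (.inr i) =>
      simp only [obs]
      simp only [mix, cc, ss, t', obs, Sum.elim_inr]
      ring
  -- the posterior mean of the degraded problem, an estimator that uses the mixed data
  let A : (Coord R N → ℝ) → ℝ := fun y => gibbs 𝒮.p (fun x => expo 𝒮.c t' y (𝒮.X x)) q
  have hA : PolyGrowth A := PolyGrowth.gibbs 𝒮.isWeight
    (fun x => (PolyGrowth.expo 𝒮.c (𝒮.X x)).slice_left t') fun x => .const _
  have hAo : ∀ s ω, 𝒮.post t' s ω q = A (𝒮.obs t' s ω) := fun s ω =>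
    𝒮.post_eq_gibbs_obs t' s ω q
  have hmixP : ∀ z j, PolyGrowth (fun y => mix y z j) := fun z j =>
    ((PolyGrowth.of_eval j).const_mul _).add (.const _)
  have hopt : ∀ z, expect 𝒮.p (fun s (ω : Coord R N → ℝ) => (𝒮.post t s ω q - q s) ^ 2) ≤
      expect 𝒮.p (fun s ω => (A (mix (𝒮.obs t s ω) z) - q s) ^ 2) := fun z =>
    𝒮.expect_sq_post_sub_le t q (K := fun y => A (mix y z)) (hA.comp_pi (hmixP z))
  have hE : ∀ s, PolyGrowth (fun ω => (A (𝒮.obs t' s ω) - q s) ^ 2) := fun s =>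
    ((hA.comp_pi (𝒮.polyGrowth_obs t' s)).sub (.const _)).pow 2
  have hE2 : ∀ s, PolyGrowth (fun v : (Coord R N → ℝ) × (Coord R N → ℝ) =>
      (A (𝒮.obs t' s (mix v.1 v.2)) - q s) ^ 2) := fun s =>
    (hE s).comp_pi fun j => ((PolyGrowth.of_eval j).comp_fst.const_mul _).add
      ((PolyGrowth.of_eval j).comp_snd.const_mul _)
  have hint := fun s => (hE2 s).integrable ((stdGauss (Coord R N)).prod (stdGauss (Coord R N)))
  have hR : expect 𝒮.p (fun s (ω : Coord R N → ℝ) => (𝒮.post t' s ω q - q s) ^ 2) =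
      ∫ z, expect 𝒮.p (fun s ω => (A (mix (𝒮.obs t s ω) z) - q s) ^ 2)
        ∂(stdGauss (Coord R N)) := by
    simp_rw [hAo]
    unfold expect
    rw [integral_finsetSum _ fun s _ => ?_]
    · refine Finset.sum_congr rfl fun s _ => ?_
      rw [integral_const_mul, ← integral_mix_stdGauss cc ss hcs (hE s),
        integral_prod_symm _ (hint s)]
      simp_rw [← hmix]
    · have h := (hint s).integral_prod_right.const_mul (𝒮.p s)
      simpa only [hmix] using h
  rw [show (a * t.1, b * t.2) = t' from rfl, hR]
  calc _ = ∫ _, expect 𝒮.p (fun s (ω : Coord R N → ℝ) => (𝒮.post t s ω q - q s) ^ 2)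
        ∂(stdGauss (Coord R N)) := by simp
    _ ≤ _ := by
      refine integral_mono (integrable_const _) ?_ hopt
      unfold expect
      refine integrable_finsetSum _ fun s _ => ?_
      have h := (hint s).integral_prod_right.const_mul (𝒮.p s)
      simpa only [hmix] using h

/-! ### Mean free energy and its derivatives -/

lemma post_disp (t : ℝ × ℝ) (s : Ω) (ω : Coord R N → ℝ) (i : N) :
    (𝒮.post t s ω fun x => 𝒮.disp s x i) = (𝒮.post t s ω fun x => 𝒮.X x i) - 𝒮.X s i := by
  unfold post disp
  rw [gibbs_sub, gibbs_const 𝒮.isWeight]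

variable (R) in
/-- The expected log-partition function, with `R` indexing the measurements. -/
def meanLogZ (t : ℝ × ℝ) : ℝ := expect 𝒮.p fun s (ω : Coord R N → ℝ) => 𝒮.logZ t s ω

variable (R) in
/-- The total mean square error `𝔼 ‖Φ (S - ⟨X⟩)‖²` of the noiseless measurements. -/
def measErr (t : ℝ × ℝ) : ℝ := expect 𝒮.p fun s (ω : Coord R N → ℝ) =>
  ∑ μ, (𝒮.post t s ω fun x => field 𝒮.c (𝒮.disp s x) ω μ) ^ 2

variable (R) in
/-- The total mean square error `𝔼 ‖S - ⟨X⟩‖²` of the signal. -/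
def sigErr (t : ℝ × ℝ) : ℝ := expect 𝒮.p fun s (ω : Coord R N → ℝ) =>
  ∑ i, (𝒮.post t s ω fun x => 𝒮.disp s x i) ^ 2

lemma polyGrowth_post_field (s : Ω) (μ : R) : PolyGrowth (fun v : ParamSpace R N =>
    𝒮.post v.1 s v.2 fun x => field 𝒮.c (𝒮.disp s x) v.2 μ) :=
  𝒮.polyGrowth_post (fun x => (PolyGrowth.field 𝒮.c (𝒮.disp s x) μ).comp_snd) s

lemma polyGrowth_post_disp (s : Ω) (i : N) : PolyGrowth (fun v : ParamSpace R N =>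
    𝒮.post v.1 s v.2 fun x => 𝒮.disp s x i) :=
  𝒮.polyGrowth_post (fun _ => .const _) s

lemma polyGrowth_post_deriv (s : Ω) : PolyGrowth (fun v : ParamSpace R N =>
    𝒮.post v.1 s v.2 fun x => expoDerivMeas 𝒮.c v.1.1 v.2 (𝒮.disp s x)) :=
  𝒮.polyGrowth_post (fun x => PolyGrowth.expoDerivMeas 𝒮.c (𝒮.disp s x)) s

lemma continuous_meanLogZ : Continuous (𝒮.meanLogZ R) :=
  continuous_expect (f := fun s v => 𝒮.logZ v.1 s v.2) fun s => 𝒮.polyGrowth_logZ s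

lemma continuous_measErr : Continuous (𝒮.measErr R) :=
  continuous_expect
    (f := fun s v => ∑ μ, (𝒮.post v.1 s v.2 fun x => field 𝒮.c (𝒮.disp s x) v.2 μ) ^ 2)
    fun s => .sum _ fun μ _ => (𝒮.polyGrowth_post_field s μ).pow 2

lemma continuous_sigErr : Continuous (𝒮.sigErr R) :=
  continuous_expect (f := fun s v => ∑ i, (𝒮.post v.1 s v.2 fun x => 𝒮.disp s x i) ^ 2)
    fun s => .sum _ fun i _ => (𝒮.polyGrowth_post_disp s i).pow 2

lemma measErr_nonneg (t : ℝ × ℝ) : 0 ≤ 𝒮.measErr R t :=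
  expect_nonneg 𝒮.isWeight fun _ _ => Finset.sum_nonneg fun _ _ => sq_nonneg _

lemma sigErr_nonneg (t : ℝ × ℝ) : 0 ≤ 𝒮.sigErr R t :=
  expect_nonneg 𝒮.isWeight fun _ _ => Finset.sum_nonneg fun _ _ => sq_nonneg _

lemma sigErr_antitone (t : ℝ × ℝ) {a b : ℝ} (ha : a ^ 2 ≤ 1) (hb : b ^ 2 ≤ 1) :
    𝒮.sigErr R t ≤ 𝒮.sigErr R (a * t.1, b * t.2) := by
  have hP : ∀ (t : ℝ × ℝ) (i : N) (s : Ω), PolyGrowth (fun ω : Coord R N → ℝ =>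
      (𝒮.post t s ω fun x => 𝒮.disp s x i) ^ 2) := fun t i s =>
    ((𝒮.polyGrowth_post_disp s i).slice_left t).pow 2
  unfold sigErr
  rw [expect_sum _ (hP t), expect_sum _ (hP _)]
  refine Finset.sum_le_sum fun i _ => ?_
  simp_rw [post_disp]
  have h := 𝒮.expect_sq_post_sub_antitone (R := R) t ha hb fun x => 𝒮.X x i
  exact h

variable [DecidableEq R] [DecidableEq N]

lemma expect_noise_mul_post_field (t : ℝ × ℝ) (μ : R) :
    expect 𝒮.p (fun s (ω : Coord R N → ℝ) => ω (.inr (.inl μ)) *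
        𝒮.post t s ω fun x => field 𝒮.c (𝒮.disp s x) ω μ) =
      t.1 * expect 𝒮.p (fun s (ω : Coord R N → ℝ) =>
        (𝒮.post t s ω fun x => field 𝒮.c (𝒮.disp s x) ω μ ^ 2) -
          (𝒮.post t s ω fun x => field 𝒮.c (𝒮.disp s x) ω μ) ^ 2) := by
  rw [← expect_const_mul]
  refine Finset.sum_congr rfl fun s _ => ?_
  rw [𝒮.integral_eval_mul_post t s (.inr (.inl μ)) (fun x => PolyGrowth.field 𝒮.c (𝒮.disp s x) μ)
    fun x ω a => by simp [field]]
  congr 2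
  ext ω
  simp only [expoGrad]
  have e1 : (𝒮.post t s ω fun x => field 𝒮.c (𝒮.disp s x) ω μ *
      (t.1 * field 𝒮.c (𝒮.disp s x) ω μ)) =
      t.1 * 𝒮.post t s ω fun x => field 𝒮.c (𝒮.disp s x) ω μ ^ 2 := by
    unfold post
    rw [← gibbs_const_mul]
    congr 1; ext x; ring
  have e2 : (𝒮.post t s ω fun x => t.1 * field 𝒮.c (𝒮.disp s x) ω μ) =
      t.1 * 𝒮.post t s ω fun x => field 𝒮.c (𝒮.disp s x) ω μ := gibbs_const_mul _
  rw [e1, e2]; ring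

lemma expect_noise_mul_post_disp (t : ℝ × ℝ) (i : N) :
    expect 𝒮.p (fun s (ω : Coord R N → ℝ) => ω (.inr (.inr i)) *
        𝒮.post t s ω fun x => 𝒮.disp s x i) =
      t.2 * expect 𝒮.p (fun s (ω : Coord R N → ℝ) =>
        (𝒮.post t s ω fun x => 𝒮.disp s x i ^ 2) - (𝒮.post t s ω fun x => 𝒮.disp s x i) ^ 2) := by
  rw [← expect_const_mul]
  refine Finset.sum_congr rfl fun s _ => ?_
  rw [𝒮.integral_eval_mul_post t s (.inr (.inr i)) (q := fun x _ => 𝒮.disp s x i)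
    (fun x => .const _) fun x ω a => rfl]
  congr 2
  ext ω
  simp only [expoGrad]
  have e1 : (𝒮.post t s ω fun x => 𝒮.disp s x i * (t.2 * 𝒮.disp s x i)) =
      t.2 * 𝒮.post t s ω fun x => 𝒮.disp s x i ^ 2 := by
    unfold post
    rw [← gibbs_const_mul]
    congr 1; ext x; ring
  have e2 : (𝒮.post t s ω fun x => t.2 * 𝒮.disp s x i) =
      t.2 * 𝒮.post t s ω fun x => 𝒮.disp s x i := gibbs_const_mul _
  rw [e1, e2]; ring

lemma expect_post_expoDerivMeas (h g : ℝ) :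
    expect 𝒮.p (fun s (ω : Coord R N → ℝ) => 𝒮.post (h, g) s ω fun x =>
      expoDerivMeas 𝒮.c h ω (𝒮.disp s x)) = -h * 𝒮.measErr R (h, g) := by
  have hw := fun s (μ : R) => (𝒮.polyGrowth_post_field s μ).slice_left (h, g)
  have hw2 : ∀ s (μ : R), PolyGrowth (fun ω : Coord R N → ℝ => 𝒮.post (h, g) s ω fun x =>
      field 𝒮.c (𝒮.disp s x) ω μ ^ 2) := fun s μ =>
    𝒮.polyGrowth_post_slice (h, g) (fun x => (PolyGrowth.field 𝒮.c (𝒮.disp s x) μ).pow 2) s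
  have e : ∀ s (ω : Coord R N → ℝ), (𝒮.post (h, g) s ω fun x =>
      expoDerivMeas 𝒮.c h ω (𝒮.disp s x)) = ∑ μ, (ω (.inr (.inl μ)) *
        (𝒮.post (h, g) s ω fun x => field 𝒮.c (𝒮.disp s x) ω μ) -
        h * 𝒮.post (h, g) s ω fun x => field 𝒮.c (𝒮.disp s x) ω μ ^ 2) := by
    intro s ω
    unfold post expoDerivMeas
    rw [gibbs_sum]
    refine Finset.sum_congr rfl fun μ _ => ?_
    rw [gibbs_sub, gibbs_mul_const, gibbs_const_mul, mul_comm]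
  simp only [e]
  rw [expect_sum _ fun μ s => ((PolyGrowth.of_eval _).mul (hw s μ)).sub ((hw2 s μ).const_mul _),
    measErr, expect_sum _ fun μ s => (hw s μ).pow 2, Finset.mul_sum]
  refine Finset.sum_congr rfl fun μ _ => ?_
  rw [expect_sub (fun s => (PolyGrowth.of_eval _).mul (hw s μ)) (fun s => (hw2 s μ).const_mul _),
    expect_noise_mul_post_field, expect_const_mul, expect_sub (fun s => hw2 s μ)
    (fun s => (hw s μ).pow 2)]
  ring

lemma expect_post_expoDerivSide (h g : ℝ) :
    expect 𝒮.p (fun s (ω : Coord R N → ℝ) => 𝒮.post (h, g) s ω fun x =>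
      expoDerivSide g ω (𝒮.disp s x)) = -g * 𝒮.sigErr R (h, g) := by
  have hw := fun s (i : N) => (𝒮.polyGrowth_post_disp (R := R) s i).slice_left (h, g)
  have hw2 : ∀ s (i : N), PolyGrowth (fun ω : Coord R N → ℝ => 𝒮.post (h, g) s ω fun x =>
      𝒮.disp s x i ^ 2) := fun s i =>
    𝒮.polyGrowth_post_slice (h, g) (fun x => PolyGrowth.const (𝒮.disp s x i ^ 2)) s
  have e : ∀ s (ω : Coord R N → ℝ), (𝒮.post (h, g) s ω fun x =>
      expoDerivSide g ω (𝒮.disp s x)) = ∑ i, (ω (.inr (.inr i)) *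
        (𝒮.post (h, g) s ω fun x => 𝒮.disp s x i) -
        g * 𝒮.post (h, g) s ω fun x => 𝒮.disp s x i ^ 2) := by
    intro s ω
    unfold post expoDerivSide
    rw [gibbs_sum]
    refine Finset.sum_congr rfl fun i _ => ?_
    rw [gibbs_sub, gibbs_mul_const, gibbs_const_mul, mul_comm]
  simp only [e]
  rw [expect_sum _ fun i s => ((PolyGrowth.of_eval _).mul (hw s i)).sub ((hw2 s i).const_mul _),
    sigErr, expect_sum _ fun i s => (hw s i).pow 2, Finset.mul_sum]
  refine Finset.sum_congr rfl fun i _ => ?_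
  rw [expect_sub (fun s => (PolyGrowth.of_eval _).mul (hw s i)) (fun s => (hw2 s i).const_mul _),
    expect_noise_mul_post_disp, expect_const_mul, expect_sub (fun s => hw2 s i)
    (fun s => (hw s i).pow 2)]
  ring

/-- The I-MMSE relation for the measurements. -/
lemma hasDerivAt_meanLogZ_meas (h g : ℝ) :
    HasDerivAt (fun h => 𝒮.meanLogZ R (h, g)) (-h * 𝒮.measErr R (h, g)) h := by
  rw [← expect_post_expoDerivMeas]
  exact hasDerivAt_expect (f := fun s v => 𝒮.logZ (v.1, g) s v.2)
    (f' := fun s v => 𝒮.post (v.1, g) s v.2 fun x => expoDerivMeas 𝒮.c v.1 v.2 (𝒮.disp s x))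
    (fun s => (𝒮.polyGrowth_logZ s).slice_meas g)
    (fun s => (𝒮.polyGrowth_post_deriv s).slice_meas g)
    (fun s t ω => 𝒮.hasDerivAt_logZ_meas s ω g t) h

/-- The I-MMSE relation for the side channel. -/
lemma hasDerivAt_meanLogZ_side (h g : ℝ) :
    HasDerivAt (fun g => 𝒮.meanLogZ R (h, g)) (-g * 𝒮.sigErr R (h, g)) g := by
  rw [← expect_post_expoDerivSide]
  exact hasDerivAt_expect (f := fun s v => 𝒮.logZ (h, v.1) s v.2)
    (f' := fun s v => 𝒮.post (h, v.1) s v.2 fun x => expoDerivSide v.1 v.2 (𝒮.disp s x))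
    (fun s => (𝒮.polyGrowth_logZ s).slice_side h)
    (fun s => (𝒮.polyGrowth_post
      (fun x => PolyGrowth.expoDerivSide (𝒮.disp s x)) s).slice_side h)
    (fun s t ω => 𝒮.hasDerivAt_logZ_side s ω h t) g

end Signal

namespace Signal

variable {Ω R N : Type*} [Fintype Ω] [Fintype R] [Fintype N] (𝒮 : Signal Ω N)

/-! ### Relation between the two mean square errors -/

/-- The noise correlation `∑ z_μ (z_μ - h w_μ)`. -/
def noiseCorr (h : ℝ) (s : Ω) (ω : Coord R N → ℝ) (x : Ω) : ℝ :=
  ∑ μ, ω (.inr (.inl μ)) * (ω (.inr (.inl μ)) - h * field 𝒮.c (𝒮.disp s x) ω μ)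

/-- The (rescaled) overlap of the displacement with its fluctuation. -/
def overlap (t : ℝ × ℝ) (s : Ω) (ω : Coord R N → ℝ) (x : Ω) : ℝ :=
  𝒮.c ^ 2 * ∑ i, 𝒮.disp s x i * (𝒮.disp s x i - 𝒮.post t s ω fun y => 𝒮.disp s y i)

/-- The residual `‖Y - h Φ x‖²`. -/
def residual (h : ℝ) (s : Ω) (ω : Coord R N → ℝ) (x : Ω) : ℝ :=
  ∑ μ, (h * field 𝒮.c (𝒮.disp s x) ω μ - ω (.inr (.inl μ))) ^ 2

lemma noiseCorr_eq (h : ℝ) (s : Ω) (ω : Coord R N → ℝ) (x : Ω) :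
    𝒮.noiseCorr h s ω x = 𝒮.residual h s ω x + h * expoDerivMeas 𝒮.c h ω (𝒮.disp s x) := by
  unfold noiseCorr residual expoDerivMeas
  rw [Finset.mul_sum, ← Finset.sum_add_distrib]
  exact Finset.sum_congr rfl fun μ _ => by ring

lemma polyGrowth_noiseCorr (h : ℝ) (s x : Ω) :
    PolyGrowth (fun ω : Coord R N → ℝ => 𝒮.noiseCorr h s ω x) :=
  .sum _ fun μ _ => (PolyGrowth.of_eval _).mul
    ((PolyGrowth.of_eval _).sub ((PolyGrowth.field _ _ μ).const_mul _))

lemma polyGrowth_residual (h : ℝ) (s x : Ω) :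
    PolyGrowth (fun ω : Coord R N → ℝ => 𝒮.residual h s ω x) :=
  .sum _ fun μ _ => (((PolyGrowth.field _ _ μ).const_mul _).sub (PolyGrowth.of_eval _)).pow 2

lemma polyGrowth_overlap (t : ℝ × ℝ) (s x : Ω) :
    PolyGrowth (fun ω : Coord R N → ℝ => 𝒮.overlap t s ω x) :=
  (PolyGrowth.sum _ fun i _ => (PolyGrowth.const _).mul
    ((PolyGrowth.const _).sub ((𝒮.polyGrowth_post_disp s i).slice_left t))).const_mul _

lemma sum_disp_sq_le {C : ℝ} (hC : ∀ x, 𝒮.c ^ 2 * ∑ i, 𝒮.X x i ^ 2 ≤ C) (s x : Ω) :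
    𝒮.c ^ 2 * ∑ i, 𝒮.disp s x i ^ 2 ≤ 4 * C := by
  have h1 : ∑ i, 𝒮.disp s x i ^ 2 ≤ 2 * ∑ i, 𝒮.X x i ^ 2 + 2 * ∑ i, 𝒮.X s i ^ 2 := by
    rw [Finset.mul_sum, Finset.mul_sum, ← Finset.sum_add_distrib]
    refine Finset.sum_le_sum fun i _ => ?_
    simp only [disp]
    nlinarith [sq_nonneg (𝒮.X x i + 𝒮.X s i)]
  nlinarith [mul_le_mul_of_nonneg_left h1 (sq_nonneg 𝒮.c), hC x, hC s]

lemma sum_post_disp_sq_le {C : ℝ} (hC : ∀ x, 𝒮.c ^ 2 * ∑ i, 𝒮.X x i ^ 2 ≤ C) (t : ℝ × ℝ) (s : Ω)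
    (ω : Coord R N → ℝ) :
    𝒮.c ^ 2 * ∑ i, (𝒮.post t s ω fun y => 𝒮.disp s y i) ^ 2 ≤ 4 * C := by
  have h1 : ∑ i, (𝒮.post t s ω fun y => 𝒮.disp s y i) ^ 2 ≤
      𝒮.post t s ω fun y => ∑ i, 𝒮.disp s y i ^ 2 := by
    unfold post
    rw [gibbs_sum]
    exact Finset.sum_le_sum fun i _ => sq_gibbs_le 𝒮.isWeight
  refine (mul_le_mul_of_nonneg_left h1 (sq_nonneg 𝒮.c)).trans ?_
  unfold post
  rw [← gibbs_const_mul, ← gibbs_const (e := fun x => expo 𝒮.c t ω (𝒮.disp s x)) 𝒮.isWeight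
    (4 * C)]
  exact gibbs_mono 𝒮.isWeight (𝒮.sum_disp_sq_le hC s)

lemma abs_overlap_le {C : ℝ} (hC : ∀ x, 𝒮.c ^ 2 * ∑ i, 𝒮.X x i ^ 2 ≤ C) (t : ℝ × ℝ) (s : Ω)
    (ω : Coord R N → ℝ) (x : Ω) : |𝒮.overlap t s ω x| ≤ 8 * C := by
  have hd := 𝒮.sum_disp_sq_le hC s
  have hp := 𝒮.sum_post_disp_sq_le hC t s ω
  unfold overlap
  rw [abs_mul, abs_of_nonneg (sq_nonneg 𝒮.c)]
  have h2 : |∑ i, 𝒮.disp s x i * (𝒮.disp s x i - 𝒮.post t s ω fun y => 𝒮.disp s y i)| ≤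
      3 / 2 * ∑ i, 𝒮.disp s x i ^ 2 + 1 / 2 * ∑ i, (𝒮.post t s ω fun y => 𝒮.disp s y i) ^ 2 := by
    rw [Finset.mul_sum, Finset.mul_sum, ← Finset.sum_add_distrib]
    refine (Finset.abs_sum_le_sum_abs _ _).trans (Finset.sum_le_sum fun i _ => ?_)
    rw [abs_le]
    constructor <;>
    nlinarith [sq_nonneg (𝒮.disp s x i + 𝒮.post t s ω fun y => 𝒮.disp s y i),
      sq_nonneg (𝒮.disp s x i - 𝒮.post t s ω fun y => 𝒮.disp s y i), sq_nonneg (𝒮.disp s x i),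
      sq_nonneg (𝒮.post t s ω fun y => 𝒮.disp s y i)]
  nlinarith [mul_le_mul_of_nonneg_left h2 (sq_nonneg 𝒮.c), hd x]

/-- The residual at a posterior sample is distributed as the squared norm of the noise. -/
lemma expect_post_residual (t : ℝ × ℝ) (k : ℝ) :
    expect 𝒮.p (fun s (ω : Coord R N → ℝ) =>
        𝒮.post t s ω fun x => |𝒮.residual t.1 s ω x - k|) =
      expect 𝒮.p (fun _ (ω : Coord R N → ℝ) => |∑ μ, ω (.inr (.inl μ)) ^ 2 - k|) := by
  have n := 𝒮.nishimori t (Ψ := fun x (y : Coord R N → ℝ) =>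
    |∑ μ, (t.1 * field 𝒮.c (𝒮.X x) y μ - y (.inr (.inl μ))) ^ 2 - k|) fun x =>
      ((PolyGrowth.sum _ fun μ _ => (((PolyGrowth.field _ _ μ).const_mul _).sub
        (PolyGrowth.of_eval _)).pow 2).sub (.const _)).abs
  simp only [field_obs] at n
  simp only [obs] at n
  have e1 : ∀ (s x : Ω) (ω : Coord R N → ℝ), ∑ μ, (t.1 * field 𝒮.c (𝒮.X x) ω μ -
      (ω (.inr (.inl μ)) + t.1 * field 𝒮.c (𝒮.X s) ω μ)) ^ 2 = 𝒮.residual t.1 s ω x := by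
    intro s x ω
    unfold residual
    exact Finset.sum_congr rfl fun μ _ => by rw [field_disp]; ring
  simp only [e1] at n
  rw [← n]
  congr 1
  ext s ω
  congr 2
  unfold residual
  refine Finset.sum_congr rfl fun μ _ => ?_
  rw [field_disp]; ring

/-- By the Nishimori identity, the posterior average of `‖Φ (x - S)‖²` is at most four times the
mean of `‖Φ S‖²`. -/
lemma expect_post_field_sq_le {C : ℝ} (hC : ∀ x, 𝒮.c ^ 2 * ∑ i, 𝒮.X x i ^ 2 ≤ C) (t : ℝ × ℝ) :
    expect 𝒮.p (fun s (ω : Coord R N → ℝ) =>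
      𝒮.post t s ω fun x => ∑ μ, field 𝒮.c (𝒮.disp s x) ω μ ^ 2) ≤
        4 * C * Fintype.card R := by
  classical
  have hP : ∀ μ s, PolyGrowth (fun ω : Coord R N → ℝ =>
      𝒮.post t s ω fun x => field 𝒮.c (𝒮.disp s x) ω μ ^ 2) := fun μ s =>
    𝒮.polyGrowth_post_slice t (fun x => (PolyGrowth.field _ _ μ).pow 2) s
  have e : ∀ s (ω : Coord R N → ℝ), (𝒮.post t s ω fun x =>
      ∑ μ, field 𝒮.c (𝒮.disp s x) ω μ ^ 2) =
      ∑ μ, 𝒮.post t s ω fun x => field 𝒮.c (𝒮.disp s x) ω μ ^ 2 := fun s ω => gibbs_sum _ _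
  simp only [e]
  rw [expect_sum _ hP, ← nsmul_eq_mul', ← Finset.card_univ, ← Finset.sum_const]
  refine Finset.sum_le_sum fun μ _ => ?_
  simp_rw [field_disp]
  refine (𝒮.expect_post_sq_sub_le t (q := fun x ω => field 𝒮.c (𝒮.X x) ω μ)
    (fun x => PolyGrowth.field _ _ μ) fun x s ω => rfl).trans ?_
  refine mul_le_mul_of_nonneg_left ?_ (by norm_num)
  have h1 : ∀ s, ∫ ω : Coord R N → ℝ, field 𝒮.c (𝒮.X s) ω μ ^ 2 ∂(stdGauss (Coord R N)) =
      𝒮.c ^ 2 * ∑ i, 𝒮.X s i ^ 2 := by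
    intro s
    let a : Coord R N → ℝ := Sum.elim (fun q => if q.1 = μ then 𝒮.c * 𝒮.X s q.2 else 0) 0
    have e1 : ∀ ω : Coord R N → ℝ, field 𝒮.c (𝒮.X s) ω μ = ∑ j, a j * ω j := by
      intro ω
      rw [Fintype.sum_sum_type, Fintype.sum_prod_type]
      simp only [a, Sum.elim_inl, Sum.elim_inr, Pi.zero_apply, zero_mul, Finset.sum_const_zero,
        add_zero, ite_mul]
      rw [Finset.sum_eq_single μ (by intro b _ hb; simp [hb]) (by simp)]
      simp only [if_true, field, Finset.mul_sum]
      exact Finset.sum_congr rfl fun i _ => by ring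
    simp_rw [e1]
    rw [integral_sq_linear_stdGauss, Fintype.sum_sum_type, Fintype.sum_prod_type]
    simp only [a, Sum.elim_inl, Sum.elim_inr, Pi.zero_apply, ne_eq, OfNat.ofNat_ne_zero,
      not_false_eq_true, zero_pow, Finset.sum_const_zero, add_zero, ite_pow]
    rw [Finset.sum_eq_single μ (by intro b _ hb; simp [hb]) (by simp)]
    simp only [if_true, mul_pow, Finset.mul_sum]
  unfold expect
  simp_rw [h1]
  calc ∑ s, 𝒮.p s * (𝒮.c ^ 2 * ∑ i, 𝒮.X s i ^ 2) ≤ ∑ s, 𝒮.p s * C :=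
        Finset.sum_le_sum fun s _ => mul_le_mul_of_nonneg_left (hC s) (𝒮.isWeight.nonneg s)
    _ = C := by rw [← Finset.sum_mul, 𝒮.isWeight.sum_eq, one_mul]

lemma measErr_le {C : ℝ} (hC : ∀ x, 𝒮.c ^ 2 * ∑ i, 𝒮.X x i ^ 2 ≤ C) (t : ℝ × ℝ) :
    𝒮.measErr R t ≤ 4 * C * Fintype.card R := by
  refine le_trans ?_ (𝒮.expect_post_field_sq_le hC t)
  refine expect_mono 𝒮.isWeight
    (fun s => .sum _ fun μ _ => ((𝒮.polyGrowth_post_field s μ).slice_left t).pow 2)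
    (fun s => 𝒮.polyGrowth_post_slice t
      (fun x => .sum _ fun μ _ => (PolyGrowth.field _ _ μ).pow 2) s) fun s ω => ?_
  unfold post
  rw [gibbs_sum]
  exact Finset.sum_le_sum fun μ _ => sq_gibbs_le 𝒮.isWeight

lemma sigErr_le {C : ℝ} (hC : ∀ x, 𝒮.c ^ 2 * ∑ i, 𝒮.X x i ^ 2 ≤ C) (t : ℝ × ℝ) :
    𝒮.c ^ 2 * 𝒮.sigErr R t ≤ 4 * C := by
  unfold sigErr
  rw [← expect_const_mul, ← expect_const (J := Coord R N) 𝒮.isWeight (4 * C)]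
  exact expect_mono 𝒮.isWeight
    (fun s => (PolyGrowth.sum _ fun i _ =>
      ((𝒮.polyGrowth_post_disp s i).slice_left t).pow 2).const_mul _)
    (fun s => .const _) fun s ω => 𝒮.sum_post_disp_sq_le hC t s ω

lemma expect_sq_coord (j : Coord R N) :
    expect 𝒮.p (fun _ (ω : Coord R N → ℝ) => ω j ^ 2) = 1 := by
  classical
  have h := integral_sq_linear_stdGauss (Pi.single j 1 : Coord R N → ℝ)
  simp [Pi.single_apply] at h
  simp [expect, h, 𝒮.isWeight.sum_eq]

/-- By the Nishimori identity, the posterior variance averages to the mean square error. -/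
lemma expect_post_overlap (t : ℝ × ℝ) :
    expect 𝒮.p (fun s (ω : Coord R N → ℝ) => 𝒮.post t s ω fun x => 𝒮.overlap t s ω x) =
      𝒮.c ^ 2 * 𝒮.sigErr R t := by
  have e : ∀ (s : Ω) (ω : Coord R N → ℝ), (𝒮.post t s ω fun x => 𝒮.overlap t s ω x) =
      𝒮.c ^ 2 * ∑ i, ((𝒮.post t s ω fun x => 𝒮.disp s x i ^ 2) -
        (𝒮.post t s ω fun x => 𝒮.disp s x i) ^ 2) := by
    intro s ω
    unfold overlap
    conv_lhs => unfold post
    rw [gibbs_const_mul, gibbs_sum]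
    congr 1
    refine Finset.sum_congr rfl fun i _ => ?_
    simp_rw [mul_sub]
    rw [gibbs_sub, gibbs_mul_const]
    simp only [post, sq]
  have hv : ∀ i, expect 𝒮.p (fun s (ω : Coord R N → ℝ) =>
      (𝒮.post t s ω fun x => 𝒮.disp s x i) ^ 2) = expect 𝒮.p (fun s (ω : Coord R N → ℝ) =>
        (𝒮.post t s ω fun x => 𝒮.disp s x i ^ 2) -
          (𝒮.post t s ω fun x => 𝒮.disp s x i) ^ 2) := fun i =>
    𝒮.expect_sq_post_sub t (q := fun x _ => 𝒮.X x i) (fun x => .const _) fun _ _ _ => rfl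
  have hP1 : ∀ i s, PolyGrowth (fun ω : Coord R N → ℝ => 𝒮.post t s ω fun x => 𝒮.disp s x i) :=
    fun i s => (𝒮.polyGrowth_post_disp s i).slice_left t
  have hP2 : ∀ i s, PolyGrowth (fun ω : Coord R N → ℝ =>
      𝒮.post t s ω fun x => 𝒮.disp s x i ^ 2) := fun i s =>
    𝒮.polyGrowth_post_slice t (fun x => PolyGrowth.const (𝒮.disp s x i ^ 2)) s
  simp only [e]
  rw [expect_const_mul, sigErr, expect_sum _ fun i s => (hP2 i s).sub ((hP1 i s).pow 2),
    expect_sum _ fun i s => (hP1 i s).pow 2]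
  simp_rw [hv]

variable [DecidableEq R] [DecidableEq N]

/-- Integration by parts in the noise, followed by the Nishimori identity. -/
lemma expect_noise_mul_post_field_eq (t : ℝ × ℝ) (μ : R) :
    expect 𝒮.p (fun s (ω : Coord R N → ℝ) => ω (.inr (.inl μ)) *
        𝒮.post t s ω fun x => field 𝒮.c (𝒮.disp s x) ω μ) =
      t.1 * expect 𝒮.p (fun s (ω : Coord R N → ℝ) =>
          (𝒮.post t s ω fun x => field 𝒮.c (𝒮.disp s x) ω μ) ^ 2) := by
  rw [expect_noise_mul_post_field]
  congr 1
  simp_rw [field_disp]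
  exact (𝒮.expect_sq_post_sub t (q := fun x ω => field 𝒮.c (𝒮.X x) ω μ)
    (fun x => PolyGrowth.field _ _ μ) fun x s ω => rfl).symm

lemma expect_post_noiseCorr (t : ℝ × ℝ) :
    expect 𝒮.p (fun s (ω : Coord R N → ℝ) => 𝒮.post t s ω fun x => 𝒮.noiseCorr t.1 s ω x) =
      Fintype.card R - t.1 ^ 2 * 𝒮.measErr R t := by
  have e : ∀ s (ω : Coord R N → ℝ), (𝒮.post t s ω fun x => 𝒮.noiseCorr t.1 s ω x) =
      ∑ μ, (ω (.inr (.inl μ)) ^ 2 - t.1 * (ω (.inr (.inl μ)) *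
        𝒮.post t s ω fun x => field 𝒮.c (𝒮.disp s x) ω μ)) := by
    intro s ω
    unfold noiseCorr post
    rw [gibbs_sum]
    refine Finset.sum_congr rfl fun μ _ => ?_
    rw [gibbs_const_mul, gibbs_sub, gibbs_const 𝒮.isWeight, gibbs_const_mul]
    ring
  have hP : ∀ μ s, PolyGrowth (fun ω : Coord R N → ℝ =>
      𝒮.post t s ω fun x => field 𝒮.c (𝒮.disp s x) ω μ) := fun μ s =>
    (𝒮.polyGrowth_post_field s μ).slice_left t
  have hP1 : ∀ μ s, PolyGrowth (fun ω : Coord R N → ℝ => t.1 * (ω (.inr (.inl μ)) *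
        𝒮.post t s ω fun x => field 𝒮.c (𝒮.disp s x) ω μ)) := fun μ s =>
    ((PolyGrowth.of_eval _).mul (hP μ s)).const_mul _
  simp only [e]
  rw [expect_sum _ fun μ s => ((PolyGrowth.of_eval _).pow 2).sub (hP1 μ s), measErr,
    expect_sum _ fun μ s => (hP μ s).pow 2, Finset.mul_sum, ← Finset.card_univ,
    Finset.cast_card, ← Finset.sum_sub_distrib]
  refine Finset.sum_congr rfl fun μ _ => ?_
  rw [expect_sub (fun s => (PolyGrowth.of_eval _).pow 2) (hP1 μ), expect_const_mul,
    expect_noise_mul_post_field_eq, expect_sq_coord]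
  ring

/-- Integration by parts in the matrix entries: `h y = 𝔼 ⟨z · w⟩` for the noise `z` and
`w = Φ (x - S)`, and `w` is linear in the matrix entries. -/
lemma measErr_eq_expect_noiseCorr_mul_overlap (t : ℝ × ℝ) :
    t.1 * 𝒮.measErr R t = t.1 * expect 𝒮.p (fun s (ω : Coord R N → ℝ) =>
      𝒮.post t s ω fun x => 𝒮.noiseCorr t.1 s ω x * 𝒮.overlap t s ω x) := by
  have hP : ∀ μ s, PolyGrowth (fun ω : Coord R N → ℝ =>
      𝒮.post t s ω fun x => field 𝒮.c (𝒮.disp s x) ω μ) := fun μ s =>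
    (𝒮.polyGrowth_post_field s μ).slice_left t
  -- the contribution of the matrix entry `(μ, i)` to `𝔼 ⟨z · w⟩`, and its integral by parts `Q`
  let u : R → N → Ω → (Coord R N → ℝ) → ℝ := fun μ i s ω => 𝒮.c * (ω (.inl (μ, i)) *
    𝒮.post t s ω fun x => ω (.inr (.inl μ)) * 𝒮.disp s x i)
  have hq : ∀ μ i s x, PolyGrowth (fun ω : Coord R N → ℝ => ω (.inr (.inl μ)) * 𝒮.disp s x i) :=
    fun μ i s x => (PolyGrowth.of_eval _).mul (.const _)
  have hu : ∀ μ i s, PolyGrowth (u μ i s) := fun μ i s =>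
    ((PolyGrowth.of_eval _).mul (𝒮.polyGrowth_post_slice t (hq μ i s) s)).const_mul _
  let Q : R → N → Ω → (Coord R N → ℝ) → ℝ := fun μ i s ω =>
    𝒮.post t s ω (fun x => ω (.inr (.inl μ)) * 𝒮.disp s x i *
      expoGrad 𝒮.c t ω (𝒮.disp s x) (.inl (μ, i))) -
    𝒮.post t s ω (fun x => ω (.inr (.inl μ)) * 𝒮.disp s x i) *
      𝒮.post t s ω fun x => expoGrad 𝒮.c t ω (𝒮.disp s x) (.inl (μ, i))
  have hg : ∀ μ i s x, PolyGrowth (fun ω : Coord R N → ℝ =>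
      expoGrad 𝒮.c t ω (𝒮.disp s x) (.inl (μ, i))) := fun μ i s x =>
    (PolyGrowth.expoGrad 𝒮.c (𝒮.disp s x) _).slice_left t
  have hQ : ∀ μ i s, PolyGrowth (Q μ i s) := fun μ i s =>
    (𝒮.polyGrowth_post_slice t (fun x => (hq μ i s x).mul (hg μ i s x)) s).sub
      ((𝒮.polyGrowth_post_slice t (hq μ i s) s).mul (𝒮.polyGrowth_post_slice t (hg μ i s) s))
  have e1 : ∀ μ i, expect 𝒮.p (u μ i) = 𝒮.c * expect 𝒮.p (Q μ i) := by
    intro μ i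
    simp only [u]
    rw [expect_const_mul]
    congr 1
    refine Finset.sum_congr rfl fun s _ => ?_
    rw [𝒮.integral_eval_mul_post t s (.inl (μ, i)) (hq μ i s) fun x ω a => by simp]
  have e2 : ∀ μ s (ω : Coord R N → ℝ), ω (.inr (.inl μ)) *
      (𝒮.post t s ω fun x => field 𝒮.c (𝒮.disp s x) ω μ) = ∑ i, u μ i s ω := by
    intro μ s ω
    simp only [u, post, field]
    rw [gibbs_const_mul, gibbs_sum, Finset.mul_sum, Finset.mul_sum]
    refine Finset.sum_congr rfl fun i _ => ?_
    rw [gibbs_const_mul, gibbs_const_mul]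
    ring
  have e3 : ∀ s (ω : Coord R N → ℝ), (𝒮.post t s ω fun x => 𝒮.noiseCorr t.1 s ω x *
      𝒮.overlap t s ω x) * t.1 = ∑ μ, ∑ i, 𝒮.c * Q μ i s ω := by
    intro s ω
    have hx : ∀ x, 𝒮.noiseCorr t.1 s ω x * 𝒮.overlap t s ω x = ∑ μ, ∑ i,
        ((ω (.inr (.inl μ)) * (ω (.inr (.inl μ)) - t.1 * field 𝒮.c (𝒮.disp s x) ω μ)) *
        (𝒮.c ^ 2 * (𝒮.disp s x i * (𝒮.disp s x i - 𝒮.post t s ω fun y => 𝒮.disp s y i)))) := by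
      intro x
      unfold noiseCorr overlap
      rw [Finset.mul_sum, Finset.sum_mul_sum]
    simp_rw [hx]
    rw [Signal.post.eq_def 𝒮 t s ω (fun x => ∑ μ, ∑ i, _), gibbs_sum, Finset.sum_mul]
    refine Finset.sum_congr rfl fun μ _ => ?_
    rw [gibbs_sum, Finset.sum_mul]
    refine Finset.sum_congr rfl fun i _ => ?_
    have hy : ∀ x, ω (.inr (.inl μ)) * (ω (.inr (.inl μ)) - t.1 * field 𝒮.c (𝒮.disp s x) ω μ) *
        (𝒮.c ^ 2 * (𝒮.disp s x i * (𝒮.disp s x i - 𝒮.post t s ω fun y => 𝒮.disp s y i))) =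
        ω (.inr (.inl μ)) * 𝒮.c ^ 2 * (𝒮.disp s x i * 𝒮.disp s x i *
          (ω (.inr (.inl μ)) - t.1 * field 𝒮.c (𝒮.disp s x) ω μ)) -
        (ω (.inr (.inl μ)) * 𝒮.c ^ 2 * 𝒮.post t s ω fun y => 𝒮.disp s y i) * (𝒮.disp s x i *
          (ω (.inr (.inl μ)) - t.1 * field 𝒮.c (𝒮.disp s x) ω μ)) := fun x => by ring
    simp_rw [hy]
    have hz1 : ∀ x, ω (.inr (.inl μ)) * 𝒮.disp s x i *
        expoGrad 𝒮.c t ω (𝒮.disp s x) (.inl (μ, i)) = (ω (.inr (.inl μ)) * t.1 * 𝒮.c) *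
        (𝒮.disp s x i * 𝒮.disp s x i *
          (ω (.inr (.inl μ)) - t.1 * field 𝒮.c (𝒮.disp s x) ω μ)) := fun x => by
      simp only [expoGrad]; ring
    have hz2 : ∀ x, expoGrad 𝒮.c t ω (𝒮.disp s x) (.inl (μ, i)) = (t.1 * 𝒮.c) *
        (𝒮.disp s x i * (ω (.inr (.inl μ)) - t.1 * field 𝒮.c (𝒮.disp s x) ω μ)) := fun x => by
      simp only [expoGrad]; ring
    simp only [Q]
    simp_rw [hz1, hz2]
    unfold post
    rw [gibbs_sub]
    simp only [gibbs_const_mul]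
    ring
  have hVT : ∀ s, PolyGrowth (fun ω : Coord R N → ℝ => 𝒮.post t s ω fun x =>
      𝒮.noiseCorr t.1 s ω x * 𝒮.overlap t s ω x) := fun s =>
    𝒮.polyGrowth_post_slice t
      (fun x => (𝒮.polyGrowth_noiseCorr t.1 s x).mul (𝒮.polyGrowth_overlap t s x)) s
  have e4 : t.1 * expect 𝒮.p (fun s (ω : Coord R N → ℝ) => 𝒮.post t s ω fun x =>
      𝒮.noiseCorr t.1 s ω x * 𝒮.overlap t s ω x) = ∑ μ, ∑ i, 𝒮.c * expect 𝒮.p (Q μ i) := by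
    rw [← expect_const_mul]
    have : (fun s (ω : Coord R N → ℝ) => t.1 * 𝒮.post t s ω fun x =>
      𝒮.noiseCorr t.1 s ω x * 𝒮.overlap t s ω x) = fun s ω => ∑ μ, ∑ i, 𝒮.c * Q μ i s ω := by
      ext s ω; rw [mul_comm, e3]
    rw [this, expect_sum _ fun μ s => .sum _ fun i _ => (hQ μ i s).const_mul _]
    refine Finset.sum_congr rfl fun μ _ => ?_
    rw [expect_sum _ fun i s => (hQ μ i s).const_mul _]
    exact Finset.sum_congr rfl fun i _ => expect_const_mul _
  rw [e4, measErr, expect_sum _ fun μ s => (hP μ s).pow 2, Finset.mul_sum]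
  refine Finset.sum_congr rfl fun μ _ => ?_
  rw [← expect_noise_mul_post_field_eq]
  simp_rw [e2 μ, ← e1]
  exact expect_sum _ fun i s => hu μ i s

/-- The fluctuation of the noise correlation, around an arbitrary constant, controls the defect in
the relation between the two mean square errors. -/
lemma measErr_relation {C : ℝ} (hC : ∀ x, 𝒮.c ^ 2 * ∑ i, 𝒮.X x i ^ 2 ≤ C) (t : ℝ × ℝ) (k : ℝ) :
    |t.1 * 𝒮.measErr R t * (1 + t.1 ^ 2 * (𝒮.c ^ 2 * 𝒮.sigErr R t)) -
        t.1 * (Fintype.card R * (𝒮.c ^ 2 * 𝒮.sigErr R t))| ≤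
      |t.1| * (16 * C * expect 𝒮.p (fun s (ω : Coord R N → ℝ) =>
        𝒮.post t s ω fun x => |𝒮.noiseCorr t.1 s ω x - k|)) := by
  have hV := fun s x => 𝒮.polyGrowth_noiseCorr (R := R) t.1 s x
  have hT := fun s x => 𝒮.polyGrowth_overlap (R := R) t s x
  set φ := expect 𝒮.p (fun s (ω : Coord R N → ℝ) =>
        𝒮.post t s ω fun x => |𝒮.noiseCorr t.1 s ω x - k|) with hφ
  have hC0 : 0 ≤ C := by
    obtain ⟨x⟩ : Nonempty Ω := by
      by_contra hn
      rw [not_nonempty_iff] at hn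
      simpa using 𝒮.isWeight.sum_eq
    exact (mul_nonneg (sq_nonneg _) (Finset.sum_nonneg fun i _ => sq_nonneg _)).trans (hC x)
  set v := expect 𝒮.p (fun s (ω : Coord R N → ℝ) => 𝒮.post t s ω fun x => 𝒮.noiseCorr t.1 s ω x)
    with hv
  have hPabs : ∀ k, ∀ s, PolyGrowth (fun ω : Coord R N → ℝ =>
      𝒮.post t s ω fun x => |𝒮.noiseCorr t.1 s ω x - k|) := fun k s =>
    𝒮.polyGrowth_post_slice t (fun x => ((hV s x).sub (.const _)).abs) s
  have hPk : ∀ k, ∀ s, PolyGrowth (fun ω : Coord R N → ℝ =>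
      𝒮.post t s ω fun x => 𝒮.noiseCorr t.1 s ω x - k) := fun k s =>
    𝒮.polyGrowth_post_slice t (fun x => ((hV s x).sub (.const _))) s
  have hvk : |v - k| ≤ φ := by
    have : v - k = expect 𝒮.p (fun s (ω : Coord R N → ℝ) =>
        𝒮.post t s ω fun x => 𝒮.noiseCorr t.1 s ω x - k) := by
      have e : ∀ s (ω : Coord R N → ℝ), (𝒮.post t s ω fun x => 𝒮.noiseCorr t.1 s ω x - k) =
          (𝒮.post t s ω fun x => 𝒮.noiseCorr t.1 s ω x) - k := by
        intro s ω; unfold post; rw [gibbs_sub, gibbs_const 𝒮.isWeight]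
      simp only [e]
      rw [expect_sub (fun s => 𝒮.polyGrowth_post_slice t (hV s) s) (fun s => .const _),
        expect_const 𝒮.isWeight]
    rw [this]
    refine (abs_expect_le 𝒮.isWeight (hPk k)).trans ?_
    exact expect_mono 𝒮.isWeight (fun s => (hPk k s).abs) (hPabs k)
      fun s ω => abs_gibbs_le 𝒮.isWeight
  have hvv : expect 𝒮.p (fun s (ω : Coord R N → ℝ) =>
        𝒮.post t s ω fun x => |𝒮.noiseCorr t.1 s ω x - v|) ≤ 2 * φ := by
    have h1 : expect 𝒮.p (fun s (ω : Coord R N → ℝ) =>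
        𝒮.post t s ω fun x => |𝒮.noiseCorr t.1 s ω x - v|) ≤
        expect 𝒮.p (fun s (ω : Coord R N → ℝ) =>
        (𝒮.post t s ω fun x => |𝒮.noiseCorr t.1 s ω x - k|) + |v - k|) := by
      refine expect_mono 𝒮.isWeight (hPabs v) (fun s => (hPabs k s).add (.const _)) fun s ω => ?_
      unfold post
      rw [← gibbs_const (e := fun x => expo 𝒮.c t ω (𝒮.disp s x)) 𝒮.isWeight (|v - k|), ← gibbs_add]
      refine gibbs_mono 𝒮.isWeight fun x => ?_
      rw [abs_sub_comm v k]
      exact abs_sub_le _ _ _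
    rw [expect_add (hPabs k) (fun s => .const _), expect_const 𝒮.isWeight] at h1
    linarith
  -- split `𝔼 ⟨V T⟩`, with `V` the noise correlation and `T` the overlap, at the mean `v` of `V`
  have hdec : expect 𝒮.p (fun s (ω : Coord R N → ℝ) => 𝒮.post t s ω fun x =>
      𝒮.noiseCorr t.1 s ω x * 𝒮.overlap t s ω x) =
      expect 𝒮.p (fun s (ω : Coord R N → ℝ) => 𝒮.post t s ω fun x =>
      (𝒮.noiseCorr t.1 s ω x - v) * 𝒮.overlap t s ω x) + v * (𝒮.c ^ 2 * 𝒮.sigErr R t) := by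
    rw [← expect_post_overlap, ← expect_const_mul, ← expect_add]
    · congr 1
      ext s ω
      unfold post
      rw [← gibbs_const_mul, ← gibbs_add]
      congr 1; ext x; ring
    · exact fun s => 𝒮.polyGrowth_post_slice t
        (fun x => ((hV s x).sub (.const _)).mul (hT s x)) s
    · exact fun s => (𝒮.polyGrowth_post_slice t (hT s) s).const_mul _
  set ε := expect 𝒮.p (fun s (ω : Coord R N → ℝ) => 𝒮.post t s ω fun x =>
      (𝒮.noiseCorr t.1 s ω x - v) * 𝒮.overlap t s ω x) with hε
  have hεb : |ε| ≤ 16 * C * φ := by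
    have hP : ∀ s, PolyGrowth (fun ω : Coord R N → ℝ => 𝒮.post t s ω fun x =>
        (𝒮.noiseCorr t.1 s ω x - v) * 𝒮.overlap t s ω x) := fun s =>
      𝒮.polyGrowth_post_slice t (fun x => ((hV s x).sub (.const _)).mul (hT s x)) s
    have h1 : |ε| ≤ expect 𝒮.p (fun s (ω : Coord R N → ℝ) =>
        8 * C * 𝒮.post t s ω fun x => |𝒮.noiseCorr t.1 s ω x - v|) := by
      refine (abs_expect_le 𝒮.isWeight hP).trans (expect_mono 𝒮.isWeight (fun s => (hP s).abs)
        (fun s => (hPabs v s).const_mul _) fun s ω => ?_)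
      refine (abs_gibbs_le 𝒮.isWeight).trans ?_
      unfold post
      rw [← gibbs_const_mul]
      refine gibbs_mono 𝒮.isWeight fun x => ?_
      rw [abs_mul, mul_comm]
      exact mul_le_mul_of_nonneg_right (𝒮.abs_overlap_le hC t s ω x) (abs_nonneg _)
    rw [expect_const_mul] at h1
    nlinarith
  have hmain := 𝒮.measErr_eq_expect_noiseCorr_mul_overlap (R := R) t
  rw [hdec] at hmain
  have hvval := 𝒮.expect_post_noiseCorr (R := R) t
  rw [← hv] at hvval
  have hfin : t.1 * 𝒮.measErr R t * (1 + t.1 ^ 2 * (𝒮.c ^ 2 * 𝒮.sigErr R t)) -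
        t.1 * (Fintype.card R * (𝒮.c ^ 2 * 𝒮.sigErr R t)) = t.1 * ε := by
    rw [hvval] at hmain
    linear_combination hmain
  rw [hfin, abs_mul]
  exact mul_le_mul_of_nonneg_left hεb (abs_nonneg _)

end Signal

/-! ### Fluctuations of the log-partition function -/

/-- The product of copies of a weight. -/
def prodWeight {κ : Type*} (w : κ → ℝ) (L : ℕ) (x : Fin L → κ) : ℝ := ∏ l, w (x l)

section EfronStein

variable {κ : Type*} {w : κ → ℝ}

lemma prodWeight_cons {L : ℕ} (k : κ) (y : Fin L → κ) :
    prodWeight w (L + 1) (Fin.cons k y) = w k * prodWeight w L y := by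
  simp [prodWeight, Fin.prod_univ_succ]

variable [Fintype κ]

lemma sum_fin_succ_fun {L : ℕ} (f : (Fin (L + 1) → κ) → ℝ) :
    ∑ x, f x = ∑ k, ∑ y : Fin L → κ, f (Fin.cons k y) := by
  rw [← Fintype.sum_prod_type', ← (Fin.consEquiv fun _ : Fin (L + 1) => κ).sum_comp]
  rfl

lemma isWeight_prodWeight (hw : IsWeight w) (L : ℕ) : IsWeight (prodWeight w L) where
  nonneg x := Finset.prod_nonneg fun l _ => hw.nonneg _
  sum_eq := by
    have h := Finset.prod_univ_sum (fun _ : Fin L => (Finset.univ : Finset κ)) fun _ k => w k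
    rw [Fintype.piFinset_univ] at h
    unfold prodWeight
    rw [← h]
    simp [hw.sum_eq]

lemma sum_sq_sub_sq_eq {Ω : Type*} [Fintype Ω] {p : Ω → ℝ} (hp : IsWeight p) (f : Ω → ℝ) (a : ℝ) :
    ∑ x, p x * (f x - a) ^ 2 =
      (∑ x, p x * f x ^ 2 - (∑ x, p x * f x) ^ 2) + (∑ x, p x * f x - a) ^ 2 := by
  have h : ∀ x, p x * (f x - a) ^ 2 = p x * f x ^ 2 - 2 * a * (p x * f x) + a ^ 2 * p x :=
    fun x => by ring
  simp only [h, Finset.sum_add_distrib, Finset.sum_sub_distrib, ← Finset.mul_sum, hp.sum_eq]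
  ring

lemma sq_sum_le_sum_sq {Ω : Type*} [Fintype Ω] {p : Ω → ℝ} (hp : IsWeight p) (f : Ω → ℝ) :
    (∑ x, p x * f x) ^ 2 ≤ ∑ x, p x * f x ^ 2 := by
  have h := sum_sq_sub_sq_eq hp f (∑ x, p x * f x)
  have h2 : 0 ≤ ∑ x, p x * (f x - ∑ x, p x * f x) ^ 2 :=
    Finset.sum_nonneg fun x _ => mul_nonneg (hp.nonneg x) (sq_nonneg _)
  nlinarith

/-- **Efron–Stein inequality** for a product of finite probability spaces; `m' l` is any
approximation of `m` that does not depend on the coordinate `l`. -/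
lemma efronStein (hw : IsWeight w) {L : ℕ} (m : (Fin L → κ) → ℝ) (m' : Fin L → (Fin L → κ) → ℝ)
    (hm : ∀ l x k, m' l (Function.update x l k) = m' l x) :
    ∑ x, prodWeight w L x * m x ^ 2 - (∑ x, prodWeight w L x * m x) ^ 2 ≤
      ∑ l, ∑ x, prodWeight w L x * (m x - m' l x) ^ 2 := by
  induction L with
  | zero => simp [prodWeight]
  | succ L ih =>
    have hp := isWeight_prodWeight hw L
    rw [Fin.sum_univ_succ]
    simp only [sum_fin_succ_fun, prodWeight_cons, mul_assoc, ← Finset.mul_sum]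
    have h1 : ∀ k, ∑ y, prodWeight w L y * m (Fin.cons k y) ^ 2 -
        (∑ y, prodWeight w L y * m (Fin.cons k y)) ^ 2 ≤
        ∑ l : Fin L, ∑ y, prodWeight w L y *
          (m (Fin.cons k y) - m' l.succ (Fin.cons k y)) ^ 2 := fun k =>
      ih (fun y => m (Fin.cons k y)) (fun l y => m' l.succ (Fin.cons k y)) fun l y j => by
        rw [Fin.cons_update, hm]
    set A : κ → ℝ := fun k => ∑ y, prodWeight w L y * m (Fin.cons k y) with hA
    obtain ⟨k₀⟩ : Nonempty κ := by
      by_contra hn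
      rw [not_nonempty_iff] at hn
      simpa using hw.sum_eq
    set a := ∑ y, prodWeight w L y * m' 0 (Fin.cons k₀ y) with ha
    have h2 : ∀ k, (A k - a) ^ 2 ≤
        ∑ y, prodWeight w L y * (m (Fin.cons k y) - m' 0 (Fin.cons k y)) ^ 2 := by
      intro k
      have e : A k - a = ∑ y, prodWeight w L y * (m (Fin.cons k y) - m' 0 (Fin.cons k y)) := by
        simp only [hA, ha, ← Finset.sum_sub_distrib, mul_sub]
        refine Finset.sum_congr rfl fun y _ => ?_
        have := hm 0 (Fin.cons k₀ y) k
        rw [Fin.update_cons_zero] at this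
        rw [this]
      rw [e]
      exact sq_sum_le_sum_sq hp _
    have h3 := sum_sq_sub_sq_eq hw A a
    have h4 := Finset.sum_le_sum fun k (_ : k ∈ Finset.univ) =>
      mul_le_mul_of_nonneg_left (h1 k) (hw.nonneg k)
    have h5 := Finset.sum_le_sum fun k (_ : k ∈ Finset.univ) =>
      mul_le_mul_of_nonneg_left (h2 k) (hw.nonneg k)
    simp only [mul_sub, Finset.sum_sub_distrib] at h4
    have h6 : ∑ k, w k * ∑ l : Fin L, ∑ y, prodWeight w L y *
          (m (Fin.cons k y) - m' l.succ (Fin.cons k y)) ^ 2 = ∑ l : Fin L, ∑ k, w k *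
          ∑ y, prodWeight w L y * (m (Fin.cons k y) - m' l.succ (Fin.cons k y)) ^ 2 := by
      simp only [Finset.mul_sum]
      rw [Finset.sum_comm]
    rw [h6] at h4
    nlinarith [sq_nonneg (∑ k, w k * A k - a)]

/-- Resampling one coordinate of a product weight. -/
lemma sum_prodWeight_update {L : ℕ} [DecidableEq κ] (hw : IsWeight w) (l : Fin L) (k : κ)
    (G : (Fin L → κ) → ℝ) :
    w k * ∑ x, prodWeight w L x * G (Function.update x l k) =
      ∑ x, prodWeight w L x * (if x l = k then 1 else 0) * G x := by
  obtain ⟨L, rfl⟩ : ∃ L', L = L' + 1 := ⟨L - 1, by have := l.pos; omega⟩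
  have e : ∀ f : (Fin (L + 1) → κ) → ℝ, ∑ x, f x = ∑ j, ∑ y : Fin L → κ, f (l.insertNth j y) := by
    intro f
    rw [← Fintype.sum_prod_type', ← (Fin.insertNthEquiv (fun _ : Fin (L + 1) => κ) l).sum_comp]
    rfl
  have ew : ∀ j (y : Fin L → κ),
      prodWeight w (L + 1) (l.insertNth j y) = w j * prodWeight w L y := by
    intro j y
    simp [prodWeight, Fin.prod_univ_succAbove _ l]
  simp only [e, ew, Fin.insertNth_apply_same, Fin.update_insertNth]
  rw [Finset.sum_comm, Finset.sum_comm (γ := κ), Finset.mul_sum]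
  refine Finset.sum_congr rfl fun y _ => ?_
  have h1 : ∑ j, w j * prodWeight w L y * G (l.insertNth k y) =
      prodWeight w L y * G (l.insertNth k y) := by
    simp only [mul_assoc, ← Finset.sum_mul, hw.sum_eq, one_mul]
  rw [h1]
  simp
  ring

lemma sum_prodWeight_eval {L : ℕ} (hw : IsWeight w) (l : Fin L) (f : κ → ℝ) :
    ∑ x, prodWeight w L x * f (x l) = ∑ k, w k * f k := by
  obtain ⟨L, rfl⟩ : ∃ L', L = L' + 1 := ⟨L - 1, by have := l.pos; omega⟩
  rw [← (Fin.insertNthEquiv (fun _ : Fin (L + 1) => κ) l).sum_comp, Fintype.sum_prod_type]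
  refine Finset.sum_congr rfl fun k _ => ?_
  have ew : ∀ (y : Fin L → κ), prodWeight w (L + 1) (l.insertNth k y) = w k * prodWeight w L y := by
    intro y
    simp [prodWeight, Fin.prod_univ_succAbove _ l]
  have e : ∀ y : Fin L → κ, prodWeight w (L + 1) ((Fin.insertNthEquiv (fun _ => κ) l) (k, y)) *
      f ((Fin.insertNthEquiv (fun _ : Fin (L + 1) => κ) l) (k, y) l) =
      w k * f k * prodWeight w L y := by
    intro y
    have h1 : (Fin.insertNthEquiv (fun _ : Fin (L + 1) => κ) l) (k, y) = l.insertNth k y := rfl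
    rw [h1, ew, Fin.insertNth_apply_same]
    ring
  simp only [e]
  rw [← Finset.mul_sum, (isWeight_prodWeight hw L).sum_eq, mul_one]

end EfronStein

lemma mul_log_sq_le {t : ℝ} (h0 : 0 ≤ t) (h1 : t ≤ 1) : t * Real.log t ^ 2 ≤ 4 := by
  rcases h0.eq_or_lt with rfl | h0
  · simp
  have hs : 0 < √t := Real.sqrt_pos.2 h0
  have h := Real.abs_log_mul_self_lt (√t) hs (Real.sqrt_le_one.2 h1)
  have h2 : Real.log t = 2 * Real.log (√t) := by
    rw [Real.log_sqrt h0.le]; ring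
  have h3 : t * Real.log t ^ 2 = 4 * (Real.log (√t) * √t) ^ 2 := by
    rw [h2, mul_pow _ (√t), Real.sq_sqrt h0.le]; ring
  rw [h3]
  have := sq_abs (Real.log (√t) * √t)
  nlinarith [abs_nonneg (Real.log (√t) * √t)]

namespace Signal

section

variable {Ω R N : Type*} [Fintype Ω] [Fintype R] [Fintype N] (𝒮 : Signal Ω N)

lemma sum_expoGrad_sq (t : ℝ × ℝ) (s x : Ω) (ω : Coord R N → ℝ) :
    ∑ j, expoGrad 𝒮.c t ω (𝒮.disp s x) j ^ 2 =
      t.1 ^ 2 * (𝒮.c ^ 2 * ∑ i, 𝒮.disp s x i ^ 2) * 𝒮.residual t.1 s ω x +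
      t.1 ^ 2 * ∑ μ, field 𝒮.c (𝒮.disp s x) ω μ ^ 2 + t.2 ^ 2 * ∑ i, 𝒮.disp s x i ^ 2 := by
  rw [Fintype.sum_sum_type, Fintype.sum_sum_type, Fintype.sum_prod_type, ← add_assoc]
  congr 1
  · congr 1
    · unfold residual
      rw [Finset.mul_sum]
      refine Finset.sum_congr rfl fun μ _ => ?_
      rw [Finset.mul_sum, Finset.mul_sum, Finset.sum_mul]
      exact Finset.sum_congr rfl fun i _ => by simp only [expoGrad]; ring
    · rw [Finset.mul_sum]
      exact Finset.sum_congr rfl fun i _ => by simp only [expoGrad]; ring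
  · rw [Finset.mul_sum]
    exact Finset.sum_congr rfl fun i _ => by simp only [expoGrad]; ring

/-- The conditional variance of the log-partition function given the signal, bounded by the Gaussian
Poincaré inequality; the Nishimori identity evaluates the resulting Dirichlet energy. -/
lemma sum_condVar_logZ_le {C : ℝ} (hC : ∀ x, 𝒮.c ^ 2 * ∑ i, 𝒮.X x i ^ 2 ≤ C) (hc : 𝒮.c ≠ 0)
    (t : ℝ × ℝ) :
    ∑ s, 𝒮.p s * (∫ ω, 𝒮.logZ t s ω ^ 2 ∂(stdGauss (Coord R N)) -
        (∫ ω, 𝒮.logZ t s ω ∂(stdGauss (Coord R N))) ^ 2) ≤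
      8 * C * t.1 ^ 2 * Fintype.card R + 4 * C * t.2 ^ 2 / 𝒮.c ^ 2 := by
  classical
  have hC0 : 0 ≤ C := by
    obtain ⟨x⟩ : Nonempty Ω := by
      by_contra hn
      rw [not_nonempty_iff] at hn
      simpa using 𝒮.isWeight.sum_eq
    exact (mul_nonneg (sq_nonneg _) (Finset.sum_nonneg fun i _ => sq_nonneg _)).trans (hC x)
  have hg : ∀ s x j, PolyGrowth (fun ω : Coord R N → ℝ => expoGrad 𝒮.c t ω (𝒮.disp s x) j) :=
    fun s x j => (PolyGrowth.expoGrad 𝒮.c (𝒮.disp s x) j).slice_left t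
  have hp : ∀ s j, PolyGrowth (fun ω : Coord R N → ℝ => 𝒮.post t s ω fun x =>
      expoGrad 𝒮.c t ω (𝒮.disp s x) j) := fun s j => 𝒮.polyGrowth_post_slice t (fun x => hg s x j) s
  have h1 : ∑ s, 𝒮.p s * (∫ ω, 𝒮.logZ t s ω ^ 2 ∂(stdGauss (Coord R N)) -
        (∫ ω, 𝒮.logZ t s ω ∂(stdGauss (Coord R N))) ^ 2) ≤
      expect 𝒮.p fun s (ω : Coord R N → ℝ) => ∑ j, (𝒮.post t s ω fun x =>
        expoGrad 𝒮.c t ω (𝒮.disp s x) j) ^ 2 := by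
    refine Finset.sum_le_sum fun s _ => mul_le_mul_of_nonneg_left ?_ (𝒮.isWeight.nonneg s)
    rw [integral_finsetSum _ fun j _ => ((hp s j).pow 2).integrable _]
    exact poincare_stdGauss ((𝒮.polyGrowth_logZ s).slice_left t) (hp s)
      fun u u' τ hu => 𝒮.hasDerivAt_logZ_curve t s hu
  have hP1 : ∀ s, PolyGrowth (fun ω : Coord R N → ℝ => 𝒮.post t s ω fun x =>
      𝒮.residual t.1 s ω x) := fun s => 𝒮.polyGrowth_post_slice t (𝒮.polyGrowth_residual t.1 s) s
  have hP2 : ∀ s, PolyGrowth (fun ω : Coord R N → ℝ => 𝒮.post t s ω fun x =>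
      ∑ μ, field 𝒮.c (𝒮.disp s x) ω μ ^ 2) := fun s => 𝒮.polyGrowth_post_slice t
        (fun x => .sum _ fun μ _ => (PolyGrowth.field _ _ μ).pow 2) s
  have h2 : expect 𝒮.p (fun s (ω : Coord R N → ℝ) => ∑ j, (𝒮.post t s ω fun x =>
        expoGrad 𝒮.c t ω (𝒮.disp s x) j) ^ 2) ≤
      expect 𝒮.p fun s (ω : Coord R N → ℝ) => t.1 ^ 2 * (4 * C) * (𝒮.post t s ω fun x =>
        𝒮.residual t.1 s ω x) + t.1 ^ 2 * (𝒮.post t s ω fun x =>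
        ∑ μ, field 𝒮.c (𝒮.disp s x) ω μ ^ 2) + t.2 ^ 2 * (4 * C / 𝒮.c ^ 2) := by
    refine expect_mono 𝒮.isWeight (fun s => .sum _ fun j _ => (hp s j).pow 2)
      (fun s => (((hP1 s).const_mul _).add ((hP2 s).const_mul _)).add (.const _)) fun s ω => ?_
    have e1 : ∑ j, (𝒮.post t s ω fun x => expoGrad 𝒮.c t ω (𝒮.disp s x) j) ^ 2 ≤
        𝒮.post t s ω fun x => ∑ j, expoGrad 𝒮.c t ω (𝒮.disp s x) j ^ 2 := by
      unfold post
      rw [gibbs_sum]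
      exact Finset.sum_le_sum fun j _ => sq_gibbs_le 𝒮.isWeight
    refine e1.trans ?_
    unfold post
    rw [← gibbs_const_mul, ← gibbs_const_mul, ← gibbs_const
      (e := fun x => expo 𝒮.c t ω (𝒮.disp s x)) 𝒮.isWeight (t.2 ^ 2 * (4 * C / 𝒮.c ^ 2)),
      ← gibbs_add, ← gibbs_add]
    refine gibbs_mono 𝒮.isWeight fun x => ?_
    rw [sum_expoGrad_sq]
    have hd := 𝒮.sum_disp_sq_le hC s x
    have hc2 : 0 < 𝒮.c ^ 2 := by positivity
    have hr : 0 ≤ 𝒮.residual t.1 s ω x := Finset.sum_nonneg fun _ _ => sq_nonneg _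
    have hd2 : ∑ i, 𝒮.disp s x i ^ 2 ≤ 4 * C / 𝒮.c ^ 2 := by
      rw [le_div_iff₀ hc2]; linarith
    gcongr
  refine h1.trans (h2.trans ?_)
  rw [expect_add (fun s => ((hP1 s).const_mul _).add ((hP2 s).const_mul _)) (fun s => .const _),
    expect_add (fun s => (hP1 s).const_mul _) (fun s => (hP2 s).const_mul _),
    expect_const_mul, expect_const_mul, expect_const 𝒮.isWeight]
  have h3 : expect 𝒮.p (fun s (ω : Coord R N → ℝ) => 𝒮.post t s ω fun x =>
        𝒮.residual t.1 s ω x) = Fintype.card R := by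
    have h := 𝒮.expect_post_residual (R := R) t 0
    have e1 : ∀ s x (ω : Coord R N → ℝ), |𝒮.residual t.1 s ω x| = 𝒮.residual t.1 s ω x :=
      fun s x ω => abs_of_nonneg (Finset.sum_nonneg fun _ _ => sq_nonneg _)
    have e2 : ∀ ω : Coord R N → ℝ,
        |∑ μ : R, ω (.inr (.inl μ)) ^ 2| = ∑ μ : R, ω (.inr (.inl μ)) ^ 2 := fun ω =>
      abs_of_nonneg (Finset.sum_nonneg fun _ _ => sq_nonneg _)
    simp only [sub_zero, e1, e2] at h
    rw [h, expect_sum _ fun μ s => (PolyGrowth.of_eval _).pow 2]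
    simp [expect_sq_coord]
  have h4 := 𝒮.expect_post_field_sq_le (R := R) hC t
  rw [h3]
  have := mul_le_mul_of_nonneg_left h4 (sq_nonneg t.1)
  have e : 4 * C * t.2 ^ 2 / 𝒮.c ^ 2 = t.2 ^ 2 * (4 * C / 𝒮.c ^ 2) := by ring
  rw [e]
  linarith

end

/-- The signal made of `L` independent sections, each taking the value `a k` with probability
`w k`. -/
def sections {κ B : Type*} [Fintype κ] {w : κ → ℝ} (hw : IsWeight w) (a : κ → B → ℝ) (L : ℕ)
    (c : ℝ) : Signal (Fin L → κ) (Fin L × B) where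
  p := prodWeight w L
  X x i := a (x i.1) i.2
  c := c
  isWeight := isWeight_prodWeight hw L

section Sections

variable {κ B R : Type*} [Fintype κ] [Fintype B] [Fintype R] {w : κ → ℝ} (hw : IsWeight w)
  (a : κ → B → ℝ) (L : ℕ) (c : ℝ)

/-- The log-partition function with the section `l` of the configuration pinned to the signal. -/
def logZPinned (t : ℝ × ℝ) (l : Fin L) (s : Fin L → κ) (ω : Coord R (Fin L × B) → ℝ) : ℝ :=
  Real.log (partitionFn (prodWeight w L)
    (fun x => expo c t ω ((sections hw a L c).disp s (Function.update x l (s l)))))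

lemma polyGrowth_logZPinned (t : ℝ × ℝ) (l : Fin L) (s : Fin L → κ) :
    PolyGrowth (logZPinned (R := R) hw a L c t l s) :=
  (PolyGrowth.log_partitionFn (isWeight_prodWeight hw L).nonneg
    (by rw [(isWeight_prodWeight hw L).sum_eq]; exact one_pos)
    (fun x => PolyGrowth.expo c _)).slice_left (W := ℝ × ℝ) t

lemma logZPinned_update (t : ℝ × ℝ) (l : Fin L) (s : Fin L → κ) (k : κ)
    (ω : Coord R (Fin L × B) → ℝ) :
    logZPinned hw a L c t l (Function.update s l k) ω = logZPinned hw a L c t l s ω := by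
  unfold logZPinned
  have : ∀ x : Fin L → κ, (sections hw a L c).disp (Function.update s l k)
      (Function.update x l (Function.update s l k l)) =
      (sections hw a L c).disp s (Function.update x l (s l)) := by
    intro x
    ext ⟨l', b⟩
    simp only [disp, sections]
    by_cases h : l' = l
    · subst h; simp
    · simp [Function.update_of_ne h]
  simp only [this]

variable [DecidableEq κ]

/-- The sum over configurations that are right in section `l` is `w (s l)` times the pinned
partition function, so pinning changes the log-partition function by two logarithms of
probabilities. -/
lemma logZ_sub_logZPinned (t : ℝ × ℝ) (l : Fin L) (s : Fin L → κ) (hs : 0 < w (s l))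
    (ω : Coord R (Fin L × B) → ℝ) :
    (sections hw a L c).logZ t s ω - logZPinned hw a L c t l s ω =
      Real.log (w (s l)) -
        Real.log ((sections hw a L c).post t s ω fun x => if x l = s l then 1 else 0) := by
  have h := sum_prodWeight_update hw l (s l)
    (fun x => Real.exp (expo c t ω ((sections hw a L c).disp s x)))
  have hp := isWeight_prodWeight hw L
  have h1 : 0 < partitionFn (prodWeight w L)
    (fun x => expo c t ω ((sections hw a L c).disp s (Function.update x l (s l)))) :=
    partitionFn_pos hp
  have h2 : 0 < partitionFn (prodWeight w L)
    (fun x => expo c t ω ((sections hw a L c).disp s x)) := partitionFn_pos hp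
  have e : ((sections hw a L c).post t s ω fun x => if x l = s l then (1 : ℝ) else 0) =
      w (s l) * partitionFn (prodWeight w L)
        (fun x => expo c t ω ((sections hw a L c).disp s (Function.update x l (s l)))) /
      partitionFn (prodWeight w L) (fun x => expo c t ω ((sections hw a L c).disp s x)) := by
    unfold post gibbs
    congr 1
    unfold partitionFn
    rw [h]
    refine Finset.sum_congr rfl fun x _ => ?_
    simp only [sections]; ring
  rw [e, Real.log_div (mul_pos hs h1).ne' h2.ne', Real.log_mul hs.ne' h1.ne']
  unfold logZ logZPinned
  simp only [sections]
  ring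

/-- The logarithm of the posterior probability of the true value of a section is bounded in
mean square: by the Nishimori identity its second moment is that of an entropy. -/
lemma expect_log_post_sq_le (t : ℝ × ℝ) (l : Fin L) :
    expect (prodWeight w L) (fun s (ω : Coord R (Fin L × B) → ℝ) =>
      Real.log ((sections hw a L c).post t s ω fun x => if x l = s l then 1 else 0) ^ 2) ≤
      4 * Fintype.card κ ∧ ∀ s, PolyGrowth (fun ω : Coord R (Fin L × B) → ℝ =>
      Real.log ((sections hw a L c).post t s ω fun x => if x l = s l then 1 else 0)) := by
  set 𝒮 := sections hw a L c with h𝒮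
  let P : κ → (Coord R (Fin L × B) → ℝ) → ℝ := fun k y =>
    gibbs 𝒮.p (fun x => expo 𝒮.c t y (𝒮.X x)) fun x => if x l = k then 1 else 0
  have hlog : ∀ (k : κ) (e : (Fin L → κ) → (Coord R (Fin L × B) → ℝ) → ℝ),
      (∀ x, PolyGrowth (e x)) → PolyGrowth (fun y => Real.log (gibbs 𝒮.p (fun x => e x y)
        fun x => if x l = k then 1 else 0)) := by
    intro k e he
    let q : (Fin L → κ) → ℝ := fun x => 𝒮.p x * if x l = k then 1 else 0
    have hq : ∀ x, 0 ≤ q x := fun x => mul_nonneg (𝒮.isWeight.nonneg x) (by split_ifs <;> norm_num)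
    have eq : ∀ y, gibbs 𝒮.p (fun x => e x y) (fun x => if x l = k then 1 else 0) =
        partitionFn q (fun x => e x y) / partitionFn 𝒮.p fun x => e x y := by
      intro y
      unfold gibbs
      congr 1
      exact Finset.sum_congr rfl fun x _ => by simp only [q]; ring
    simp only [eq]
    -- a value `k` of probability zero has a vanishing posterior, and then `log 0 = 0`
    rcases (Finset.sum_nonneg fun x _ => hq x).eq_or_lt with h0 | h0
    · have hz : ∀ x, q x = 0 := fun x =>
        (Finset.sum_eq_zero_iff_of_nonneg fun x _ => hq x).1 h0.symm x (Finset.mem_univ x)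
      have : ∀ y, partitionFn q (fun x => e x y) = 0 := fun y => by simp [partitionFn, hz]
      simp only [this, zero_div, Real.log_zero]
      exact .const 0
    · have : ∀ y, Real.log (partitionFn q (fun x => e x y) / partitionFn 𝒮.p fun x => e x y) =
          Real.log (partitionFn q (fun x => e x y)) -
            Real.log (partitionFn 𝒮.p fun x => e x y) := fun y =>
        Real.log_div (partitionFn_pos_of_sum_pos hq h0).ne' (partitionFn_pos 𝒮.isWeight).ne'
      simp only [this]
      exact (PolyGrowth.log_partitionFn hq h0 he).sub (PolyGrowth.log_partitionFn
        𝒮.isWeight.nonneg (by rw [𝒮.isWeight.sum_eq]; exact one_pos) he)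
  constructor
  · have hPl : ∀ k, PolyGrowth (fun y => Real.log (P k y)) := fun k =>
      hlog k _ fun x => (PolyGrowth.expo 𝒮.c (𝒮.X x)).slice_left t
    have n := 𝒮.nishimori t (Ψ := fun x y => Real.log (P (x l) y) ^ 2) fun x => (hPl _).pow 2
    have e1 : ∀ s (ω : Coord R (Fin L × B) → ℝ),
        (𝒮.post t s ω fun x => if x l = s l then 1 else 0) = P (s l) (𝒮.obs t s ω) := fun s ω =>
      𝒮.post_eq_gibbs_obs t s ω _
    simp only [e1]
    change expect 𝒮.p _ ≤ _
    rw [n, ← expect_const (J := Coord R (Fin L × B)) 𝒮.isWeight (4 * (Fintype.card κ : ℝ))]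
    have hgr : ∀ s, PolyGrowth (fun ω : Coord R (Fin L × B) → ℝ =>
        𝒮.post t s ω fun x => Real.log (P (x l) (𝒮.obs t s ω)) ^ 2) := fun s =>
      𝒮.polyGrowth_post_slice t (fun x => ((hPl (x l)).pow 2).comp_pi (𝒮.polyGrowth_obs t s)) s
    refine expect_mono 𝒮.isWeight hgr (fun s => .const _) fun s ω => ?_
    have e2 : ∀ x : Fin L → κ, Real.log (P (x l) (𝒮.obs t s ω)) ^ 2 =
        ∑ k, Real.log (P k (𝒮.obs t s ω)) ^ 2 * if x l = k then 1 else 0 := fun x => by simp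
    rw [post_eq_gibbs_obs]
    simp only [e2]
    rw [gibbs_sum]
    simp only [gibbs_const_mul]
    have : (4 * (Fintype.card κ : ℝ)) = ∑ k : κ, (4 : ℝ) := by simp [mul_comm]
    rw [this]
    refine Finset.sum_le_sum fun k _ => ?_
    rw [mul_comm]
    refine mul_log_sq_le (gibbs_nonneg 𝒮.isWeight fun x => by split_ifs <;> norm_num) ?_
    exact (gibbs_mono (r := fun _ => 1) 𝒮.isWeight fun x => by split_ifs <;> norm_num).trans_eq
      (gibbs_const 𝒮.isWeight 1)
  · intro s
    exact hlog (s l) _ fun x => (PolyGrowth.expo 𝒮.c (𝒮.disp s x)).slice_left t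

variable {L c}

/-- The variance of the log-partition function: the Poincaré inequality for the Gaussian
coordinates, and the Efron–Stein inequality for the conditional mean as a function of the signal,
compared with its value when one section is pinned. -/
lemma expect_sq_logZ_sub_le {C : ℝ}
    (hC : ∀ x, c ^ 2 * ∑ i, (sections hw a L c).X x i ^ 2 ≤ C) (hc : c ≠ 0) (t : ℝ × ℝ) :
    expect (prodWeight w L) (fun s (ω : Coord R (Fin L × B) → ℝ) =>
      ((sections hw a L c).logZ t s ω - (sections hw a L c).meanLogZ R t) ^ 2) ≤
      8 * C * t.1 ^ 2 * Fintype.card R + 4 * C * t.2 ^ 2 / c ^ 2 + 16 * Fintype.card κ * L := by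
  set 𝒮 := sections hw a L c with h𝒮
  have hp := isWeight_prodWeight hw L
  have hF : ∀ s, PolyGrowth (𝒮.logZ (R := R) t s) := fun s => (𝒮.polyGrowth_logZ s).slice_left t
  have hFl : ∀ l s, PolyGrowth (logZPinned (R := R) hw a L c t l s) :=
    polyGrowth_logZPinned hw a L c t
  set γ := stdGauss (Coord R (Fin L × B))
  let m : (Fin L → κ) → ℝ := fun s => ∫ ω, 𝒮.logZ t s ω ∂γ
  have h1 := 𝒮.sum_condVar_logZ_le (R := R) hC hc t
  have h2 := efronStein hw m (fun l s => ∫ ω, logZPinned (R := R) hw a L c t l s ω ∂γ)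
    fun l s k => by simp only [logZPinned_update]
  have h3 : ∀ l, ∑ s, prodWeight w L s *
      (m s - ∫ ω, logZPinned (R := R) hw a L c t l s ω ∂γ) ^ 2 ≤ 16 * Fintype.card κ := by
    intro l
    obtain ⟨h5, h6⟩ := expect_log_post_sq_le (R := R) hw a L c t l
    simp only [← h𝒮] at h5 h6
    have h4 : ∑ s, prodWeight w L s *
        (m s - ∫ ω, logZPinned (R := R) hw a L c t l s ω ∂γ) ^ 2 ≤
        expect (prodWeight w L) (fun s (ω : Coord R (Fin L × B) → ℝ) =>
          2 * Real.log (w (s l)) ^ 2 + 2 *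
          Real.log (𝒮.post t s ω fun x => if x l = s l then 1 else 0) ^ 2) := by
      refine Finset.sum_le_sum fun s _ => ?_
      rcases (hw.nonneg (s l)).eq_or_lt with h0 | h0
      · have : prodWeight w L s = 0 := Finset.prod_eq_zero (Finset.mem_univ l) h0.symm
        simp [this]
      refine mul_le_mul_of_nonneg_left ?_ (hp.nonneg s)
      have hd := (hF s).sub (hFl l s)
      simp only [m]
      rw [← integral_sub ((hF s).integrable _) ((hFl l s).integrable _)]
      have hj : (∫ ω, (𝒮.logZ t s ω - logZPinned (R := R) hw a L c t l s ω) ∂γ) ^ 2 ≤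
          ∫ ω, (𝒮.logZ t s ω - logZPinned (R := R) hw a L c t l s ω) ^ 2 ∂γ := by
        have := sq_expect_le (p := fun _ : Unit => (1 : ℝ)) ⟨by simp, by simp⟩
          (f := fun _ ω => 𝒮.logZ t s ω - logZPinned (R := R) hw a L c t l s ω) fun _ => hd
        simpa [expect] using this
      refine hj.trans (integral_mono ((hd.pow 2).integrable _)
        (((PolyGrowth.const _).add (((h6 s).pow 2).const_mul 2)).integrable _) fun ω => ?_)
      change (𝒮.logZ t s ω - logZPinned (R := R) hw a L c t l s ω) ^ 2 ≤ _
      rw [h𝒮, logZ_sub_logZPinned hw a L c t l s h0]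
      nlinarith [sq_nonneg (Real.log (w (s l)) +
        Real.log ((sections hw a L c).post t s ω fun x => if x l = s l then 1 else 0))]
    refine (h4.trans_eq (expect_add (fun s => .const _)
      (fun s => ((h6 s).pow 2).const_mul 2))).trans ?_
    have e1 := expect_const_mul (p := prodWeight w L) (f := fun s (ω : Coord R (Fin L × B) → ℝ) =>
      Real.log (𝒮.post t s ω fun x => if x l = s l then 1 else 0) ^ 2) 2
    have h7 : expect (prodWeight w L) (fun s (_ : Coord R (Fin L × B) → ℝ) =>
        2 * Real.log (w (s l)) ^ 2) ≤ 8 * Fintype.card κ := by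
      unfold expect
      simp only [integral_const, probReal_univ, one_smul]
      rw [sum_prodWeight_eval hw l fun k => 2 * Real.log (w k) ^ 2]
      have : (8 * (Fintype.card κ : ℝ)) = ∑ k : κ, (8 : ℝ) := by simp [mul_comm]
      rw [this]
      exact Finset.sum_le_sum fun k _ => by linarith [mul_log_sq_le (hw.nonneg k) (hw.le_one k)]
    linarith
  have h8 : ∑ l, ∑ s, prodWeight w L s *
      (m s - ∫ ω, logZPinned (R := R) hw a L c t l s ω ∂γ) ^ 2 ≤ 16 * Fintype.card κ * L := by
    refine (Finset.sum_le_sum fun l _ => h3 l).trans (le_of_eq ?_)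
    simp [mul_comm]
  have hmean : 𝒮.meanLogZ R t = ∑ s, prodWeight w L s * m s := rfl
  have e : expect (prodWeight w L) (fun s (ω : Coord R (Fin L × B) → ℝ) =>
      (𝒮.logZ t s ω - 𝒮.meanLogZ R t) ^ 2) =
      ∑ s, prodWeight w L s * (∫ ω, 𝒮.logZ t s ω ^ 2 ∂γ - m s ^ 2) +
      (∑ s, prodWeight w L s * m s ^ 2 - (∑ s, prodWeight w L s * m s) ^ 2) := by
    have e1 : (fun s (ω : Coord R (Fin L × B) → ℝ) => (𝒮.logZ t s ω - 𝒮.meanLogZ R t) ^ 2) =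
        fun s ω => (𝒮.logZ t s ω ^ 2 - (2 * 𝒮.meanLogZ R t) * 𝒮.logZ t s ω) +
          𝒮.meanLogZ R t ^ 2 := by
      ext s ω; ring
    rw [e1, expect_add (fun s => ((hF s).pow 2).sub ((hF s).const_mul _)) (fun s => .const _),
      expect_sub (fun s => (hF s).pow 2) (fun s => (hF s).const_mul _), expect_const_mul,
      expect_const hp]
    have e2 : expect (prodWeight w L) (𝒮.logZ (R := R) t) = 𝒮.meanLogZ R t := rfl
    have e3 : expect (prodWeight w L) (fun s (ω : Coord R (Fin L × B) → ℝ) => 𝒮.logZ t s ω) =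
      𝒮.meanLogZ R t := rfl
    simp only [mul_sub, Finset.sum_sub_distrib]
    rw [← hmean, e3]
    simp only [expect]
    ring
  rw [e]
  have h1' : ∑ s, prodWeight w L s * (∫ ω, 𝒮.logZ t s ω ^ 2 ∂γ - m s ^ 2) ≤
      8 * C * t.1 ^ 2 * Fintype.card R + 4 * C * t.2 ^ 2 / c ^ 2 := h1
  linarith

end Sections

end Signal

/-! ### Concentration of the noise correlation -/

section Interval

variable {V : Type*} [NormedAddCommGroup V]

lemma PolyGrowth.bound_on_interval {f : ℝ × V → ℝ} (hf : PolyGrowth f) (a b : ℝ) :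
    ∃ (C : ℝ) (n : ℕ), ∀ τ ∈ Set.uIcc a b, ∀ v, |f (τ, v)| ≤ C * (1 + ‖v‖) ^ n := by
  obtain ⟨C, n, hC, h⟩ := hf.exists_bound
  refine ⟨C * (1 + |a| + |b|) ^ n, n, fun τ hτ v => (h _).trans ?_⟩
  have h1 : |τ| ≤ |a| + |b| := by
    obtain ⟨h1, h2⟩ := hτ
    rw [abs_le]
    constructor
    · refine le_trans ?_ h1
      rcases min_cases a b with ⟨h, _⟩ | ⟨h, _⟩ <;> rw [h] <;>
        linarith [neg_abs_le a, neg_abs_le b, abs_nonneg a, abs_nonneg b]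
    · refine h2.trans ?_
      rcases max_cases a b with ⟨h, _⟩ | ⟨h, _⟩ <;> rw [h] <;>
        linarith [le_abs_self a, le_abs_self b, abs_nonneg a, abs_nonneg b]
  have h2 : ‖(τ, v)‖ ≤ |τ| + ‖v‖ := max_le_add_of_nonneg (norm_nonneg _) (norm_nonneg _)
  rw [mul_assoc, ← mul_pow]
  refine mul_le_mul_of_nonneg_left (pow_le_pow_left₀ (by positivity) ?_ n) hC
  nlinarith [norm_nonneg v, abs_nonneg a, abs_nonneg b,
    mul_nonneg (add_nonneg (abs_nonneg a) (abs_nonneg b)) (norm_nonneg v)]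

lemma PolyGrowth.intervalIntegral {f : ℝ × V → ℝ} (hf : PolyGrowth f) (a b : ℝ) :
    PolyGrowth (fun v => ∫ τ in a..b, f (τ, v)) := by
  obtain ⟨C, n, h⟩ := hf.bound_on_interval a b
  refine ⟨?_, C * |b - a|, n, fun v => ?_⟩
  · exact intervalIntegral.continuous_parametric_intervalIntegral_of_continuous'
      (f := fun v τ => f (τ, v)) (by have := hf.1; fun_prop) a b
  · have := intervalIntegral.norm_integral_le_of_norm_le_const (a := a) (b := b)
      (f := fun τ => f (τ, v)) (C := C * (1 + ‖v‖) ^ n)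
      fun τ hτ => h τ (Set.uIoc_subset_uIcc hτ) v
    rw [Real.norm_eq_abs] at this
    linarith

lemma PolyGrowth.integral_intervalIntegral [NormedSpace ℝ V] [MeasurableSpace V] [BorelSpace V]
    [CompleteSpace V] [SecondCountableTopology V] {f : ℝ × V → ℝ} (hf : PolyGrowth f)
    (μ : Measure V) [IsGaussian μ] {a b : ℝ} (hab : a ≤ b) :
    ∫ v, (∫ τ in a..b, f (τ, v)) ∂μ = ∫ τ in a..b, (∫ v, f (τ, v) ∂μ) := by
  obtain ⟨C, n, h⟩ := hf.bound_on_interval a b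
  simp only [intervalIntegral.integral_of_le hab]
  refine integral_integral_swap (f := fun v τ => f (τ, v)) ?_
  have hi : Integrable (fun v : V => C * (1 + ‖v‖) ^ n) μ :=
    (PolyGrowth.integrable_one_add_norm_pow μ n).const_mul C
  refine (hi.comp_fst (volume.restrict (Set.Ioc a b))).mono' ?_ ?_
  · have := hf.1
    exact Continuous.aestronglyMeasurable (by unfold Function.uncurry; fun_prop)
  · have hae : ∀ᵐ τ ∂(volume.restrict (Set.Ioc a b)), τ ∈ Set.Ioc a b :=
      ae_restrict_mem measurableSet_Ioc
    have := (Measure.quasiMeasurePreserving_snd (μ := μ)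
      (ν := volume.restrict (Set.Ioc a b))).ae hae
    filter_upwards [this] with q hq
    exact h _ (Set.Ioc_subset_Icc_self.trans Set.Icc_subset_uIcc hq) _

end Interval

section Convexity

variable {φ φ' v W : ℝ → ℝ}

/-- A secant bound for a function whose second derivative is at least `-W`. -/
lemma mul_deriv_le_secant (h1 : ∀ τ, HasDerivAt φ (φ' τ) τ)
    (h2 : ∀ τ, HasDerivAt φ' (v τ - W τ) τ) (hv : ∀ τ, 0 ≤ v τ) (hW : ∀ τ, 0 ≤ W τ)
    (hWc : Continuous W) (h : ℝ) {δ : ℝ} (hδ : 0 ≤ δ) :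
    δ * φ' h ≤ φ (h + δ) - φ h + δ * ∫ τ in h..h + δ, W τ := by
  have hi : ∀ a b, IntervalIntegrable W volume a b := fun a b => hWc.intervalIntegrable a b
  have hm : Monotone (fun τ => φ' τ + ∫ u in h..τ, W u) := by
    refine monotone_of_hasDerivAt_nonneg (f' := v) (fun τ => ?_) hv
    exact ((h2 τ).fun_add (intervalIntegral.integral_hasDerivAt_right (hi h τ)
      (hWc.stronglyMeasurableAtFilter _ _) hWc.continuousAt)).congr_deriv (by ring)
  have h3 : ∀ τ ∈ Set.Icc h (h + δ), φ' h - ∫ u in h..h + δ, W u ≤ φ' τ := by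
    intro τ hτ
    have h4 := hm hτ.1
    simp only [intervalIntegral.integral_same, add_zero] at h4
    have h5 := intervalIntegral.integral_add_adjacent_intervals (hi h τ) (hi τ (h + δ))
    have h6 : 0 ≤ ∫ u in τ..h + δ, W u :=
      intervalIntegral.integral_nonneg hτ.2 fun u _ => hW u
    linarith
  have h7 := (convex_Icc h (h + δ)).mul_sub_le_image_sub_of_le_deriv
    (fun τ _ => (h1 τ).continuousAt.continuousWithinAt)
    (fun τ _ => (h1 τ).differentiableAt.differentiableWithinAt)
    (fun τ hτ => by rw [(h1 τ).deriv]; exact h3 τ (interior_subset hτ))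
    h (Set.left_mem_Icc.2 (by linarith)) (h + δ) (Set.right_mem_Icc.2 (by linarith)) (by linarith)
  linarith

lemma neg_mul_deriv_le_secant (h1 : ∀ τ, HasDerivAt φ (φ' τ) τ)
    (h2 : ∀ τ, HasDerivAt φ' (v τ - W τ) τ) (hv : ∀ τ, 0 ≤ v τ) (hW : ∀ τ, 0 ≤ W τ)
    (hWc : Continuous W) (h : ℝ) {δ : ℝ} (hδ : 0 ≤ δ) :
    -(δ * φ' h) ≤ φ (h - δ) - φ h + δ * ∫ τ in (h - δ)..h, W τ := by
  have := mul_deriv_le_secant (φ := fun τ => φ (-τ)) (φ' := fun τ => -φ' (-τ))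
    (v := fun τ => v (-τ)) (W := fun τ => W (-τ))
    (fun τ => ((h1 (-τ)).comp τ (hasDerivAt_neg τ)).congr_deriv (by ring))
    (fun τ => (((h2 (-τ)).comp τ (hasDerivAt_neg τ)).fun_neg).congr_deriv (by ring))
    (fun τ => hv _) (fun τ => hW _) (by fun_prop) (-h) hδ
  rw [intervalIntegral.integral_comp_neg] at this
  simp only [neg_neg, neg_add_rev, mul_neg] at this
  rw [show -δ + h = h - δ by ring] at this
  exact this

/-- The integral of a second difference is controlled by the derivative. -/
lemma integral_second_difference_le {a : ℝ → ℝ} {a' : ℝ → ℝ} (ha : ∀ h, HasDerivAt a (a' h) h)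
    {H δ A : ℝ} (hH : 0 ≤ H) (hδ : 0 ≤ δ) (hδ1 : δ ≤ 1) (hA : ∀ h, |h| ≤ H + 1 → |a' h| ≤ A) :
    ∫ h in 0..H, (a (h + δ) - a h + (a (h - δ) - a h)) ≤ 2 * δ ^ 2 * A := by
  have hac : Continuous a := continuous_iff_continuousAt.2 fun h => (ha h).continuousAt
  let b : ℝ → ℝ := fun h => a h - a (h - δ)
  have hbc : Continuous b := by fun_prop
  have hb : ∀ h, 0 ≤ h → h ≤ H + δ → |b h| ≤ δ * A := by
    intro h h0 h1
    have := (convex_Icc (h - δ) h).norm_image_sub_le_of_norm_hasDerivWithin_le (f := a) (f' := a')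
      (C := A) (fun x _ => (ha x).hasDerivWithinAt) (fun x hx => hA x (by
        rw [abs_le]; constructor <;> linarith [hx.1, hx.2]))
      (Set.left_mem_Icc.2 (by linarith)) (Set.right_mem_Icc.2 (by linarith))
    rw [Real.norm_eq_abs, Real.norm_eq_abs, sub_sub_cancel, abs_of_nonneg hδ] at this
    linarith
  have hi : ∀ a c, IntervalIntegrable b volume a c := fun a c => hbc.intervalIntegrable a c
  have e : ∫ h in 0..H, (a (h + δ) - a h + (a (h - δ) - a h)) =
      (∫ h in H..H + δ, b h) - ∫ h in 0..δ, b h := by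
    have e1 : ∀ h, a (h + δ) - a h + (a (h - δ) - a h) = b (h + δ) - b h := by
      intro h; simp only [b, add_sub_cancel_right]; ring
    simp only [e1]
    have hbδ : Continuous (fun h => b (h + δ)) := by fun_prop
    rw [intervalIntegral.integral_sub (hbδ.intervalIntegrable _ _)
      (hi _ _), intervalIntegral.integral_comp_add_right]
    have h1 := intervalIntegral.integral_add_adjacent_intervals (hi 0 H) (hi H (H + δ))
    have h2 := intervalIntegral.integral_add_adjacent_intervals (hi 0 δ) (hi δ (H + δ))
    rw [zero_add]
    linarith
  have h1 : ‖∫ h in H..H + δ, b h‖ ≤ δ * A * |H + δ - H| :=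
    intervalIntegral.norm_integral_le_of_norm_le_const fun h hh => by
      rw [Set.uIoc_of_le (by linarith)] at hh
      exact hb h (by linarith [hh.1]) hh.2
  have h2 : ‖∫ h in 0..δ, b h‖ ≤ δ * A * |δ - 0| :=
    intervalIntegral.norm_integral_le_of_norm_le_const fun h hh => by
      rw [Set.uIoc_of_le hδ] at hh
      exact hb h hh.1.le (by linarith [hh.2])
  rw [add_sub_cancel_left, abs_of_nonneg hδ, Real.norm_eq_abs] at h1
  rw [sub_zero, abs_of_nonneg hδ, Real.norm_eq_abs] at h2
  rw [e]
  have := (abs_le.1 h1).2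
  have := (abs_le.1 h2).1
  nlinarith

end Convexity

namespace Signal

variable {Ω R N : Type*} [Fintype Ω] [Fintype R] [Fintype N] (𝒮 : Signal Ω N)

/-- The squared norm of the noise fluctuates by the square root of the dimension. -/
lemma expect_abs_noise_sq_sub_le :
    expect 𝒮.p (fun _ (ω : Coord R N → ℝ) => |∑ μ, ω (.inr (.inl μ)) ^ 2 - Fintype.card R|) ≤
      2 * √(Fintype.card R) := by
  classical
  have hP : PolyGrowth (fun ω : Coord R N → ℝ => ∑ μ : R, ω (.inr (.inl μ)) ^ 2) :=
    .sum _ fun μ _ => (PolyGrowth.of_eval _).pow 2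
  refine (expect_abs_le_sqrt 𝒮.isWeight fun s => hP.sub (.const _)).trans ?_
  have h1 : expect 𝒮.p (fun _ (ω : Coord R N → ℝ) => ∑ μ : R, ω (.inr (.inl μ)) ^ 2) =
      Fintype.card R := by
    rw [expect_sum _ fun μ s => (PolyGrowth.of_eval _).pow 2]
    simp [expect_sq_coord]
  have h1' : ∫ ω : Coord R N → ℝ, ∑ μ : R, ω (.inr (.inl μ)) ^ 2 ∂(stdGauss (Coord R N)) =
      Fintype.card R := by
    simpa [expect, ← Finset.sum_mul, 𝒮.isWeight.sum_eq] using h1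
  have h2 := poincare_stdGauss (f := fun ω : Coord R N → ℝ => ∑ μ : R, ω (.inr (.inl μ)) ^ 2)
    (d := fun j ω => match j with
      | .inl _ => 0
      | .inr (.inl μ) => 2 * ω (.inr (.inl μ))
      | .inr (.inr _) => 0) hP
    (fun j => by
      match j with
      | .inl _ => exact .const 0
      | .inr (.inl μ) => exact (PolyGrowth.of_eval _).const_mul 2
      | .inr (.inr _) => exact .const 0)
    (fun u u' t hu => by
      refine (HasDerivAt.fun_sum fun μ _ => (hu (.inr (.inl μ))).fun_pow 2).congr_deriv ?_
      simp only [Fintype.sum_sum_type, mul_zero, Finset.sum_const_zero, zero_add, add_zero]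
      exact Finset.sum_congr rfl fun μ _ => by push_cast; ring)
  rw [h1'] at h2
  have h3 : ∀ μ : R, ∫ ω : Coord R N → ℝ, ω (.inr (.inl μ)) ^ 2 ∂(stdGauss (Coord R N)) = 1 := by
    intro μ
    have := integral_sq_linear_stdGauss (J := Coord R N) (Pi.single (.inr (.inl μ)) 1)
    simpa [Pi.single_apply] using this
  simp only [Fintype.sum_sum_type, mul_pow, integral_const_mul, h3, ne_eq, OfNat.ofNat_ne_zero,
    not_false_eq_true, zero_pow, integral_zero, Finset.sum_const_zero, zero_add, add_zero,
    Finset.sum_const, Finset.card_univ, nsmul_eq_mul] at h2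
  have h4 : expect 𝒮.p (fun _ (ω : Coord R N → ℝ) =>
      (∑ μ : R, ω (.inr (.inl μ)) ^ 2 - Fintype.card R) ^ 2) ≤ 4 * Fintype.card R := by
    have e : (fun (_ : Ω) (ω : Coord R N → ℝ) =>
        (∑ μ : R, ω (.inr (.inl μ)) ^ 2 - (Fintype.card R : ℝ)) ^ 2) = fun _ ω =>
        ((∑ μ : R, ω (.inr (.inl μ)) ^ 2) ^ 2 - (2 * Fintype.card R) *
          ∑ μ : R, ω (.inr (.inl μ)) ^ 2) + (Fintype.card R : ℝ) ^ 2 := by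
      ext s ω; ring
    rw [e, expect_add (fun s => (hP.pow 2).sub (hP.const_mul _)) (fun s => .const _),
      expect_sub (fun s => hP.pow 2) (fun s => hP.const_mul _), expect_const_mul, h1,
      expect_const 𝒮.isWeight]
    have e2 : expect 𝒮.p (fun _ (ω : Coord R N → ℝ) => (∑ μ : R, ω (.inr (.inl μ)) ^ 2) ^ 2) =
        ∫ ω : Coord R N → ℝ, (∑ μ : R, ω (.inr (.inl μ)) ^ 2) ^ 2 ∂(stdGauss (Coord R N)) := by
      simp [expect, ← Finset.sum_mul, 𝒮.isWeight.sum_eq]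
    rw [e2]
    linarith
  refine (Real.sqrt_le_sqrt h4).trans (le_of_eq ?_)
  rw [Real.sqrt_mul (by norm_num), show (4 : ℝ) = 2 ^ 2 by norm_num, Real.sqrt_sq (by norm_num)]

/-- The posterior average of the derivative in `h` of the exponent. -/
def dLogZ (t : ℝ × ℝ) (s : Ω) (ω : Coord R N → ℝ) : ℝ :=
  𝒮.post t s ω fun x => expoDerivMeas 𝒮.c t.1 ω (𝒮.disp s x)

/-- The posterior variance of the derivative in `h` of the exponent. -/
def varDeriv (t : ℝ × ℝ) (s : Ω) (ω : Coord R N → ℝ) : ℝ :=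
  𝒮.post t s ω fun x => (expoDerivMeas 𝒮.c t.1 ω (𝒮.disp s x) - 𝒮.dLogZ t s ω) ^ 2

/-- The posterior average of `‖Φ (x - S)‖²`. -/
def postField (t : ℝ × ℝ) (s : Ω) (ω : Coord R N → ℝ) : ℝ :=
  𝒮.post t s ω fun x => ∑ μ, field 𝒮.c (𝒮.disp s x) ω μ ^ 2

lemma polyGrowth_dLogZ (s : Ω) : PolyGrowth (fun v : ParamSpace R N => 𝒮.dLogZ v.1 s v.2) :=
  𝒮.polyGrowth_post_deriv s

lemma polyGrowth_varDeriv (s : Ω) : PolyGrowth (fun v : ParamSpace R N => 𝒮.varDeriv v.1 s v.2) :=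
  𝒮.polyGrowth_post (q := fun x (v : ParamSpace R N) => (expoDerivMeas 𝒮.c v.1.1 v.2 (𝒮.disp s x) -
    𝒮.dLogZ v.1 s v.2) ^ 2)
    (fun x => ((PolyGrowth.expoDerivMeas 𝒮.c (𝒮.disp s x)).sub (𝒮.polyGrowth_dLogZ s)).pow 2) s

lemma polyGrowth_postField (s : Ω) : PolyGrowth (fun v : ParamSpace R N => 𝒮.postField v.1 s v.2) :=
  𝒮.polyGrowth_post (q := fun x (v : ParamSpace R N) => ∑ μ, field 𝒮.c (𝒮.disp s x) v.2 μ ^ 2)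
    (fun x => PolyGrowth.sum _ fun μ _ => ((PolyGrowth.field 𝒮.c (𝒮.disp s x) μ).comp_snd).pow 2) s

lemma varDeriv_nonneg (t : ℝ × ℝ) (s : Ω) (ω : Coord R N → ℝ) : 0 ≤ 𝒮.varDeriv t s ω :=
  gibbs_nonneg 𝒮.isWeight fun _ => sq_nonneg _

lemma postField_nonneg (t : ℝ × ℝ) (s : Ω) (ω : Coord R N → ℝ) : 0 ≤ 𝒮.postField t s ω :=
  gibbs_nonneg 𝒮.isWeight fun _ => Finset.sum_nonneg fun _ _ => sq_nonneg _

lemma hasDerivAt_dLogZ (s : Ω) (ω : Coord R N → ℝ) (g h : ℝ) :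
    HasDerivAt (fun h => 𝒮.dLogZ (h, g) s ω)
      (𝒮.varDeriv (h, g) s ω - 𝒮.postField (h, g) s ω) h := by
  refine (𝒮.hasDerivAt_post_meas s ω g h).congr_deriv ?_
  unfold varDeriv postField
  congr 1
  exact (gibbs_sq_sub_eq 𝒮.isWeight).symm

lemma expect_dLogZ (h g : ℝ) :
    expect 𝒮.p (𝒮.dLogZ (R := R) (h, g)) = -h * 𝒮.measErr R (h, g) := by
  classical exact 𝒮.expect_post_expoDerivMeas h g

/-- The thermal fluctuations of the derivative of the exponent, integrated over `h`. -/
lemma integral_varDeriv_le {C : ℝ} (hC : ∀ x, 𝒮.c ^ 2 * ∑ i, 𝒮.X x i ^ 2 ≤ C) (g : ℝ) {H : ℝ}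
    (hH : 0 ≤ H) :
    ∫ h in 0..H, expect 𝒮.p (𝒮.varDeriv (R := R) (h, g)) ≤ H * (4 * C * Fintype.card R) := by
  have hv := fun s => (𝒮.polyGrowth_varDeriv (R := R) s).slice_meas g
  have hW := fun s => (𝒮.polyGrowth_postField (R := R) s).slice_meas g
  have hd : ∀ h, HasDerivAt (fun h => expect 𝒮.p (𝒮.dLogZ (R := R) (h, g)))
      (expect 𝒮.p (𝒮.varDeriv (R := R) (h, g)) - expect 𝒮.p (𝒮.postField (R := R) (h, g))) h := by
    intro h
    have := hasDerivAt_expect (p := 𝒮.p) (f := fun s v => 𝒮.dLogZ (v.1, g) s v.2)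
      (f' := fun s v => 𝒮.varDeriv (R := R) (v.1, g) s v.2 - 𝒮.postField (v.1, g) s v.2)
      (fun s => (𝒮.polyGrowth_dLogZ s).slice_meas g) (fun s => (hv s).sub (hW s))
      (fun s t ω => 𝒮.hasDerivAt_dLogZ s ω g t) h
    rwa [expect_sub (fun s => (hv s).slice_left h) (fun s => (hW s).slice_left h)] at this
  have hvc : Continuous (fun h => expect 𝒮.p (𝒮.varDeriv (R := R) (h, g))) :=
    continuous_expect (f := fun s v => 𝒮.varDeriv (v.1, g) s v.2) hv
  have hWc : Continuous (fun h => expect 𝒮.p (𝒮.postField (R := R) (h, g))) :=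
    continuous_expect (f := fun s v => 𝒮.postField (v.1, g) s v.2) hW
  have h1 := intervalIntegral.integral_eq_sub_of_hasDerivAt (a := 0) (b := H) (fun h _ => hd h)
    ((hvc.sub hWc).intervalIntegrable _ _)
  rw [intervalIntegral.integral_sub (hvc.intervalIntegrable _ _) (hWc.intervalIntegrable _ _)] at h1
  simp only [expect_dLogZ] at h1
  have h2 : ∫ h in 0..H, expect 𝒮.p (𝒮.postField (R := R) (h, g)) ≤
      ∫ _ in 0..H, 4 * C * Fintype.card R :=
    intervalIntegral.integral_mono_on hH (hWc.intervalIntegrable _ _)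
      (continuous_const.intervalIntegrable _ _) fun h _ => 𝒮.expect_post_field_sq_le hC (h, g)
  simp only [intervalIntegral.integral_const, smul_eq_mul, sub_zero] at h2
  have h3 := mul_nonneg hH (𝒮.measErr_nonneg (R := R) (H, g))
  linarith

/-- The fluctuations, due to the data, of the derivative of the log-partition function. Up to the
posterior average of `‖Φ (x - S)‖²`, the log-partition function is convex in `h`, so its derivative
is enclosed by difference quotients, which concentrate because the log-partition function does. -/
lemma expect_abs_dLogZ_sub_le {C : ℝ} (hC : ∀ x, 𝒮.c ^ 2 * ∑ i, 𝒮.X x i ^ 2 ≤ C) (h g : ℝ)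
    {δ V : ℝ} (hδ : 0 < δ)
    (hV : ∀ h' ∈ Set.Icc (h - δ) (h + δ), expect 𝒮.p (fun s (ω : Coord R N → ℝ) =>
      (𝒮.logZ (h', g) s ω - 𝒮.meanLogZ R (h', g)) ^ 2) ≤ V) :
    δ * expect 𝒮.p (fun s (ω : Coord R N → ℝ) =>
        |𝒮.dLogZ (h, g) s ω - -h * 𝒮.measErr R (h, g)|) ≤
      3 * √V + 4 * δ ^ 2 * (4 * C * Fintype.card R) +
        (𝒮.meanLogZ R (h + δ, g) - 𝒮.meanLogZ R (h, g) +
          (𝒮.meanLogZ R (h - δ, g) - 𝒮.meanLogZ R (h, g))) := by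
  set κ : ℝ := 4 * C * Fintype.card R with hκ
  set d := -h * 𝒮.measErr R (h, g) with hd
  set a := fun h => 𝒮.meanLogZ R (h, g) with ha
  have hF : ∀ h s, PolyGrowth (𝒮.logZ (R := R) (h, g) s) := fun h s =>
    (𝒮.polyGrowth_logZ s).slice_left (h, g)
  have hF' : ∀ h s, PolyGrowth (𝒮.dLogZ (R := R) (h, g) s) := fun h s =>
    (𝒮.polyGrowth_dLogZ s).slice_left (h, g)
  have hW := fun s => (𝒮.polyGrowth_postField (R := R) s).slice_meas g
  let I : ℝ → ℝ → Ω → (Coord R N → ℝ) → ℝ := fun a b s ω => ∫ τ in a..b, 𝒮.postField (τ, g) s ω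
  have hI : ∀ a b s, PolyGrowth (I a b s) := fun a b s => (hW s).intervalIntegral a b
  have hWc : Continuous (fun h => expect 𝒮.p (𝒮.postField (R := R) (h, g))) :=
    continuous_expect (f := fun s v => 𝒮.postField (v.1, g) s v.2) hW
  have hWc' : ∀ s (ω : Coord R N → ℝ), Continuous (fun τ => 𝒮.postField (τ, g) s ω) := fun s ω =>
    ((hW s).slice_right ω).1
  have hI0 : ∀ a b s ω, a ≤ b → 0 ≤ I a b s ω := fun a b s ω hab =>
    intervalIntegral.integral_nonneg hab fun τ _ => 𝒮.postField_nonneg _ _ _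
  have hIe : ∀ a b, a ≤ b → expect 𝒮.p (I a b) ≤ (b - a) * κ := by
    intro a b hab
    have e : expect 𝒮.p (I a b) = ∫ τ in a..b, expect 𝒮.p (𝒮.postField (R := R) (τ, g)) := by
      unfold expect
      rw [intervalIntegral.integral_finsetSum fun s _ =>
        (((hW s).continuous_integral _).const_mul _).intervalIntegrable _ _]
      refine Finset.sum_congr rfl fun s _ => ?_
      rw [intervalIntegral.integral_const_mul]
      congr 1
      exact (hW s).integral_intervalIntegral (stdGauss (Coord R N)) hab
    rw [e]
    have := intervalIntegral.integral_mono_on hab (hWc.intervalIntegrable a b)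
      (continuous_const.intervalIntegrable (μ := volume) a b) fun h _ =>
        𝒮.expect_post_field_sq_le hC (h, g)
    refine this.trans (le_of_eq ?_)
    rw [intervalIntegral.integral_const, smul_eq_mul]
  have hG : ∀ h', h' ∈ Set.Icc (h - δ) (h + δ) → expect 𝒮.p (fun s (ω : Coord R N → ℝ) =>
      |𝒮.logZ (h', g) s ω - a h'|) ≤ √V := fun h' hh =>
    (expect_abs_le_sqrt 𝒮.isWeight fun s => (hF h' s).sub (.const _)).trans
      (Real.sqrt_le_sqrt (hV h' hh))
  -- difference quotients on either side of `h`
  have hu : ∀ s (ω : Coord R N → ℝ), δ * 𝒮.dLogZ (h, g) s ω ≤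
      𝒮.logZ (h + δ, g) s ω - 𝒮.logZ (h, g) s ω + δ * I h (h + δ) s ω := fun s ω =>
    mul_deriv_le_secant (fun τ => 𝒮.hasDerivAt_logZ_meas s ω g τ)
      (fun τ => 𝒮.hasDerivAt_dLogZ s ω g τ) (fun τ => 𝒮.varDeriv_nonneg _ _ _)
      (fun τ => 𝒮.postField_nonneg _ _ _) (hWc' s ω) h hδ.le
  have hl : ∀ s (ω : Coord R N → ℝ), -(δ * 𝒮.dLogZ (h, g) s ω) ≤
      𝒮.logZ (h - δ, g) s ω - 𝒮.logZ (h, g) s ω + δ * I (h - δ) h s ω := fun s ω =>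
    neg_mul_deriv_le_secant (fun τ => 𝒮.hasDerivAt_logZ_meas s ω g τ)
      (fun τ => 𝒮.hasDerivAt_dLogZ s ω g τ) (fun τ => 𝒮.varDeriv_nonneg _ _ _)
      (fun τ => 𝒮.postField_nonneg _ _ _) (hWc' s ω) h hδ.le
  have ed : expect 𝒮.p (fun s (ω : Coord R N → ℝ) => 𝒮.dLogZ (h, g) s ω) = d := 𝒮.expect_dLogZ h g
  have ea : ∀ h, expect 𝒮.p (fun s (ω : Coord R N → ℝ) => 𝒮.logZ (h, g) s ω) = a h := fun h => rfl
  have hJ1 := hIe h (h + δ) (by linarith)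
  have hJ2 := hIe (h - δ) h (by linarith)
  rw [add_sub_cancel_left] at hJ1
  rw [sub_sub_cancel] at hJ2
  have hU : δ * d ≤ a (h + δ) - a h + δ * (δ * κ) := by
    have := expect_mono 𝒮.isWeight (fun s => (hF' h s).const_mul δ)
      (fun s => ((hF (h + δ) s).sub (hF h s)).add ((hI h (h + δ) s).const_mul δ)) hu
    rw [expect_const_mul, expect_add (fun s => (hF (h + δ) s).sub (hF h s))
      (fun s => (hI h (h + δ) s).const_mul δ), expect_sub (hF (h + δ)) (hF h), expect_const_mul,
      ed, ea, ea] at this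
    linarith [mul_le_mul_of_nonneg_left hJ1 hδ.le]
  have hLo : -(δ * d) ≤ a (h - δ) - a h + δ * (δ * κ) := by
    have := expect_mono 𝒮.isWeight (fun s => ((hF' h s).const_mul δ).neg)
      (fun s => ((hF (h - δ) s).sub (hF h s)).add ((hI (h - δ) h s).const_mul δ)) hl
    have en := expect_const_mul (p := 𝒮.p)
      (f := fun s (ω : Coord R N → ℝ) => 𝒮.dLogZ (h, g) s ω) (-δ)
    simp only [neg_mul] at en
    rw [en, expect_add (fun s => (hF (h - δ) s).sub (hF h s))
      (fun s => (hI (h - δ) h s).const_mul δ), expect_sub (hF (h - δ)) (hF h), expect_const_mul,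
      ed, ea, ea] at this
    linarith [mul_le_mul_of_nonneg_left hJ2 hδ.le]
  have hκ0 : 0 ≤ δ * (δ * κ) := mul_nonneg hδ.le
    ((expect_nonneg 𝒮.isWeight fun s ω => hI0 h (h + δ) s ω (by linarith)).trans hJ1)
  have hA : ∀ h s, PolyGrowth (fun ω : Coord R N → ℝ => |𝒮.logZ (h, g) s ω - a h|) := fun h s =>
    ((hF h s).sub (.const _)).abs
  have key := expect_mono (p := 𝒮.p) (f := fun s (ω : Coord R N → ℝ) =>
      δ * |𝒮.dLogZ (h, g) s ω - d|) (g := fun s ω => ((|𝒮.logZ (h + δ, g) s ω - a (h + δ)| +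
        |𝒮.logZ (h, g) s ω - a h|) + |𝒮.logZ (h - δ, g) s ω - a (h - δ)|) +
        (δ * I h (h + δ) s ω + δ * I (h - δ) h s ω) +
        ((a (h + δ) - a h) + (a (h - δ) - a h) + 2 * (δ * (δ * κ)))) 𝒮.isWeight
    (fun s => (((hF' h s).sub (.const _)).abs).const_mul δ)
    (fun s => ((((hA _ s).add (hA _ s)).add (hA _ s)).add (((hI _ _ s).const_mul δ).add
      ((hI _ _ s).const_mul δ))).add (.const _)) (fun s ω => by
      have k1 := hu s ω
      have k2 := hl s ω
      have k3 := mul_nonneg hδ.le (hI0 h (h + δ) s ω (by linarith))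
      have k4 := mul_nonneg hδ.le (hI0 (h - δ) h s ω (by linarith))
      have k5 := abs_nonneg (𝒮.logZ (h + δ, g) s ω - a (h + δ))
      have k6 := abs_nonneg (𝒮.logZ (h - δ, g) s ω - a (h - δ))
      have k7 := le_abs_self (𝒮.logZ (h + δ, g) s ω - a (h + δ))
      have k8 := le_abs_self (𝒮.logZ (h - δ, g) s ω - a (h - δ))
      have k9 := neg_abs_le (𝒮.logZ (h, g) s ω - a h)
      rw [← abs_of_pos hδ, ← abs_mul, abs_of_pos hδ, abs_le]
      constructor <;> linarith)
  rw [expect_const_mul, expect_add (fun s => ((((hA _ s).add (hA _ s)).add (hA _ s)).add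
      (((hI _ _ s).const_mul δ).add ((hI _ _ s).const_mul δ)))) (fun s => .const _),
    expect_add (fun s => ((hA _ s).add (hA _ s)).add (hA _ s))
      (fun s => ((hI _ _ s).const_mul δ).add ((hI _ _ s).const_mul δ)),
    expect_add (fun s => (hA _ s).add (hA _ s)) (hA _), expect_add (hA _) (hA _),
    expect_add (fun s => (hI _ _ s).const_mul δ) (fun s => (hI _ _ s).const_mul δ),
    expect_const_mul, expect_const_mul, expect_const 𝒮.isWeight] at key
  have g1 := hG (h + δ) ⟨by linarith, le_rfl⟩
  have g2 := hG h ⟨by linarith, by linarith⟩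
  have g3 := hG (h - δ) ⟨le_rfl, by linarith⟩
  have j1 := mul_le_mul_of_nonneg_left hJ1 hδ.le
  have j2 := mul_le_mul_of_nonneg_left hJ2 hδ.le
  change _ ≤ 3 * √V + 4 * δ ^ 2 * κ + ((a (h + δ) - a h) + (a (h - δ) - a h))
  simp only [I] at j1 j2 key
  linarith

end Signal

namespace Signal

variable {Ω R N : Type*} [Fintype Ω] [Fintype R] [Fintype N] (𝒮 : Signal Ω N)

variable (R) in
/-- The mean absolute deviation of the noise correlation from its mean `M - h² y`, where `y` is the
mean square error on `Φ S`. -/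
def corrFluct (t : ℝ × ℝ) : ℝ := expect 𝒮.p fun s (ω : Coord R N → ℝ) =>
  𝒮.post t s ω fun x => |𝒮.noiseCorr t.1 s ω x - (Fintype.card R + t.1 * (-t.1 * 𝒮.measErr R t))|

lemma polyGrowth_noiseCorr_param (s x : Ω) :
    PolyGrowth (fun v : ParamSpace R N => 𝒮.noiseCorr v.1.1 s v.2 x) := by
  unfold noiseCorr
  exact PolyGrowth.sum _ fun μ _ => (PolyGrowth.coord _).mul ((PolyGrowth.coord _).sub
      (PolyGrowth.param_fst.mul (PolyGrowth.field _ _ μ).comp_snd))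

lemma polyGrowth_expo_meas (s x : Ω) (g : ℝ) :
    PolyGrowth (fun v : ParamSpace R N => expo 𝒮.c (v.1.1, g) v.2 (𝒮.disp s x)) :=
  (PolyGrowth.expo 𝒮.c (𝒮.disp s x)).comp_prod (a := fun v : ParamSpace R N => (v.1.1, g))
    (by fun_prop) continuous_snd (.of_le (by fun_prop) (PolyGrowth.param_fst.abs.add (.const ‖g‖))
      fun v => by rw [abs_norm]; exact max_le_add_of_nonneg (norm_nonneg _) (norm_nonneg _))
    PolyGrowth.norm_comp_snd

lemma continuous_corrFluct (g : ℝ) : Continuous (fun h => 𝒮.corrFluct R (h, g)) := by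
  -- the centring need not have polynomial growth in `h`: it is treated as an extra variable
  have h1 : ∀ s x, PolyGrowth (fun v : ParamSpace R N =>
      |𝒮.noiseCorr v.1.1 s v.2 x - v.1.2|) := fun s x =>
    ((𝒮.polyGrowth_noiseCorr_param s x).sub PolyGrowth.param_snd).abs
  have h2 : ∀ s, PolyGrowth (fun v : ParamSpace R N =>
      𝒮.post (v.1.1, g) s v.2 fun x => |𝒮.noiseCorr v.1.1 s v.2 x - v.1.2|) := by
    intro s
    unfold post
    exact PolyGrowth.gibbs 𝒮.isWeight (fun x => 𝒮.polyGrowth_expo_meas s x g) (h1 s)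
  have h3 : Continuous (fun t : ℝ × ℝ => expect 𝒮.p fun s (ω : Coord R N → ℝ) =>
      𝒮.post (t.1, g) s ω fun x => |𝒮.noiseCorr t.1 s ω x - t.2|) :=
    continuous_expect (f := fun s (v : ParamSpace R N) =>
      𝒮.post (v.1.1, g) s v.2 fun x => |𝒮.noiseCorr v.1.1 s v.2 x - v.1.2|) h2
  have h4 : Continuous (fun h : ℝ =>
      ((h, Fintype.card R + h * (-h * 𝒮.measErr R (h, g))) : ℝ × ℝ)) := by
    have hm : Continuous (fun h : ℝ => 𝒮.measErr R (h, g)) :=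
      𝒮.continuous_measErr.comp (by fun_prop)
    exact continuous_id.prodMk (continuous_const.add (continuous_id.mul (continuous_neg.mul hm)))
  have e : (fun h => 𝒮.corrFluct R (h, g)) = (fun t : ℝ × ℝ => expect 𝒮.p
      fun s (ω : Coord R N → ℝ) => 𝒮.post (t.1, g) s ω fun x => |𝒮.noiseCorr t.1 s ω x - t.2|) ∘
      fun h : ℝ => ((h, Fintype.card R + h * (-h * 𝒮.measErr R (h, g))) : ℝ × ℝ) := by
    funext h
    simp only [corrFluct, Function.comp_apply]
  rw [e]
  exact h3.comp h4

lemma corrFluct_nonneg (t : ℝ × ℝ) : 0 ≤ 𝒮.corrFluct R t :=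
  expect_nonneg 𝒮.isWeight fun _ _ => gibbs_nonneg 𝒮.isWeight fun _ => abs_nonneg _

/-- The noise correlation is the residual plus `h` times the derivative of the exponent; the
deviation of the latter splits into a thermal part, bounded by its variance, and a disorder part. -/
lemma corrFluct_le {h : ℝ} (hh : 0 ≤ h) (g : ℝ) {η : ℝ} (hη : 0 < η) :
    𝒮.corrFluct R (h, g) ≤ 2 * √(Fintype.card R) +
      h * (expect 𝒮.p (𝒮.varDeriv (R := R) (h, g)) / (2 * η) + η / 2) +
      h * expect 𝒮.p (fun s (ω : Coord R N → ℝ) =>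
        |𝒮.dLogZ (h, g) s ω - -h * 𝒮.measErr R (h, g)|) := by
  set d := -h * 𝒮.measErr R (h, g) with hd
  have hres : ∀ s x, PolyGrowth (fun ω : Coord R N → ℝ => |𝒮.residual h s ω x - Fintype.card R|) :=
    fun s x => ((𝒮.polyGrowth_residual h s x).sub (.const _)).abs
  have hres' := fun s => 𝒮.polyGrowth_post_slice (h, g) (hres s) s
  have hvar : ∀ s, PolyGrowth (𝒮.varDeriv (R := R) (h, g) s) := fun s =>
    (𝒮.polyGrowth_varDeriv s).slice_left (h, g)
  have hdl : ∀ s, PolyGrowth (fun ω : Coord R N → ℝ => |𝒮.dLogZ (h, g) s ω - d|) := fun s =>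
    (((𝒮.polyGrowth_dLogZ s).slice_left (h, g)).sub (.const d)).abs
  have hmain : 𝒮.corrFluct R (h, g) ≤ expect 𝒮.p (fun s (ω : Coord R N → ℝ) =>
      ((𝒮.post (h, g) s ω fun x => |𝒮.residual h s ω x - Fintype.card R|) +
        (h / (2 * η) * 𝒮.varDeriv (h, g) s ω + h * (η / 2))) + h * |𝒮.dLogZ (h, g) s ω - d|) := by
    refine expect_mono 𝒮.isWeight (fun s => 𝒮.polyGrowth_post_slice (h, g)
      (fun x => ((𝒮.polyGrowth_noiseCorr h s x).sub (.const _)).abs) s)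
      (fun s => ((hres' s).add (((hvar s).const_mul _).add (.const _))).add ((hdl s).const_mul _))
      fun s ω => ?_
    change gibbs _ _ _ ≤ gibbs _ _ _ + (h / (2 * η) * gibbs _ _ _ + h * (η / 2)) +
      h * |𝒮.dLogZ (h, g) s ω - d|
    rw [← gibbs_const_mul, ← gibbs_const (e := fun x => expo 𝒮.c (h, g) ω (𝒮.disp s x))
      𝒮.isWeight (h * (η / 2)), ← gibbs_const (e := fun x => expo 𝒮.c (h, g) ω (𝒮.disp s x))
      𝒮.isWeight (h * |𝒮.dLogZ (h, g) s ω - d|), ← gibbs_add, ← gibbs_add, ← gibbs_add]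
    refine gibbs_mono 𝒮.isWeight fun x => ?_
    simp only
    set D := expoDerivMeas 𝒮.c h ω (𝒮.disp s x)
    set d₁ := 𝒮.dLogZ (h, g) s ω
    rw [noiseCorr_eq]
    have h1 : 𝒮.residual h s ω x + h * D - (Fintype.card R + h * d) =
        (𝒮.residual h s ω x - Fintype.card R) + h * (D - d₁) + h * (d₁ - d) := by ring
    have h2 : |D - d₁| ≤ (D - d₁) ^ 2 / (2 * η) + η / 2 := by
      rw [← sq_abs (D - d₁), ← sub_nonneg]
      have : |D - d₁| ^ 2 / (2 * η) + η / 2 - |D - d₁| = (|D - d₁| - η) ^ 2 / (2 * η) := by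
        field_simp; ring
      rw [this]; positivity
    rw [h1]
    refine (abs_add_three _ _ _).trans ?_
    rw [abs_mul, abs_mul, abs_of_nonneg hh]
    have h3 := mul_le_mul_of_nonneg_left h2 hh
    have h4 : h * ((D - d₁) ^ 2 / (2 * η) + η / 2) = h / (2 * η) * (D - d₁) ^ 2 + h * (η / 2) := by
      ring
    linarith
  refine hmain.trans (le_of_eq_of_le ?_ (add_le_add_left (add_le_add_left
    𝒮.expect_abs_noise_sq_sub_le _) _))
  rw [expect_add (fun s => (hres' s).add (((hvar s).const_mul _).add (.const _)))
    (fun s => (hdl s).const_mul _),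
    expect_add hres' (fun s => ((hvar s).const_mul _).add (.const _)),
    expect_add (fun s => (hvar s).const_mul _) (fun s => .const _), expect_const 𝒮.isWeight,
    expect_const_mul, expect_const_mul]
  have e := 𝒮.expect_post_residual (R := R) (h, g) (Fintype.card R)
  have e2 : expect 𝒮.p (fun s (ω : Coord R N → ℝ) => 𝒮.varDeriv (h, g) s ω) =
    expect 𝒮.p (𝒮.varDeriv (R := R) (h, g)) := rfl
  simp only at e
  rw [e, e2]
  ring

/-- Concentration of the noise correlation, on average over `h`. -/
lemma integral_corrFluct_le {C : ℝ} (hC : ∀ x, 𝒮.c ^ 2 * ∑ i, 𝒮.X x i ^ 2 ≤ C) (g : ℝ)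
    {H δ η V : ℝ} (hH : 0 ≤ H) (hδ : 0 < δ) (hδ1 : δ ≤ 1) (hη : 0 < η)
    (hV : ∀ h, |h| ≤ H + 1 → expect 𝒮.p (fun s (ω : Coord R N → ℝ) =>
      (𝒮.logZ (h, g) s ω - 𝒮.meanLogZ R (h, g)) ^ 2) ≤ V) :
    ∫ h in 0..H, 𝒮.corrFluct R (h, g) ≤
      H * (2 * √(Fintype.card R) + H * (4 * C * Fintype.card R) / (2 * η) + H * η / 2 +
        3 * H * √V / δ + 4 * H * δ * (4 * C * Fintype.card R) +
        2 * δ * ((H + 1) * (4 * C * Fintype.card R))) := by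
  classical
  set κ : ℝ := 4 * C * Fintype.card R with hκ
  set a := fun h => 𝒮.meanLogZ R (h, g) with ha
  have hac : Continuous a := by
    have := 𝒮.continuous_meanLogZ (R := R)
    exact this.comp (by fun_prop)
  have hvc : Continuous (fun h => expect 𝒮.p (𝒮.varDeriv (R := R) (h, g))) :=
    continuous_expect (f := fun s v => 𝒮.varDeriv (v.1, g) s v.2)
      fun s => (𝒮.polyGrowth_varDeriv (R := R) s).slice_meas g
  have hpt : ∀ h ∈ Set.Icc 0 H, 𝒮.corrFluct R (h, g) ≤ (2 * √(Fintype.card R) + H * η / 2 +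
      3 * H * √V / δ + 4 * H * δ * κ) + H / (2 * η) * expect 𝒮.p (𝒮.varDeriv (R := R) (h, g)) +
      H / δ * (a (h + δ) - a h + (a (h - δ) - a h)) := by
    intro h hh
    have h1 := 𝒮.corrFluct_le (R := R) hh.1 g hη
    have h2 := 𝒮.expect_abs_dLogZ_sub_le (R := R) hC h g hδ (V := V) fun h' hh' => hV h' (by
      rw [abs_le]; constructor <;> linarith [hh'.1, hh'.2, hh.1, hh.2])
    have hn : 0 ≤ expect 𝒮.p (𝒮.varDeriv (R := R) (h, g)) :=
      expect_nonneg 𝒮.isWeight fun s ω => 𝒮.varDeriv_nonneg _ _ _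
    have hn2 : 0 ≤ expect 𝒮.p (fun s (ω : Coord R N → ℝ) =>
        |𝒮.dLogZ (h, g) s ω - -h * 𝒮.measErr R (h, g)|) :=
      expect_nonneg 𝒮.isWeight fun s ω => abs_nonneg _
    have h3 : h * (expect 𝒮.p (𝒮.varDeriv (R := R) (h, g)) / (2 * η) + η / 2) ≤
        H * (expect 𝒮.p (𝒮.varDeriv (R := R) (h, g)) / (2 * η) + η / 2) :=
      mul_le_mul_of_nonneg_right hh.2 (by positivity)
    have h4 := mul_le_mul_of_nonneg_right hh.2 hn2
    have h5 := (le_div_iff₀' hδ).2 h2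
    have h6 := mul_le_mul_of_nonneg_left h5 hH
    have e1 : H * ((3 * √V + 4 * δ ^ 2 * κ + (a (h + δ) - a h + (a (h - δ) - a h))) / δ) =
        3 * H * √V / δ + 4 * H * δ * κ + H / δ * (a (h + δ) - a h + (a (h - δ) - a h)) := by
      field_simp
    have e2 : H * (expect 𝒮.p (𝒮.varDeriv (R := R) (h, g)) / (2 * η) + η / 2) =
        H / (2 * η) * expect 𝒮.p (𝒮.varDeriv (R := R) (h, g)) + H * η / 2 := by ring
    linarith
  have hc1 : Continuous (fun h => H / (2 * η) * expect 𝒮.p (𝒮.varDeriv (R := R) (h, g))) := by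
    fun_prop
  have hc2 : Continuous (fun h => H / δ * (a (h + δ) - a h + (a (h - δ) - a h))) := by fun_prop
  have hi := intervalIntegral.integral_mono_on (μ := volume) hH
    ((𝒮.continuous_corrFluct (R := R) g).intervalIntegrable _ _)
    (((continuous_const.add hc1).add hc2).intervalIntegrable _ _) hpt
  have e : ∫ h in 0..H, ((2 * √(Fintype.card R) + H * η / 2 +
      3 * H * √V / δ + 4 * H * δ * κ) + H / (2 * η) * expect 𝒮.p (𝒮.varDeriv (R := R) (h, g)) +
      H / δ * (a (h + δ) - a h + (a (h - δ) - a h))) = H * (2 * √(Fintype.card R) + H * η / 2 +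
      3 * H * √V / δ + 4 * H * δ * κ) +
      H / (2 * η) * (∫ h in 0..H, expect 𝒮.p (𝒮.varDeriv (R := R) (h, g))) +
      H / δ * ∫ h in 0..H, (a (h + δ) - a h + (a (h - δ) - a h)) := by
    have hc3 : Continuous (fun h => (2 * √(Fintype.card R) + H * η / 2 +
      3 * H * √V / δ + 4 * H * δ * κ) + H / (2 * η) * expect 𝒮.p (𝒮.varDeriv (R := R) (h, g))) :=
      continuous_const.add hc1
    rw [intervalIntegral.integral_add (hc3.intervalIntegrable _ _)
      (hc2.intervalIntegrable _ _), intervalIntegral.integral_add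
      (continuous_const.intervalIntegrable _ _) (hc1.intervalIntegrable _ _),
      intervalIntegral.integral_const_mul, intervalIntegral.integral_const_mul,
      intervalIntegral.integral_const, smul_eq_mul, sub_zero]
  replace hi := hi.trans_eq e
  have h1 := 𝒮.integral_varDeriv_le (R := R) hC g hH
  have h2 := integral_second_difference_le (a := a) (a' := fun h => -h * 𝒮.measErr R (h, g))
    (fun h => 𝒮.hasDerivAt_meanLogZ_meas h g) hH hδ.le hδ1 (A := (H + 1) * κ) fun h hh => by
      rw [abs_mul, abs_neg, abs_of_nonneg (𝒮.measErr_nonneg (h, g))]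
      exact mul_le_mul hh (𝒮.measErr_le hC (h, g)) (𝒮.measErr_nonneg _) (by linarith)
  have h3 := mul_le_mul_of_nonneg_left h1 (show 0 ≤ H / (2 * η) by positivity)
  have h4 := mul_le_mul_of_nonneg_left h2 (show 0 ≤ H / δ by positivity)
  have e3 : H / δ * (2 * δ ^ 2 * ((H + 1) * κ)) = H * (2 * δ * ((H + 1) * κ)) := by
    field_simp
  have e4 : H / (2 * η) * (H * κ) = H * (H * κ / (2 * η)) := by ring
  rw [e3] at h4
  rw [e4] at h3
  linarith

end Signal

/-! ### Uniqueness for the limiting partial differential equation -/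

/-- A monotone weight `β` and a nonnegative function `m` satisfy `∫ β m' ≤ β(G) m(G)`; this is
integration by parts against the positive measure `dβ`, done on a subdivision. -/
lemma integral_monotone_mul_deriv_le {β m m' : ℝ → ℝ} {G : ℝ} (hG : 0 ≤ G)
    (hβ : MonotoneOn β (Set.Icc 0 G)) (hβ0 : 0 ≤ β 0) (hβc : Continuous β)
    (hm : ∀ x, HasDerivAt m (m' x) x) (hm' : Continuous m') (hm0 : ∀ x, 0 ≤ m x) :
    ∫ x in 0..G, β x * m' x ≤ β G * m G := by
  obtain ⟨A, hA⟩ := isCompact_Icc.exists_bound_of_continuousOn (hm'.continuousOn (s := Set.Icc 0 G))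
  have hA0 : 0 ≤ A := (norm_nonneg _).trans (hA 0 (Set.left_mem_Icc.2 hG))
  have hi : ∀ a b, IntervalIntegrable (fun x => β x * m' x) volume a b := fun a b =>
    (hβc.mul hm').intervalIntegrable a b
  -- one cell of the subdivision
  have hcell : ∀ x y, 0 ≤ x → x ≤ y → y ≤ G →
      ∫ u in x..y, β u * m' u ≤ β y * m y - β x * m x + A * (y - x) * (β y - β x) := by
    intro x y hx hxy hy
    have h1 : ∫ u in x..y, β u * m' u = β x * (m y - m x) + ∫ u in x..y, (β u - β x) * m' u := by
      have e : m y - m x = ∫ u in x..y, m' u :=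
        (intervalIntegral.integral_eq_sub_of_hasDerivAt (fun u _ => hm u)
          (hm'.intervalIntegrable _ _)).symm
      rw [e, ← intervalIntegral.integral_const_mul, ← intervalIntegral.integral_add
        (f := fun u => β x * m' u) (g := fun u => (β u - β x) * m' u)
        ((continuous_const.mul hm').intervalIntegrable _ _)
        (((hβc.sub continuous_const).mul hm').intervalIntegrable _ _)]
      congr 1; ext u; ring
    have h2 : ∫ u in x..y, (β u - β x) * m' u ≤ ∫ _ in x..y, (β y - β x) * A := by
      refine intervalIntegral.integral_mono_on hxy
        (((hβc.sub continuous_const).mul hm').intervalIntegrable _ _)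
        (continuous_const.intervalIntegrable _ _) fun u hu => ?_
      have hu' : u ∈ Set.Icc 0 G := ⟨hx.trans hu.1, hu.2.trans hy⟩
      have b1 := hβ ⟨hx, hxy.trans hy⟩ hu' hu.1
      have b2 := hβ hu' ⟨hx.trans hxy, hy⟩ hu.2
      have b3 := (le_abs_self _).trans (hA u hu')
      calc (β u - β x) * m' u ≤ (β u - β x) * A :=
            mul_le_mul_of_nonneg_left b3 (by linarith)
        _ ≤ (β y - β x) * A := mul_le_mul_of_nonneg_right (by linarith) hA0
    rw [intervalIntegral.integral_const, smul_eq_mul] at h2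
    have h3 := hβ ⟨hx, hxy.trans hy⟩ ⟨hx.trans hxy, hy⟩ hxy
    rw [h1]
    nlinarith [mul_nonneg (sub_nonneg.2 h3) (hm0 y)]
  have hn : ∀ n : ℕ, 0 < n → ∫ x in 0..G, β x * m' x ≤ β G * m G + A * (G / n) * (β G - β 0) := by
    intro n hn
    have hn' : (0 : ℝ) < n := by exact_mod_cast hn
    have key : ∀ k : ℕ, k ≤ n → ∫ x in 0..(k * (G / n)), β x * m' x ≤
        β (k * (G / n)) * m (k * (G / n)) + A * (G / n) * (β (k * (G / n)) - β 0) := by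
      intro k
      induction k with
      | zero => intro _; simpa using mul_nonneg hβ0 (hm0 0)
      | succ k ih =>
        intro hk
        have h1 := ih (by omega)
        have hk' : ((k + 1 : ℕ) : ℝ) ≤ n := by exact_mod_cast hk
        have hGn : 0 ≤ G / n := by positivity
        have h2 := hcell (k * (G / n)) ((k + 1 : ℕ) * (G / n)) (by positivity)
          (by push_cast; nlinarith) (by
            calc ((k + 1 : ℕ) : ℝ) * (G / n) ≤ n * (G / n) :=
                  mul_le_mul_of_nonneg_right hk' hGn
              _ = G := by field_simp)
        rw [← intervalIntegral.integral_add_adjacent_intervals (hi 0 (k * (G / n))) (hi _ _)]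
        have e : ((k + 1 : ℕ) : ℝ) * (G / n) - k * (G / n) = G / n := by push_cast; ring
        rw [e] at h2
        nlinarith
    have := key n le_rfl
    rwa [mul_div_cancel₀ _ hn'.ne'] at this
  have hlim : Tendsto (fun n : ℕ => β G * m G + A * (G / n) * (β G - β 0)) atTop
      (𝓝 (β G * m G + A * 0 * (β G - β 0))) :=
    tendsto_const_nhds.add (((tendsto_const_div_atTop_nhds_zero_nat G).const_mul A).mul_const _)
  have := ge_of_tendsto hlim ((eventually_gt_atTop 0).mono hn)
  simpa using this

/-- Regularity of a function `f (h, g)` with `∂f/∂h = q` and `∂f/∂g = g e`, where `e` plays the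
role of a mean square error. -/
structure IsPotential (C : ℝ) (f e q : ℝ × ℝ → ℝ) : Prop where
  deriv_meas : ∀ h g, HasDerivAt (fun h => f (h, g)) (q (h, g)) h
  deriv_side : ∀ h g, HasDerivAt (fun g => f (h, g)) (g * e (h, g)) g
  continuous_f : Continuous f
  continuous_e : Continuous e
  continuous_q : Continuous q
  nonneg : ∀ t, 0 ≤ e t
  le : ∀ t, e t ≤ C
  antitone_side : ∀ h, AntitoneOn (fun g => e (h, g)) (Set.Ici 0)

/-- The defect in the partial differential equation `∂f/∂h = h a e / (1 + h² e)`. -/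
def defect (a : ℝ) (e q : ℝ × ℝ → ℝ) (t : ℝ × ℝ) : ℝ :=
  q t - t.1 * a * (e t / (1 + t.1 ^ 2 * e t))

section Uniqueness

variable {C a : ℝ} {f₁ e₁ q₁ f₂ e₂ q₂ : ℝ × ℝ → ℝ}

lemma IsPotential.one_add_pos (h₁ : IsPotential C f₁ e₁ q₁) (t : ℝ × ℝ) :
    1 ≤ 1 + t.1 ^ 2 * e₁ t := by
  have := mul_nonneg (sq_nonneg t.1) (h₁.nonneg t)
  linarith

lemma IsPotential.continuous_defect (h₁ : IsPotential C f₁ e₁ q₁) :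
    Continuous (defect a e₁ q₁) := by
  have := h₁.continuous_e
  have := h₁.continuous_q
  unfold defect
  refine Continuous.sub (by fun_prop) (Continuous.mul (by fun_prop) (Continuous.div (by fun_prop)
    (by fun_prop) fun t => ?_))
  have := h₁.one_add_pos t
  positivity

/-- A quadratic energy estimate. The energy is weighted by `g e^{-g²}` so that it can be
integrated by parts in `g`, and the sign of the resulting term follows from the monotonicity of
the errors in `g`. -/
lemma energy_le (h₁ : IsPotential C f₁ e₁ q₁) (h₂ : IsPotential C f₂ e₂ q₂) (ha : 0 ≤ a)
    (h0 : ∀ g, f₁ (0, g) = f₂ (0, g)) {H G W ε : ℝ} (hH : 0 ≤ H) (hG : 0 ≤ G) (hW : 0 ≤ W)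
    (hfW : ∀ h ∈ Set.Icc 0 H, ∀ g ∈ Set.Icc 0 G, |f₁ (h, g) - f₂ (h, g)| ≤ W)
    (hr₁ : ∀ g ∈ Set.Icc 0 G, ∫ h in 0..H, |defect a e₁ q₁ (h, g)| ≤ ε)
    (hr₂ : ∀ g ∈ Set.Icc 0 G, ∫ h in 0..H, |defect a e₂ q₂ (h, g)| ≤ ε) :
    Real.exp (-(a * H ^ 2)) *
        ∫ g in 0..G, g * Real.exp (-g ^ 2) * (f₁ (H, g) - f₂ (H, g)) ^ 2 ≤
      a * H ^ 2 * Real.exp (-G ^ 2) * W ^ 2 + 4 * W * ε * G ^ 2 := by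
  have hf₁ := h₁.continuous_f
  have hf₂ := h₂.continuous_f
  have hq₁ := h₁.continuous_q
  have hq₂ := h₂.continuous_q
  have he₁ := h₁.continuous_e
  have he₂ := h₂.continuous_e
  have hd₁ : Continuous (defect a e₁ q₁) := h₁.continuous_defect
  have hd₂ : Continuous (defect a e₂ q₂) := h₂.continuous_defect
  set w : ℝ × ℝ → ℝ := fun t => f₁ t - f₂ t with hw
  set r : ℝ × ℝ → ℝ := fun t => |defect a e₁ q₁ t| + |defect a e₂ q₂ t| with hr
  have hwc : Continuous w := hf₁.sub hf₂
  have hrc : Continuous r := hd₁.abs.add hd₂.abs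
  -- the integrand, as a function of `(h, g)`
  set F : ℝ → ℝ → ℝ := fun h g => Real.exp (-(a * h ^ 2)) * (g * Real.exp (-g ^ 2) *
    (2 * w (h, g) * (q₁ (h, g) - q₂ (h, g)) - 2 * a * h * w (h, g) ^ 2)) with hF
  have hFc : Continuous (Function.uncurry F) := by
    simp only [hF]; unfold Function.uncurry; fun_prop
  have hstep1 : ∀ g, Real.exp (-(a * H ^ 2)) * (g * Real.exp (-g ^ 2) * w (H, g) ^ 2) =
      ∫ h in 0..H, F h g := by
    intro g
    have hd : ∀ h ∈ Set.uIcc 0 H, HasDerivAt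
        (fun h => Real.exp (-(a * h ^ 2)) * (g * Real.exp (-g ^ 2) * w (h, g) ^ 2)) (F h g) h := by
      intro h _
      have d1 : HasDerivAt (fun h => w (h, g)) (q₁ (h, g) - q₂ (h, g)) h :=
        (h₁.deriv_meas h g).sub (h₂.deriv_meas h g)
      have d2 : HasDerivAt (fun h : ℝ => Real.exp (-(a * h ^ 2)))
          (Real.exp (-(a * h ^ 2)) * (-(a * (2 * h)))) h := by
        refine (HasDerivAt.exp (((hasDerivAt_pow 2 h).const_mul a).fun_neg)).congr_deriv ?_
        simp
      refine (d2.fun_mul ((d1.fun_pow 2).const_mul (g * Real.exp (-g ^ 2)))).congr_deriv ?_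
      simp only [hF]
      push_cast
      ring
    rw [intervalIntegral.integral_eq_sub_of_hasDerivAt hd
      ((hFc.comp (by fun_prop : Continuous fun h : ℝ => (h, g))).intervalIntegrable _ _)]
    simp [hw, h0]
  have hswap : ∀ Ψ : ℝ → ℝ → ℝ, Continuous (Function.uncurry Ψ) →
      ∫ g in 0..G, ∫ h in 0..H, Ψ h g = ∫ h in 0..H, ∫ g in 0..G, Ψ h g := by
    intro Ψ hΨ
    have hΨ' : Continuous (Function.uncurry fun g h => Ψ h g) := hΨ.comp continuous_swap
    refine intervalIntegral_intervalIntegral_swap ?_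
    exact (hΨ'.continuousOn.integrableOn_compact (isCompact_uIcc.prod isCompact_uIcc)).mono_set
      (Set.prod_mono Set.uIoc_subset_uIcc Set.uIoc_subset_uIcc)
  rw [← intervalIntegral.integral_const_mul]
  change ∫ g in 0..G, Real.exp (-(a * H ^ 2)) * (g * Real.exp (-g ^ 2) * w (H, g) ^ 2) ≤ _
  simp only [hstep1]
  rw [hswap F hFc]
  set R : ℝ → ℝ → ℝ := fun h g => g * r (h, g) with hR
  have hRc : Continuous (Function.uncurry R) := by
    simp only [hR]; unfold Function.uncurry; fun_prop
  -- the estimate for fixed `h`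
  have hinner : ∀ h ∈ Set.Icc 0 H, ∫ g in 0..G, F h g ≤
      a * H * Real.exp (-G ^ 2) * W ^ 2 + 2 * W * ∫ g in 0..G, R h g := by
    intro h hh
    set β : ℝ → ℝ := fun g => ((1 + h ^ 2 * e₁ (h, g)) * (1 + h ^ 2 * e₂ (h, g)))⁻¹ with hβ
    set m : ℝ → ℝ := fun g => Real.exp (-g ^ 2) * w (h, g) ^ 2 with hm
    set m' : ℝ → ℝ := fun g => Real.exp (-g ^ 2) * (2 * w (h, g) * (g * (e₁ (h, g) - e₂ (h, g)))
      - 2 * g * w (h, g) ^ 2) with hm'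
    have hp1 : ∀ g, 1 ≤ 1 + h ^ 2 * e₁ (h, g) := fun g => h₁.one_add_pos (h, g)
    have hp2 : ∀ g, 1 ≤ 1 + h ^ 2 * e₂ (h, g) := fun g => h₂.one_add_pos (h, g)
    have hpp : ∀ g, 1 ≤ (1 + h ^ 2 * e₁ (h, g)) * (1 + h ^ 2 * e₂ (h, g)) := fun g =>
      one_le_mul_of_one_le_of_one_le (hp1 g) (hp2 g)
    have hβ0 : ∀ g, 0 ≤ β g := fun g => inv_nonneg.2 (by linarith [hpp g])
    have hβ1 : ∀ g, β g ≤ 1 := fun g => inv_le_one_of_one_le₀ (hpp g)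
    have hβc : Continuous β := by
      refine Continuous.inv₀ (by fun_prop) fun g => ?_
      have := hpp g
      positivity
    have hβm : MonotoneOn β (Set.Icc 0 G) := by
      intro x hx y hy hxy
      have k1 := h₁.antitone_side h hx.1 hy.1 hxy
      have k2 := h₂.antitone_side h hx.1 hy.1 hxy
      have := hp1 y
      have := hp2 y
      have := hp1 x
      simp only [hβ] at k1 k2 ⊢
      gcongr
    have hmd : ∀ g, HasDerivAt m (m' g) g := by
      intro g
      have d1 : HasDerivAt (fun g => w (h, g)) (g * e₁ (h, g) - g * e₂ (h, g)) g :=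
        (h₁.deriv_side h g).sub (h₂.deriv_side h g)
      have d2 : HasDerivAt (fun g : ℝ => Real.exp (-g ^ 2)) (Real.exp (-g ^ 2) * (-(2 * g))) g := by
        refine (HasDerivAt.exp ((hasDerivAt_pow 2 g).fun_neg)).congr_deriv ?_
        simp
      refine (d2.fun_mul (d1.fun_pow 2)).congr_deriv ?_
      simp only [hm']
      push_cast
      ring
    have hm'c : Continuous m' := by simp only [hm']; fun_prop
    have hm0 : ∀ g, 0 ≤ m g := fun g => mul_nonneg (Real.exp_pos _).le (sq_nonneg _)
    have k1 := integral_monotone_mul_deriv_le hG hβm (hβ0 0) hβc hmd hm'c hm0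
    have hGm : β G * m G ≤ Real.exp (-G ^ 2) * W ^ 2 := by
      have b1 : w (h, G) ^ 2 ≤ W ^ 2 := by
        rw [← sq_abs]
        exact pow_le_pow_left₀ (abs_nonneg _) (hfW h hh G (Set.right_mem_Icc.2 hG)) 2
      calc β G * m G ≤ 1 * m G := mul_le_mul_of_nonneg_right (hβ1 G) (hm0 G)
        _ = Real.exp (-G ^ 2) * w (h, G) ^ 2 := one_mul _
        _ ≤ _ := mul_le_mul_of_nonneg_left b1 (Real.exp_pos _).le
    have hRc' : Continuous (R h) := hRc.comp (by fun_prop : Continuous fun g : ℝ => (h, g))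
    have hmono : ∫ g in 0..G, F h g ≤ ∫ g in 0..G, (Real.exp (-(a * h ^ 2)) * (a * h *
        (β g * m' g)) + 2 * W * R h g) := by
      refine intervalIntegral.integral_mono_on hG
        ((hFc.comp (by fun_prop : Continuous fun g : ℝ => (h, g))).intervalIntegrable _ _)
        ((Continuous.add (by fun_prop) (by fun_prop)).intervalIntegrable _ _) fun g hg => ?_
      have hdiff : q₁ (h, g) - q₂ (h, g) = h * a * (β g * (e₁ (h, g) - e₂ (h, g))) +
          (defect a e₁ q₁ (h, g) - defect a e₂ q₂ (h, g)) := by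
        have n1 := (zero_lt_one.trans_le (hp1 g)).ne'
        have n2 := (zero_lt_one.trans_le (hp2 g)).ne'
        simp only [defect, hβ]
        field_simp
        ring
      have hx : F h g = Real.exp (-(a * h ^ 2)) * (a * h * (β g * m' g)) +
          Real.exp (-(a * h ^ 2)) * Real.exp (-g ^ 2) * (2 * (w (h, g) *
            (defect a e₁ q₁ (h, g) - defect a e₂ q₂ (h, g))) * g) -
          Real.exp (-(a * h ^ 2)) * Real.exp (-g ^ 2) *
            (2 * a * h * g * (1 - β g) * w (h, g) ^ 2) := by
        simp only [hF, hm']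
        rw [hdiff]
        ring
      have hpos : 0 ≤ Real.exp (-(a * h ^ 2)) * Real.exp (-g ^ 2) *
            (2 * a * h * g * (1 - β g) * w (h, g) ^ 2) := by
        have b1 := hh.1
        have b2 := hg.1
        have b3 := sub_nonneg.2 (hβ1 g)
        positivity
      have hsm : Real.exp (-(a * h ^ 2)) * Real.exp (-g ^ 2) ≤ 1 := by
        rw [← Real.exp_add, Real.exp_le_one_iff]
        nlinarith [sq_nonneg g, mul_nonneg ha (sq_nonneg h)]
      have hwr : w (h, g) * (defect a e₁ q₁ (h, g) - defect a e₂ q₂ (h, g)) ≤ W * r (h, g) := by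
        refine (le_abs_self _).trans ?_
        rw [abs_mul]
        exact mul_le_mul (hfW h hh g hg) (abs_sub _ _) (abs_nonneg _) hW
      have hWr : 0 ≤ W * r (h, g) :=
        mul_nonneg hW (add_nonneg (abs_nonneg _) (abs_nonneg _))
      have hfin : Real.exp (-(a * h ^ 2)) * Real.exp (-g ^ 2) * (2 * (w (h, g) *
            (defect a e₁ q₁ (h, g) - defect a e₂ q₂ (h, g))) * g) ≤ 2 * W * R h g := by
        calc _ ≤ Real.exp (-(a * h ^ 2)) * Real.exp (-g ^ 2) * (2 * (W * r (h, g)) * g) := by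
              refine mul_le_mul_of_nonneg_left ?_ (by positivity)
              exact mul_le_mul_of_nonneg_right (by linarith) hg.1
          _ ≤ 1 * (2 * (W * r (h, g)) * g) :=
              mul_le_mul_of_nonneg_right hsm (mul_nonneg (by linarith) hg.1)
          _ = _ := by simp only [hR]; ring
      rw [hx]
      linarith
    refine hmono.trans ?_
    rw [intervalIntegral.integral_add (Continuous.intervalIntegrable (by fun_prop) _ _)
      (Continuous.intervalIntegrable (by fun_prop) _ _), intervalIntegral.integral_const_mul,
      intervalIntegral.integral_const_mul, intervalIntegral.integral_const_mul]
    have b1 : Real.exp (-(a * h ^ 2)) ≤ 1 := by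
      rw [Real.exp_le_one_iff]; nlinarith [mul_nonneg ha (sq_nonneg h)]
    have b2 : 0 ≤ Real.exp (-G ^ 2) * W ^ 2 := by positivity
    have b3 : a * h ≤ a * H := mul_le_mul_of_nonneg_left hh.2 ha
    have b4 : 0 ≤ a * h := mul_nonneg ha hh.1
    have b5 : Real.exp (-(a * h ^ 2)) * (a * h * ∫ g in 0..G, β g * m' g) ≤
        1 * (a * H * (Real.exp (-G ^ 2) * W ^ 2)) := by
      calc _ ≤ Real.exp (-(a * h ^ 2)) * (a * h * (Real.exp (-G ^ 2) * W ^ 2)) :=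
            mul_le_mul_of_nonneg_left (mul_le_mul_of_nonneg_left (k1.trans hGm) b4)
              (Real.exp_pos _).le
        _ ≤ 1 * (a * h * (Real.exp (-G ^ 2) * W ^ 2)) :=
            mul_le_mul_of_nonneg_right b1 (mul_nonneg b4 b2)
        _ ≤ _ := mul_le_mul_of_nonneg_left (mul_le_mul_of_nonneg_right b3 b2) zero_le_one
    linarith
  have hIF : Continuous (fun h => ∫ g in 0..G, F h g) :=
    intervalIntegral.continuous_parametric_intervalIntegral_of_continuous' hFc 0 G
  have hIR : Continuous (fun h => ∫ g in 0..G, R h g) :=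
    intervalIntegral.continuous_parametric_intervalIntegral_of_continuous' hRc 0 G
  obtain ⟨K, hK⟩ : ∃ K, K = a * H * Real.exp (-G ^ 2) * W ^ 2 := ⟨_, rfl⟩
  simp only [← hK] at hinner
  have hout := intervalIntegral.integral_mono_on (μ := volume) hH (hIF.intervalIntegrable 0 H)
    (Continuous.intervalIntegrable (by fun_prop) 0 H) hinner
  rw [intervalIntegral.integral_add (continuous_const.intervalIntegrable _ _)
    (Continuous.intervalIntegrable (by fun_prop) _ _), intervalIntegral.integral_const_mul,
    ← hswap R hRc, intervalIntegral.integral_const, smul_eq_mul, sub_zero] at hout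
  have hlast : ∫ g in 0..G, ∫ h in 0..H, R h g ≤ ∫ _ in 0..G, G * (2 * ε) := by
    have hRs : Continuous (fun g => ∫ h in 0..H, R h g) :=
      intervalIntegral.continuous_parametric_intervalIntegral_of_continuous'
        (f := fun g h => R h g) (hRc.comp continuous_swap) 0 H
    refine intervalIntegral.integral_mono_on hG (hRs.intervalIntegrable _ _)
      (continuous_const.intervalIntegrable _ _) fun g hg => ?_
    simp only [hR]
    rw [intervalIntegral.integral_const_mul]
    have hc : Continuous fun h : ℝ => (h, g) := by fun_prop
    have e : ∫ h in 0..H, r (h, g) = (∫ h in 0..H, |defect a e₁ q₁ (h, g)|) +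
        ∫ h in 0..H, |defect a e₂ q₂ (h, g)| :=
      intervalIntegral.integral_add ((hd₁.comp hc).abs.intervalIntegrable _ _)
        ((hd₂.comp hc).abs.intervalIntegrable _ _)
    have hn : 0 ≤ ∫ h in 0..H, r (h, g) := intervalIntegral.integral_nonneg hH fun h _ =>
      add_nonneg (abs_nonneg _) (abs_nonneg _)
    have b1 := hr₁ g hg
    have b2 := hr₂ g hg
    exact mul_le_mul hg.2 (by rw [e]; linarith) hn hG
  rw [intervalIntegral.integral_const, smul_eq_mul, sub_zero] at hlast
  have := mul_le_mul_of_nonneg_left hlast (show 0 ≤ 2 * W by linarith)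
  rw [hK] at hout
  linarith

end Uniqueness

/-- Stability: potentials that agree at `h = 0` and solve the equation up to a small defect are
close at `g = 0`. -/
lemma exists_defect_bound {C a H Q lam : ℝ} (hC : 0 ≤ C) (ha : 0 ≤ a) (hH : 0 ≤ H) (hQ : 0 ≤ Q)
    (hlam : 0 < lam) :
    ∃ ε > 0, ∃ G : ℝ, 0 ≤ G ∧ ∀ f₁ e₁ q₁ f₂ e₂ q₂ : ℝ × ℝ → ℝ, IsPotential C f₁ e₁ q₁ →
      IsPotential C f₂ e₂ q₂ → (∀ g, f₁ (0, g) = f₂ (0, g)) →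
      (∀ h ∈ Set.Icc 0 H, ∀ g, |q₁ (h, g)| ≤ Q) → (∀ h ∈ Set.Icc 0 H, ∀ g, |q₂ (h, g)| ≤ Q) →
      (∀ g ∈ Set.Icc 0 G, ∫ h in 0..H, |defect a e₁ q₁ (h, g)| ≤ ε) →
      (∀ g ∈ Set.Icc 0 G, ∫ h in 0..H, |defect a e₂ q₂ (h, g)| ≤ ε) →
      |f₁ (H, 0) - f₂ (H, 0)| ≤ lam := by
  obtain ⟨W, hWe⟩ : ∃ W, W = 2 * Q * H := ⟨_, rfl⟩
  have hW : 0 ≤ W := by rw [hWe]; positivity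
  obtain ⟨γ, hγe⟩ : ∃ γ, γ = min 1 (lam / (2 * (C + 1))) := ⟨_, rfl⟩
  have hγ0 : 0 < γ := by rw [hγe]; exact lt_min one_pos (by positivity)
  have hγ1 : γ ≤ 1 := by rw [hγe]; exact min_le_left _ _
  have hγC : C * γ ≤ lam / 2 := by
    have h1 : γ ≤ lam / (2 * (C + 1)) := by rw [hγe]; exact min_le_right _ _
    rw [le_div_iff₀ (by positivity)] at h1
    nlinarith
  -- a lower bound for the energy if the potentials differ by `lam`
  obtain ⟨τ, hτe⟩ : ∃ τ, τ = Real.exp (-(a * H ^ 2)) *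
      (Real.exp (-1) * (lam / 2) ^ 2 * (γ ^ 2 / 2)) := ⟨_, rfl⟩
  have hτ : 0 < τ := by rw [hτe]; positivity
  have hlim : Tendsto (fun G : ℝ => a * H ^ 2 * W ^ 2 * Real.exp (-G ^ 2)) atTop (𝓝 0) := by
    have h1 : Tendsto (fun G : ℝ => Real.exp (-G ^ 2)) atTop (𝓝 0) :=
      Real.tendsto_exp_neg_atTop_nhds_zero.comp (tendsto_pow_atTop two_ne_zero)
    simpa using h1.const_mul (a * H ^ 2 * W ^ 2)
  obtain ⟨G, hGτ, hG1⟩ := ((hlim.eventually_lt_const (half_pos hτ)).and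
    (eventually_ge_atTop 1)).exists
  have hG0 : 0 ≤ G := by linarith
  refine ⟨τ / 4 / (4 * W * G ^ 2 + 1), by positivity, G, hG0, ?_⟩
  intro f₁ e₁ q₁ f₂ e₂ q₂ h₁ h₂ h0 hq₁ hq₂ hr₁ hr₂
  obtain ⟨w, hw⟩ : ∃ w : ℝ × ℝ → ℝ, w = fun t => f₁ t - f₂ t := ⟨_, rfl⟩
  have hw' : ∀ t, w t = f₁ t - f₂ t := fun t => by rw [hw]
  have hwc : Continuous w := by rw [hw]; exact h₁.continuous_f.sub h₂.continuous_f
  have hfW : ∀ h ∈ Set.Icc 0 H, ∀ g ∈ Set.Icc 0 G, |f₁ (h, g) - f₂ (h, g)| ≤ W := by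
    intro h hh g _
    have := (convex_Icc 0 H).norm_image_sub_le_of_norm_hasDerivWithin_le
      (f := fun h => f₁ (h, g) - f₂ (h, g)) (f' := fun h => q₁ (h, g) - q₂ (h, g)) (C := 2 * Q)
      (fun x _ => ((h₁.deriv_meas x g).sub (h₂.deriv_meas x g)).hasDerivWithinAt)
      (fun x hx => by
        rw [Real.norm_eq_abs]
        exact (abs_sub _ _).trans (by linarith [hq₁ x hx g, hq₂ x hx g]))
      (Set.left_mem_Icc.2 hH) hh
    rw [h0, sub_self, sub_zero, sub_zero, Real.norm_eq_abs, Real.norm_eq_abs,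
      abs_of_nonneg hh.1] at this
    rw [hWe]
    exact this.trans (mul_le_mul_of_nonneg_left hh.2 (by linarith))
  have hen := energy_le h₁ h₂ ha h0 hH hG0 hW hfW hr₁ hr₂
  by_contra hcon
  rw [not_le, ← hw'] at hcon
  have hlow : ∀ g ∈ Set.Icc 0 γ, lam / 2 ≤ |w (H, g)| := by
    intro g hg
    have := (convex_Icc 0 γ).norm_image_sub_le_of_norm_hasDerivWithin_le
      (f := fun g => f₁ (H, g) - f₂ (H, g)) (f' := fun g => g * e₁ (H, g) - g * e₂ (H, g)) (C := C)
      (fun x _ => ((h₁.deriv_side H x).sub (h₂.deriv_side H x)).hasDerivWithinAt)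
      (fun x hx => by
        rw [Real.norm_eq_abs, ← mul_sub, abs_mul, abs_of_nonneg hx.1]
        have b1 : |e₁ (H, x) - e₂ (H, x)| ≤ C := by
          rw [abs_le]
          constructor <;> linarith [h₁.nonneg (H, x), h₂.nonneg (H, x), h₁.le (H, x), h₂.le (H, x)]
        exact (mul_le_mul (hx.2.trans hγ1) b1 (abs_nonneg _) zero_le_one).trans (by linarith))
      (Set.left_mem_Icc.2 hγ0.le) hg
    simp only [← hw'] at this
    rw [sub_zero, Real.norm_eq_abs, Real.norm_eq_abs, abs_of_nonneg hg.1] at this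
    have b2 : C * g ≤ C * γ := mul_le_mul_of_nonneg_left hg.2 hC
    have b3 := abs_sub_abs_le_abs_sub (w (H, 0)) (w (H, g))
    rw [abs_sub_comm] at b3
    linarith
  have hc : Continuous (fun g => g * Real.exp (-g ^ 2) * w (H, g) ^ 2) := by fun_prop
  have hI1 : ∫ g in 0..γ, g * (Real.exp (-1) * (lam / 2) ^ 2) ≤
      ∫ g in 0..γ, g * Real.exp (-g ^ 2) * w (H, g) ^ 2 := by
    refine intervalIntegral.integral_mono_on hγ0.le
      (Continuous.intervalIntegrable (by fun_prop) _ _) (hc.intervalIntegrable _ _) fun g hg => ?_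
    rw [mul_assoc]
    refine mul_le_mul_of_nonneg_left (mul_le_mul ?_ ?_ (by positivity) (Real.exp_pos _).le) hg.1
    · rw [Real.exp_le_exp]
      have := hg.1
      have := hg.2
      nlinarith
    · rw [← sq_abs (w (H, g))]
      exact pow_le_pow_left₀ (by positivity) (hlow g hg) 2
  have hI2 : ∫ g in 0..γ, g * Real.exp (-g ^ 2) * w (H, g) ^ 2 ≤
      ∫ g in 0..G, g * Real.exp (-g ^ 2) * w (H, g) ^ 2 := by
    rw [← intervalIntegral.integral_add_adjacent_intervals (hc.intervalIntegrable 0 γ)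
      (hc.intervalIntegrable γ G)]
    have : 0 ≤ ∫ g in γ..G, g * Real.exp (-g ^ 2) * w (H, g) ^ 2 :=
      intervalIntegral.integral_nonneg (by linarith) fun g hg => by
        have := hγ0.le.trans hg.1
        positivity
    linarith
  rw [intervalIntegral.integral_mul_const, integral_id] at hI1
  simp only [← hw'] at hen
  have hlo : τ ≤ Real.exp (-(a * H ^ 2)) *
      ∫ g in 0..G, g * Real.exp (-g ^ 2) * w (H, g) ^ 2 := by
    rw [hτe]
    refine mul_le_mul_of_nonneg_left (le_trans (le_of_eq ?_) (hI1.trans hI2)) (Real.exp_pos _).le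
    ring
  have hε : 4 * W * (τ / 4 / (4 * W * G ^ 2 + 1)) * G ^ 2 ≤ τ / 4 := by
    have : 4 * W * (τ / 4 / (4 * W * G ^ 2 + 1)) * G ^ 2 =
        τ / 4 * ((4 * W * G ^ 2) / (4 * W * G ^ 2 + 1)) := by ring
    rw [this]
    refine mul_le_of_le_one_right (by positivity) ?_
    rw [div_le_one (by positivity)]
    linarith
  have hG' : a * H ^ 2 * Real.exp (-G ^ 2) * W ^ 2 < τ / 2 := by linarith
  linarith

/-! ### Limits of the potentials and of the errors -/

/-- A sequence of potentials, with the same values at `h = 0`, that solve the limiting equation up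
to a vanishing defect. -/
structure IsApproxSolution (C a : ℝ) (f e q : ℕ → ℝ × ℝ → ℝ) : Prop where
  potential : ∀ᶠ L in atTop, IsPotential C (f L) (e L) (q L)
  initial : ∃ φ : ℝ → ℝ, ∀ᶠ L in atTop, ∀ g, f L (0, g) = φ g
  bound : ∀ H, 0 ≤ H → ∃ Q : ℝ, 0 ≤ Q ∧ ∀ᶠ L in atTop, ∀ h ∈ Set.Icc 0 H, ∀ g, |q L (h, g)| ≤ Q
  defect_le : ∀ H, 0 ≤ H → ∀ G, 0 ≤ G → ∀ ε > 0, ∀ᶠ L in atTop, ∀ g ∈ Set.Icc 0 G,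
    ∫ h in 0..H, |defect a (e L) (q L) (h, g)| ≤ ε
  antitone_meas : ∀ᶠ L in atTop, AntitoneOn (fun h => e L (h, 0)) (Set.Ici 0)
  nonneg : ∀ᶠ L in atTop, ∀ h, 0 ≤ h → ∀ g, 0 ≤ q L (h, g)

section Limits

variable {C a : ℝ} {f e q : ℕ → ℝ × ℝ → ℝ}

lemma IsApproxSolution.exists_tendsto (S : IsApproxSolution C a f e q) (hC : 0 ≤ C) (ha : 0 ≤ a)
    {H : ℝ} (hH : 0 ≤ H) : ∃ l, Tendsto (fun L => f L (H, 0)) atTop (𝓝 l) := by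
  refine cauchySeq_tendsto_of_complete (Metric.cauchySeq_iff'.2 fun ε hε => ?_)
  obtain ⟨φ, hφ⟩ := S.initial
  obtain ⟨Q, hQ, hQL⟩ := S.bound H hH
  obtain ⟨η, hη, G, hG, key⟩ := exists_defect_bound hC ha hH hQ (half_pos hε)
  obtain ⟨n, hn⟩ := eventually_atTop.1 (((S.potential.and hφ).and hQL).and
    (S.defect_le H hH G hG η hη))
  refine ⟨n, fun m hm => ?_⟩
  obtain ⟨⟨⟨a1, a2⟩, a3⟩, a4⟩ := hn m hm
  obtain ⟨⟨⟨b1, b2⟩, b3⟩, b4⟩ := hn n le_rfl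
  rw [Real.dist_eq]
  have := key _ _ _ _ _ _ a1 b1 (fun g => by rw [a2, b2]) a3 b3 a4 b4
  linarith

/-- The effective error `e / (1 + h² e)` at `g = 0`: for an exact solution, the derivative in `h`
divided by `a h`. -/
def effErr (e : ℝ × ℝ → ℝ) (h : ℝ) : ℝ := e (h, 0) / (1 + h ^ 2 * e (h, 0))

lemma effErr_antitoneOn {e : ℝ × ℝ → ℝ} (he : ∀ t, 0 ≤ e t)
    (ha : AntitoneOn (fun h => e (h, 0)) (Set.Ici 0)) : AntitoneOn (effErr e) (Set.Ici 0) := by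
  intro h hh h' hh' hle
  have h1 : e (h', 0) ≤ e (h, 0) := ha hh hh' hle
  have h2 := he (h, 0)
  have h3 := he (h', 0)
  have h4 : h ^ 2 ≤ h' ^ 2 := pow_le_pow_left₀ hh hle 2
  unfold effErr
  rw [div_le_div_iff₀ (by positivity) (by positivity)]
  nlinarith [mul_le_mul_of_nonneg_right h4 (mul_nonneg h2 h3)]

/-- Increments of a potential in the variable `h²` are squeezed between values of the effective
error at the end points. -/
lemma IsPotential.increment_bounds {f e q : ℝ × ℝ → ℝ} (P : IsPotential C f e q) (ha : 0 ≤ a)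
    (hanti : AntitoneOn (fun h => e (h, 0)) (Set.Ici 0)) {h₁ h₂ ε : ℝ} (h0 : 0 ≤ h₁) (hle : h₁ ≤ h₂)
    (hε : ∫ h in 0..h₂, |defect a e q (h, 0)| ≤ ε) :
    a / 2 * effErr e h₂ * (h₂ ^ 2 - h₁ ^ 2) - ε ≤ f (h₂, 0) - f (h₁, 0) ∧
      f (h₂, 0) - f (h₁, 0) ≤ a / 2 * effErr e h₁ * (h₂ ^ 2 - h₁ ^ 2) + ε := by
  have hc : Continuous fun h : ℝ => (h, (0 : ℝ)) := by fun_prop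
  have hqc : Continuous fun h => q (h, 0) := P.continuous_q.comp hc
  have hdc : Continuous fun h => defect a e q (h, 0) := P.continuous_defect.comp hc
  have hkc : Continuous fun h => h * a * effErr e h := by
    have h1 : (fun h => h * a * effErr e h) = fun h => q (h, 0) - defect a e q (h, 0) := by
      funext h; simp only [defect, effErr]; ring
    rw [h1]; exact hqc.sub hdc
  have hk := effErr_antitoneOn P.nonneg hanti
  have e1 : f (h₂, 0) - f (h₁, 0) = (∫ h in h₁..h₂, h * a * effErr e h) +
      ∫ h in h₁..h₂, defect a e q (h, 0) := by
    rw [← intervalIntegral.integral_add (hkc.intervalIntegrable _ _) (hdc.intervalIntegrable _ _),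
      ← intervalIntegral.integral_eq_sub_of_hasDerivAt (fun h _ => P.deriv_meas h 0)
        (hqc.intervalIntegrable _ _)]
    congr 1; funext h; simp only [defect, effErr]; ring
  have e2 : |∫ h in h₁..h₂, defect a e q (h, 0)| ≤ ε := by
    refine (intervalIntegral.abs_integral_le_integral_abs hle).trans (le_trans ?_ hε)
    rw [← intervalIntegral.integral_add_adjacent_intervals (hdc.abs.intervalIntegrable 0 h₁)
      (hdc.abs.intervalIntegrable h₁ h₂)]
    have : 0 ≤ ∫ h in 0..h₁, |defect a e q (h, 0)| :=
      intervalIntegral.integral_nonneg h0 fun h _ => abs_nonneg _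
    linarith
  have e3 : ∀ k : ℝ, ∫ h in h₁..h₂, h * (a * k) = a / 2 * k * (h₂ ^ 2 - h₁ ^ 2) := by
    intro k
    rw [intervalIntegral.integral_mul_const, integral_id]; ring
  have hci : ∀ k : ℝ, IntervalIntegrable (fun h => h * (a * k)) volume h₁ h₂ := fun k =>
    Continuous.intervalIntegrable (by fun_prop) _ _
  have lo := intervalIntegral.integral_mono_on hle (hci (effErr e h₂)) (hkc.intervalIntegrable _ _)
    fun h hh => by
      rw [mul_assoc]
      exact mul_le_mul_of_nonneg_left (mul_le_mul_of_nonneg_left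
        (hk (h0.trans hh.1) (h0.trans hle) hh.2) ha) (h0.trans hh.1)
  have up := intervalIntegral.integral_mono_on hle (hkc.intervalIntegrable _ _) (hci (effErr e h₁))
    fun h hh => by
      rw [mul_assoc]
      exact mul_le_mul_of_nonneg_left (mul_le_mul_of_nonneg_left
        (hk h0 (h0.trans hh.1) hh.1) ha) (h0.trans hh.1)
  rw [e3] at lo up
  obtain ⟨l1, l2⟩ := abs_le.1 e2
  constructor <;> linarith

/-- Where the limit of the potentials is differentiable, the errors converge, because monotone
derivatives are squeezed between difference quotients. -/
lemma IsApproxSolution.tendsto_effErr (S : IsApproxSolution C a f e q) (ha : 0 ≤ a)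
    {ι : ℝ → ℝ} (hι : ∀ h, 0 ≤ h → Tendsto (fun L => f L (h, 0)) atTop (𝓝 (ι h))) {r D : ℝ}
    (hr : 0 < r) (hD : HasDerivAt (fun r => ι (√r)) D r) :
    Tendsto (fun L => a / 2 * effErr (e L) (√r)) atTop (𝓝 D) := by
  have hslope := hasDerivAt_iff_tendsto_slope.1 hD
  have hsl : ∀ r', slope (fun r => ι (√r)) r r' = (ι (√r') - ι (√r)) / (r' - r) := fun r' => by
    rw [slope_def_field]
  refine tendsto_order.2 ⟨fun b hb => ?_, fun b hb => ?_⟩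
  · have h1 : ∀ᶠ r' in 𝓝[>] r, b < slope (fun r => ι (√r)) r r' :=
      (hslope.mono_left (nhdsWithin_mono r fun x hx => ne_of_gt hx)).eventually_const_lt hb
    obtain ⟨r', hr', hrr⟩ := (h1.and self_mem_nhdsWithin).exists
    rw [hsl, lt_div_iff₀ (sub_pos.2 hrr)] at hr'
    have hlim := (hι (√r') (Real.sqrt_nonneg _)).sub (hι (√r) (Real.sqrt_nonneg _))
    obtain ⟨ε, hε⟩ : ∃ ε, ε = (ι (√r') - ι (√r) - b * (r' - r)) / 2 := ⟨_, rfl⟩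
    have hε0 : 0 < ε := by rw [hε]; linarith
    filter_upwards [hlim.eventually_const_lt (show ι (√r') - ι (√r) - ε < _ by linarith),
      S.potential, S.antitone_meas, S.defect_le (√r') (Real.sqrt_nonneg _) 0 le_rfl ε hε0]
      with L a1 a2 a3 a4
    have a5 := (a2.increment_bounds ha a3 (Real.sqrt_nonneg r) (Real.sqrt_le_sqrt hrr.le)
      (a4 0 (Set.left_mem_Icc.2 le_rfl))).2
    rw [Real.sq_sqrt hr.le, Real.sq_sqrt (hr.trans hrr).le] at a5
    have : b * (r' - r) < a / 2 * effErr (e L) (√r) * (r' - r) := by linarith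
    exact lt_of_mul_lt_mul_right this (sub_pos.2 hrr).le
  · have h1 : ∀ᶠ r' in 𝓝[<] r, slope (fun r => ι (√r)) r r' < b :=
      (hslope.mono_left (nhdsWithin_mono r fun x hx => ne_of_lt hx)).eventually_lt_const hb
    have h2 : ∀ᶠ r' in 𝓝[<] r, 0 < r' :=
      (eventually_gt_nhds hr).filter_mono nhdsWithin_le_nhds
    obtain ⟨r', ⟨hr', hr0⟩, hrr⟩ := ((h1.and h2).and self_mem_nhdsWithin).exists
    have hrr' : r' < r := hrr
    rw [hsl, ← neg_div_neg_eq, neg_sub, neg_sub, div_lt_iff₀ (sub_pos.2 hrr')] at hr'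
    have hlim := (hι (√r) (Real.sqrt_nonneg _)).sub (hι (√r') (Real.sqrt_nonneg _))
    obtain ⟨ε, hε⟩ : ∃ ε, ε = (b * (r - r') - (ι (√r) - ι (√r'))) / 2 := ⟨_, rfl⟩
    have hε0 : 0 < ε := by rw [hε]; linarith
    filter_upwards [hlim.eventually_lt_const (show _ < ι (√r) - ι (√r') + ε by linarith),
      S.potential, S.antitone_meas, S.defect_le (√r) (Real.sqrt_nonneg _) 0 le_rfl ε hε0]
      with L a1 a2 a3 a4
    have a5 := (a2.increment_bounds ha a3 (Real.sqrt_nonneg r') (Real.sqrt_le_sqrt hrr'.le)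
      (a4 0 (Set.left_mem_Icc.2 le_rfl))).1
    rw [Real.sq_sqrt hr.le, Real.sq_sqrt hr0.le] at a5
    have : a / 2 * effErr (e L) (√r) * (r - r') < b * (r - r') := by linarith
    exact lt_of_mul_lt_mul_right this (sub_pos.2 hrr').le

/-- The errors converge because the effective error determines them: `k = e / (1 + r e)` is inverted
by `e = k / (1 - r k)`, and `r k` stays away from `1` because the errors are bounded. -/
lemma IsApproxSolution.exists_tendsto_err (S : IsApproxSolution C a f e q) (hC : 0 ≤ C)
    (ha : 0 < a) {ι : ℝ → ℝ} (hι : ∀ h, 0 ≤ h → Tendsto (fun L => f L (h, 0)) atTop (𝓝 (ι h)))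
    {r D : ℝ} (hr : 0 < r) (hD : HasDerivAt (fun r => ι (√r)) D r) :
    ∃ E, Tendsto (fun L => e L (√r, 0)) atTop (𝓝 E) ∧ D = a / 2 * (E / (1 + r * E)) := by
  have h1 := (S.tendsto_effErr ha.le hι hr hD).const_mul (2 / a)
  have e1 : ∀ L, 2 / a * (a / 2 * effErr (e L) (√r)) = effErr (e L) (√r) := fun L => by
    field_simp
  simp only [e1] at h1
  obtain ⟨k, hk⟩ : ∃ k, k = 2 / a * D := ⟨_, rfl⟩
  rw [← hk] at h1
  have hb : ∀ᶠ L in atTop, effErr (e L) (√r) ≤ C / (1 + r * C) := by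
    filter_upwards [S.potential] with L P
    have p1 := P.nonneg (√r, 0)
    have p2 := P.le (√r, 0)
    unfold effErr
    rw [Real.sq_sqrt hr.le, div_le_div_iff₀ (by positivity) (by positivity)]
    nlinarith
  have hkC : k ≤ C / (1 + r * C) := le_of_tendsto h1 hb
  have hlt : ∀ k, k ≤ C / (1 + r * C) → 0 < 1 - r * k := by
    intro k hk
    have : r * k ≤ r * (C / (1 + r * C)) := mul_le_mul_of_nonneg_left hk hr.le
    have h3 : r * (C / (1 + r * C)) < 1 := by
      rw [← mul_div_assoc, div_lt_one (by positivity)]; linarith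
    linarith
  have hpos := hlt k hkC
  refine ⟨k / (1 - r * k), ?_, ?_⟩
  · have h2 := h1.div (tendsto_const_nhds.sub (h1.const_mul r)) hpos.ne'
    refine h2.congr' ?_
    filter_upwards [S.potential] with L P
    have p1 := P.nonneg (√r, 0)
    have p3 : 0 < 1 + r * e L (√r, 0) := by positivity
    simp only [Pi.div_apply]
    unfold effErr
    rw [Real.sq_sqrt hr.le]
    field_simp
    ring
  · have h3 : 1 + r * (k / (1 - r * k)) = 1 / (1 - r * k) := by
      field_simp; ring
    have hDk : D = a / 2 * k := by rw [hk]; field_simp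
    rw [h3, hDk, div_div_div_cancel_right₀ hpos.ne', div_one]

/-- The conclusion in terms of the noise level `Δ = h⁻²`. -/
lemma IsApproxSolution.limit (S : IsApproxSolution C a f e q) (hC : 0 ≤ C) (ha : 0 < a) :
    ∃ i : ℝ → ℝ, (∀ Δ : ℝ, 0 < Δ → Tendsto (fun L => f L ((√Δ)⁻¹, 0)) atTop (𝓝 (i Δ))) ∧
      ∀ᵐ Δ ∂(volume.restrict (Set.Ioi (0 : ℝ))), ∃ E : ℝ,
        Tendsto (fun L => e L ((√Δ)⁻¹, 0)) atTop (𝓝 E) ∧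
        HasDerivAt (fun r : ℝ => i r⁻¹) (a / 2 * (E / (1 + E / Δ))) Δ⁻¹ := by
  have hex : ∀ h : ℝ, ∃ l, 0 ≤ h → Tendsto (fun L => f L (h, 0)) atTop (𝓝 l) := fun h => by
    by_cases hh : 0 ≤ h
    · obtain ⟨l, hl⟩ := S.exists_tendsto hC ha.le hh
      exact ⟨l, fun _ => hl⟩
    · exact ⟨0, fun h' => absurd h' hh⟩
  choose ι hι using hex
  refine ⟨fun Δ => ι (√Δ)⁻¹, fun Δ _ => hι _ (inv_nonneg.2 (Real.sqrt_nonneg _)), ?_⟩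
  have hmono : MonotoneOn ι (Set.Ici 0) := by
    intro h hh h' hh' hle
    refine le_of_tendsto_of_tendsto (hι h hh) (hι h' hh') ?_
    filter_upwards [S.potential, S.nonneg] with L P hq
    have hd := (convex_Icc h h').mul_sub_le_image_sub_of_le_deriv
      (f := fun h => f L (h, 0)) (C := 0)
      (fun x _ => (P.deriv_meas x 0).continuousAt.continuousWithinAt)
      (fun x _ => (P.deriv_meas x 0).differentiableAt.differentiableWithinAt)
      (fun x hx => by
        rw [(P.deriv_meas x 0).deriv]
        exact hq x (hh.trans (interior_subset hx).1) 0)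
      h (Set.left_mem_Icc.2 hle) h' (Set.right_mem_Icc.2 hle) hle
    linarith
  have hneg : MonotoneOn (fun Δ => -ι (√Δ)⁻¹) (Set.Ioi 0) := by
    intro x hx y hy hxy
    refine neg_le_neg (hmono (inv_nonneg.2 (Real.sqrt_nonneg _)) (inv_nonneg.2 (Real.sqrt_nonneg _))
      (inv_anti₀ (Real.sqrt_pos.2 hx) (Real.sqrt_le_sqrt hxy)))
  have hae := hneg.ae_differentiableWithinAt measurableSet_Ioi
  filter_upwards [hae, ae_restrict_mem measurableSet_Ioi] with Δ hΔ hΔ0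
  have hΔ0' : (0 : ℝ) < Δ := hΔ0
  have hdi : DifferentiableAt ℝ (fun Δ => ι (√Δ)⁻¹) Δ := by
    have := (hΔ.differentiableAt (Ioi_mem_nhds hΔ0)).neg
    simpa using this
  have hcomp : HasDerivAt (fun r : ℝ => ι (√r⁻¹)⁻¹)
      (deriv (fun Δ => ι (√Δ)⁻¹) Δ * -((Δ⁻¹) ^ 2)⁻¹) Δ⁻¹ := by
    have hi := hasDerivAt_inv (inv_ne_zero hΔ0'.ne')
    have h1 : HasDerivAt (fun Δ => ι (√Δ)⁻¹) (deriv (fun Δ => ι (√Δ)⁻¹) Δ) (Δ⁻¹)⁻¹ := by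
      rw [inv_inv]; exact hdi.hasDerivAt
    exact h1.comp Δ⁻¹ hi
  have hfun : (fun r : ℝ => ι (√r⁻¹)⁻¹) = fun r => ι (√r) := by
    funext r; rw [Real.sqrt_inv, inv_inv]
  rw [hfun] at hcomp
  obtain ⟨E, hE, hDE⟩ := S.exists_tendsto_err hC ha hι (inv_pos.2 hΔ0') hcomp
  refine ⟨E, by rwa [← Real.sqrt_inv], ?_⟩
  simp only [hfun]
  rw [hDE] at hcomp
  rwa [div_eq_inv_mul E Δ]

end Limits

/-! ### The potentials of the sectioned signal -/

/-- Marginals of a standard Gaussian vector. -/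
lemma stdGauss_map_comp_injective {I J : Type*} [Fintype I] [Fintype J] {σ : I → J}
    (hσ : Function.Injective σ) :
    (stdGauss J).map (fun ω i => ω (σ i)) = stdGauss I := by
  have h : iIndepFun (fun (j : J) (ω : J → ℝ) => ω j) (stdGauss J) :=
    iIndepFun_pi (μ := fun _ : J => gaussianReal 0 1) (X := fun _ t => t)
      fun _ => aemeasurable_id
  have h2 := h.precomp hσ
  rw [iIndepFun_iff_map_fun_eq_pi_map fun i => (measurable_pi_apply (σ i)).aemeasurable] at h2
  rw [h2]
  unfold stdGauss
  congr 1
  funext i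
  exact (measurePreserving_eval (fun _ : J => gaussianReal 0 1) (σ i)).map_eq

namespace Signal

section

variable {Ω R N : Type*} [Fintype Ω] [Fintype R] [Fintype N] (𝒮 : Signal Ω N)

lemma antitoneOn_sigErr_side (h : ℝ) : AntitoneOn (fun g => 𝒮.sigErr R (h, g)) (Set.Ici 0) := by
  intro g hg g' hg' hle
  rcases (show (0 : ℝ) ≤ g' from hg').eq_or_lt with h0 | h0
  · have : g = 0 := le_antisymm (by rw [h0]; exact hle) hg
    simp [this, ← h0]
  · have h1 : (g / g') ^ 2 ≤ 1 :=
      pow_le_one₀ (div_nonneg hg h0.le) ((div_le_one h0).2 hle)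
    have := 𝒮.sigErr_antitone (R := R) (h, g') (a := 1) (b := g / g') (by norm_num) h1
    simpa [div_mul_cancel₀ _ h0.ne'] using this

lemma antitoneOn_sigErr_meas (g : ℝ) : AntitoneOn (fun h => 𝒮.sigErr R (h, g)) (Set.Ici 0) := by
  intro h hh h' hh' hle
  rcases (show (0 : ℝ) ≤ h' from hh').eq_or_lt with h0 | h0
  · have : h = 0 := le_antisymm (by rw [h0]; exact hle) hh
    simp [this, ← h0]
  · have h1 : (h / h') ^ 2 ≤ 1 :=
      pow_le_one₀ (div_nonneg hh h0.le) ((div_le_one h0).2 hle)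
    have := 𝒮.sigErr_antitone (R := R) (h', g) (a := h / h') (b := 1) h1 (by norm_num)
    simpa [div_mul_cancel₀ _ h0.ne'] using this

end

section Sections

variable {κ B : Type*} [Fintype κ] [Fintype B]

/-- The log-partition function of one section observed through the side channel only. -/
def logZSection (w : κ → ℝ) (a : κ → B → ℝ) (g : ℝ) (j : κ) (z : B → ℝ) : ℝ :=
  Real.log (partitionFn w fun k => ∑ b, (g * (a k b - a j b) * z b - (g * (a k b - a j b)) ^ 2 / 2))

lemma polyGrowth_logZSection {w : κ → ℝ} (hw : IsWeight w) (a : κ → B → ℝ) (g : ℝ) (j : κ) :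
    PolyGrowth (logZSection w a g j) :=
  PolyGrowth.log_partitionFn hw.nonneg (by rw [hw.sum_eq]; exact one_pos) fun _ =>
    .sum _ fun b _ => ((PolyGrowth.of_eval b).const_mul _).sub (.const _)

variable {w : κ → ℝ} (hw : IsWeight w) (a : κ → B → ℝ)

/-- Without measurements, the sections decouple. -/
lemma logZ_zero_meas {R : Type*} [Fintype R] (L : ℕ) (c g : ℝ) (s : Fin L → κ)
    (ω : Coord R (Fin L × B) → ℝ) :
    (sections hw a L c).logZ (0, g) s ω =
      ∑ l, logZSection w a g (s l) fun b => ω (.inr (.inr (l, b))) := by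
  let G : Fin L → κ → ℝ := fun l k => w k * Real.exp (∑ b, (g * (a k b - a (s l) b) *
    ω (.inr (.inr (l, b))) - (g * (a k b - a (s l) b)) ^ 2 / 2))
  have h1 : partitionFn (sections hw a L c).p
      (fun x => expo (sections hw a L c).c (0, g) ω ((sections hw a L c).disp s x)) =
      ∏ l, ∑ k, G l k := by
    have h := Finset.prod_univ_sum (fun _ : Fin L => (Finset.univ : Finset κ)) G
    rw [Fintype.piFinset_univ] at h
    rw [h]
    refine Finset.sum_congr rfl fun x _ => ?_
    rw [Finset.prod_mul_distrib, ← Real.exp_sum]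
    congr 2
    simp [expo, disp, sections, Fintype.sum_prod_type]
  unfold logZ
  rw [h1]
  exact Real.log_prod (f := fun l => ∑ k, G l k) fun l _ => (partitionFn_pos hw (e := fun k => ∑ b,
    (g * (a k b - a (s l) b) * ω (.inr (.inr (l, b))) - (g * (a k b - a (s l) b)) ^ 2 / 2))).ne'

/-- At `h = 0` the mean log-partition function per section does not depend on the number of
sections. -/
lemma meanLogZ_zero_meas (R : Type*) [Fintype R] (L : ℕ) (c g : ℝ) :
    (sections hw a L c).meanLogZ R (0, g) =
      L * ∑ k, w k * ∫ z, logZSection w a g k z ∂(stdGauss B) := by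
  have hP : ∀ l (s : Fin L → κ), PolyGrowth (fun ω : Coord R (Fin L × B) → ℝ =>
      logZSection w a g (s l) fun b => ω (.inr (.inr (l, b)))) := fun l s =>
    (polyGrowth_logZSection hw a g (s l)).comp_pi fun b => PolyGrowth.of_eval _
  have h1 : ∀ l (j : κ), ∫ ω : Coord R (Fin L × B) → ℝ,
      logZSection w a g j (fun b => ω (.inr (.inr (l, b)))) ∂(stdGauss (Coord R (Fin L × B))) =
      ∫ z, logZSection w a g j z ∂(stdGauss B) := by
    intro l j
    rw [← stdGauss_map_comp_injective (σ := fun b : B => (.inr (.inr (l, b)) : Coord R (Fin L × B)))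
      (fun b b' h => by simpa using h), integral_map
      (measurable_pi_lambda _ fun b => measurable_pi_apply _).aemeasurable
      (polyGrowth_logZSection hw a g j).1.aestronglyMeasurable]
  unfold meanLogZ
  simp only [logZ_zero_meas]
  rw [expect_sum _ hP]
  have h2 : ∀ l, expect (sections hw a L c).p (fun s (ω : Coord R (Fin L × B) → ℝ) =>
      logZSection w a g (s l) fun b => ω (.inr (.inr (l, b)))) =
      ∑ k, w k * ∫ z, logZSection w a g k z ∂(stdGauss B) := by
    intro l
    unfold expect
    simp only [h1]
    exact sum_prodWeight_eval hw l fun k => ∫ z, logZSection w a g k z ∂(stdGauss B)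
  simp [h2]

/-- The sum of the squared norms of all atoms, an upper bound for the squared norm of a section. -/
def sizeBound (a : κ → B → ℝ) : ℝ := ∑ k, ∑ b, a k b ^ 2

lemma sizeBound_nonneg : 0 ≤ sizeBound a :=
  Finset.sum_nonneg fun _ _ => Finset.sum_nonneg fun _ _ => sq_nonneg _

lemma sections_size_le (L : ℕ) (x : Fin L → κ) :
    (√L)⁻¹ ^ 2 * ∑ i, (sections hw a L (√L)⁻¹).X x i ^ 2 ≤ sizeBound a := by
  have h1 : ∑ i, (sections hw a L (√L)⁻¹).X x i ^ 2 ≤ L * sizeBound a := by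
    rw [Fintype.sum_prod_type]
    have : (L : ℝ) * sizeBound a = ∑ _ : Fin L, sizeBound a := by simp
    rw [this]
    exact Finset.sum_le_sum fun l _ => Finset.single_le_sum
      (f := fun k => ∑ b, a k b ^ 2) (fun _ _ => Finset.sum_nonneg fun _ _ => sq_nonneg _)
      (Finset.mem_univ (x l))
  rw [inv_pow, Real.sq_sqrt (Nat.cast_nonneg L)]
  rcases Nat.eq_zero_or_pos L with rfl | hL
  · simpa using sizeBound_nonneg a
  · have hL' : (0 : ℝ) < L := by exact_mod_cast hL
    rw [inv_mul_le_iff₀ hL']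
    exact h1

/-- The free energy per section, with `M` measurements. -/
def freeEnergy (L M : ℕ) (t : ℝ × ℝ) : ℝ :=
  -(sections hw a L (√L)⁻¹).meanLogZ (Fin M) t / L

/-- The mean square error per section. -/
def errPerSection (L M : ℕ) (t : ℝ × ℝ) : ℝ := (sections hw a L (√L)⁻¹).sigErr (Fin M) t / L

/-- The derivative in `h` of the free energy per section. -/
def dFreeEnergy (L M : ℕ) (t : ℝ × ℝ) : ℝ :=
  t.1 * (sections hw a L (√L)⁻¹).measErr (Fin M) t / L

lemma errPerSection_eq (L M : ℕ) (t : ℝ × ℝ) :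
    errPerSection hw a L M t = (√L)⁻¹ ^ 2 * (sections hw a L (√L)⁻¹).sigErr (Fin M) t := by
  rw [inv_pow, Real.sq_sqrt (Nat.cast_nonneg L), errPerSection, div_eq_inv_mul]

lemma errPerSection_nonneg (L M : ℕ) (t : ℝ × ℝ) : 0 ≤ errPerSection hw a L M t :=
  div_nonneg (sigErr_nonneg _ _) (Nat.cast_nonneg L)

lemma isPotential (L M : ℕ) :
    IsPotential (4 * sizeBound a) (freeEnergy hw a L M) (errPerSection hw a L M)
      (dFreeEnergy hw a L M) where
  deriv_meas h g := by
    classical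
    refine (((sections hw a L (√L)⁻¹).hasDerivAt_meanLogZ_meas (R := Fin M) h g).fun_neg.div_const
      (L : ℝ)).congr_deriv ?_
    simp only [dFreeEnergy]; ring
  deriv_side h g := by
    classical
    refine (((sections hw a L (√L)⁻¹).hasDerivAt_meanLogZ_side (R := Fin M) h g).fun_neg.div_const
      (L : ℝ)).congr_deriv ?_
    simp only [errPerSection]; ring
  continuous_f := ((sections hw a L (√L)⁻¹).continuous_meanLogZ).neg.div_const _
  continuous_e := ((sections hw a L (√L)⁻¹).continuous_sigErr).div_const _
  continuous_q := (continuous_fst.mul (sections hw a L (√L)⁻¹).continuous_measErr).div_const _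
  nonneg t := errPerSection_nonneg hw a L M t
  le t := by
    rw [errPerSection_eq]
    exact (sections hw a L (√L)⁻¹).sigErr_le (sections_size_le hw a L) t
  antitone_side h := fun g hg g' hg' hle => div_le_div_of_nonneg_right
    (antitoneOn_sigErr_side _ h hg hg' hle) (Nat.cast_nonneg L)

lemma dFreeEnergy_nonneg (L M : ℕ) {h : ℝ} (hh : 0 ≤ h) (g : ℝ) :
    0 ≤ dFreeEnergy hw a L M (h, g) :=
  div_nonneg (mul_nonneg hh (measErr_nonneg _ _)) (Nat.cast_nonneg L)

lemma dFreeEnergy_le (L M : ℕ) {h H m : ℝ} (hh : 0 ≤ h) (hH : h ≤ H) (g : ℝ)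
    (hL : 0 < L) (hm : (M : ℝ) ≤ m * L) :
    |dFreeEnergy hw a L M (h, g)| ≤ H * (4 * sizeBound a * m) := by
  have hL' : (0 : ℝ) < L := by exact_mod_cast hL
  rw [abs_of_nonneg (dFreeEnergy_nonneg hw a L M hh g), dFreeEnergy, div_le_iff₀ hL']
  have h1 := (sections hw a L (√L)⁻¹).measErr_le (R := Fin M) (sections_size_le hw a L) (h, g)
  rw [Fintype.card_fin] at h1
  have h2 := (sections hw a L (√L)⁻¹).measErr_nonneg (R := Fin M) (h, g)
  have h3 := sizeBound_nonneg a
  calc h * (sections hw a L (√L)⁻¹).measErr (Fin M) (h, g)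
      ≤ H * (4 * sizeBound a * (m * L)) :=
        mul_le_mul hH (h1.trans (mul_le_mul_of_nonneg_left hm (by positivity))) h2 (hh.trans hH)
    _ = _ := by ring

/-- The defect consists of the deviation from the relation between the two errors and of the
difference between `M / L` and its limit. -/
lemma abs_defect_le (L M : ℕ) (α : ℝ) (hL : 0 < L) {h : ℝ} (hh : 0 ≤ h) (g : ℝ) :
    |defect α (errPerSection hw a L M) (dFreeEnergy hw a L M) (h, g)| ≤
      h * (16 * sizeBound a * ((sections hw a L (√L)⁻¹).corrFluct (Fin M) (h, g) / L)) +
        h * (|M / L - α| * (4 * sizeBound a)) := by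
  classical
  have hL' : (0 : ℝ) < L := by exact_mod_cast hL
  set 𝒮 := sections hw a L (√L)⁻¹ with h𝒮
  have hs := sizeBound_nonneg a
  obtain ⟨e, he⟩ : ∃ e, e = errPerSection hw a L M (h, g) := ⟨_, rfl⟩
  obtain ⟨y, hy⟩ : ∃ y, y = 𝒮.measErr (Fin M) (h, g) := ⟨_, rfl⟩
  have he0 : 0 ≤ e := by rw [he]; exact errPerSection_nonneg hw a L M _
  have he1 : e ≤ 4 * sizeBound a := by rw [he]; exact (isPotential hw a L M).le _
  have hrel := 𝒮.measErr_relation (R := Fin M) (sections_size_le hw a L) (h, g)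
    (Fintype.card (Fin M) + h * (-h * 𝒮.measErr (Fin M) (h, g)))
  have hc : 𝒮.c = (√L)⁻¹ := rfl
  rw [hc, ← errPerSection_eq hw a L M (h, g), ← he, Fintype.card_fin] at hrel
  simp only at hrel
  rw [abs_of_nonneg hh] at hrel
  have hfl : expect 𝒮.p (fun s (ω : Coord (Fin M) (Fin L × B) → ℝ) => 𝒮.post (h, g) s ω fun x =>
      |𝒮.noiseCorr h s ω x - (M + h * (-h * 𝒮.measErr (Fin M) (h, g)))|) =
      𝒮.corrFluct (Fin M) (h, g) := by
    simp only [corrFluct, Fintype.card_fin]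
  rw [hfl, ← hy] at hrel
  have hp : 1 ≤ 1 + h ^ 2 * e := by linarith [mul_nonneg (sq_nonneg h) he0]
  have hp' : 0 < 1 + h ^ 2 * e := by linarith
  have e1 : defect α (errPerSection hw a L M) (dFreeEnergy hw a L M) (h, g) =
      (h * y * (1 + h ^ 2 * e) - h * (M * e)) / (L * (1 + h ^ 2 * e)) +
        h * ((M / L - α) * (e / (1 + h ^ 2 * e))) := by
    simp only [defect, dFreeEnergy, ← he, ← h𝒮, ← hy]
    field_simp
    ring
  rw [e1]
  refine (abs_add_le _ _).trans (add_le_add ?_ ?_)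
  · rw [abs_div, abs_of_pos (mul_pos hL' hp'), div_le_iff₀ (mul_pos hL' hp')]
    refine hrel.trans ?_
    have e2 : h * (16 * sizeBound a * (𝒮.corrFluct (Fin M) (h, g) / L)) * (L * (1 + h ^ 2 * e)) =
        h * (16 * sizeBound a * 𝒮.corrFluct (Fin M) (h, g)) * (1 + h ^ 2 * e) := by
      field_simp
    rw [e2]
    have := 𝒮.corrFluct_nonneg (R := Fin M) (h, g)
    exact le_mul_of_one_le_right (by positivity) hp
  · rw [abs_mul, abs_mul, abs_of_nonneg hh]
    refine mul_le_mul_of_nonneg_left (mul_le_mul_of_nonneg_left ?_ (abs_nonneg _)) hh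
    rw [abs_of_nonneg (div_nonneg he0 hp'.le)]
    exact (div_le_self he0 hp).trans he1

/-- A rate for the concentration of the noise correlation, in the regime `M = O(L)`. -/
lemma integral_corrFluct_div_le {H G m : ℝ} (hH : 0 ≤ H) (hm : 0 ≤ m) :
    ∃ A, ∀ L M : ℕ, 0 < L → (M : ℝ) ≤ m * L → ∀ g ∈ Set.Icc 0 G,
      (∫ h in 0..H, (sections hw a L (√L)⁻¹).corrFluct (Fin M) (h, g)) / L ≤ A / √√L := by
  classical
  have hs := sizeBound_nonneg a
  set v : ℝ := 8 * sizeBound a * (H + 1) ^ 2 * m + 4 * sizeBound a * G ^ 2 + 16 * Fintype.card κ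
    with hv
  have hv0 : 0 ≤ v := by positivity
  refine ⟨H * (2 * √m + H * (2 * sizeBound a * m) + H / 2 + 3 * H * √v +
    4 * H * (4 * sizeBound a * m) + 2 * ((H + 1) * (4 * sizeBound a * m))), ?_⟩
  intro L M hL hM g hg
  have hL' : (1 : ℝ) ≤ L := by exact_mod_cast hL
  have hL0 : (0 : ℝ) < L := by linarith
  obtain ⟨u, hu⟩ : ∃ u, u = √√(L : ℝ) := ⟨_, rfl⟩
  have hu1 : 1 ≤ u := by rw [hu]; exact Real.one_le_sqrt.2 (Real.one_le_sqrt.2 hL')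
  have hu0 : 0 < u := by linarith
  have hu2 : u ^ 2 = √(L : ℝ) := by rw [hu, Real.sq_sqrt (Real.sqrt_nonneg _)]
  have hu4 : (L : ℝ) = u ^ 4 := by
    rw [show u ^ 4 = (u ^ 2) ^ 2 by ring, hu2, Real.sq_sqrt hL0.le]
  have hV : ∀ h, |h| ≤ H + 1 → expect (sections hw a L (√L)⁻¹).p
      (fun s (ω : Coord (Fin M) (Fin L × B) → ℝ) => ((sections hw a L (√L)⁻¹).logZ (h, g) s ω -
        (sections hw a L (√L)⁻¹).meanLogZ (Fin M) (h, g)) ^ 2) ≤ v * u ^ 4 := by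
    intro h hh
    refine (expect_sq_logZ_sub_le (R := Fin M) hw a (sections_size_le hw a L)
      (inv_ne_zero (Real.sqrt_pos.2 hL0).ne') (h, g)).trans ?_
    rw [Fintype.card_fin, inv_pow, Real.sq_sqrt hL0.le, div_inv_eq_mul, ← hu4, hv]
    have h1 : h ^ 2 ≤ (H + 1) ^ 2 := by
      rw [← sq_abs]; exact pow_le_pow_left₀ (abs_nonneg _) hh 2
    have h2 : g ^ 2 ≤ G ^ 2 := pow_le_pow_left₀ hg.1 hg.2 2
    have h3 : 8 * sizeBound a * h ^ 2 * M ≤ 8 * sizeBound a * (H + 1) ^ 2 * (m * L) := by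
      gcongr
    have h4 : 4 * sizeBound a * g ^ 2 * L ≤ 4 * sizeBound a * G ^ 2 * L := by gcongr
    simp only
    linarith
  -- with `u = L ^ (1/4)`: the step `δ = 1 / u` balances the smoothing error, of relative size `δ`,
  -- against the fluctuation `√V / (δ L)`, of relative size `1 / (δ √L)`; `η = √L` suffices
  have key := (sections hw a L (√L)⁻¹).integral_corrFluct_le (R := Fin M)
    (sections_size_le hw a L) g hH (δ := 1 / u) (η := u ^ 2) (V := v * u ^ 4) (by positivity)
    (by rw [div_le_one hu0]; exact hu1) (by positivity) hV
  rw [Fintype.card_fin] at key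
  have hsM : √(M : ℝ) ≤ √m * u ^ 2 := by
    rw [hu2, ← Real.sqrt_mul hm]; exact Real.sqrt_le_sqrt hM
  have hsV : √(v * u ^ 4) = √v * u ^ 2 := by
    rw [Real.sqrt_mul hv0, show u ^ 4 = (u ^ 2) ^ 2 by ring, Real.sqrt_sq (by positivity)]
  have hMu : 4 * sizeBound a * M ≤ 4 * sizeBound a * m * u ^ 4 := by
    rw [← hu4, mul_assoc _ m]
    exact mul_le_mul_of_nonneg_left hM (by positivity)
  rw [← hu, div_le_div_iff₀ hL0 hu0]
  refine (mul_le_mul_of_nonneg_right key hu0.le).trans ?_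
  rw [hsV, hu4]
  have hu23 : u ^ 2 ≤ u ^ 3 := pow_le_pow_right₀ hu1 (by norm_num)
  have t1 : 2 * √(M : ℝ) ≤ 2 * √m * u ^ 3 := by
    have := mul_le_mul_of_nonneg_left hu23 (Real.sqrt_nonneg m)
    linarith
  have t2 : H * (4 * sizeBound a * M) / (2 * u ^ 2) ≤ H * (2 * sizeBound a * m) * u ^ 3 := by
    rw [div_le_iff₀ (by positivity)]
    calc H * (4 * sizeBound a * M) ≤ H * (4 * sizeBound a * m * u ^ 4) :=
          mul_le_mul_of_nonneg_left hMu hH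
      _ = H * (2 * sizeBound a * m) * u ^ 2 * (2 * u ^ 2) := by ring
      _ ≤ H * (2 * sizeBound a * m) * u ^ 3 * (2 * u ^ 2) := by gcongr
  have t3 : H * u ^ 2 / 2 ≤ H / 2 * u ^ 3 := by
    have := mul_le_mul_of_nonneg_left hu23 hH
    linarith
  have t4 : 3 * H * (√v * u ^ 2) / (1 / u) = 3 * H * √v * u ^ 3 := by
    field_simp
  have t5 : 4 * H * (1 / u) * (4 * sizeBound a * M) ≤ 4 * H * (4 * sizeBound a * m) * u ^ 3 := by
    calc 4 * H * (1 / u) * (4 * sizeBound a * M) ≤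
          4 * H * (1 / u) * (4 * sizeBound a * m * u ^ 4) :=
          mul_le_mul_of_nonneg_left hMu (by positivity)
      _ = _ := by field_simp
  have t6 : 2 * (1 / u) * ((H + 1) * (4 * sizeBound a * M)) ≤
      2 * ((H + 1) * (4 * sizeBound a * m)) * u ^ 3 := by
    calc 2 * (1 / u) * ((H + 1) * (4 * sizeBound a * M)) ≤
          2 * (1 / u) * ((H + 1) * (4 * sizeBound a * m * u ^ 4)) := by gcongr
      _ = _ := by field_simp
  rw [t4]
  have hsum := add_le_add (add_le_add (add_le_add (add_le_add (add_le_add t1 t2) t3)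
    (le_refl (3 * H * √v * u ^ 3))) t5) t6
  have := mul_le_mul_of_nonneg_right (mul_le_mul_of_nonneg_left hsum hH) hu0.le
  refine this.trans (le_of_eq ?_)
  ring

/-- The free energies of the model form an approximate solution of the limiting equation. -/
lemma isApproxSolution {M : ℕ → ℕ} {α : ℝ}
    (hM : Tendsto (fun L : ℕ => (M L : ℝ) / L) atTop (𝓝 α)) :
    IsApproxSolution (4 * sizeBound a) α (fun L => freeEnergy hw a L (M L))
      (fun L => errPerSection hw a L (M L)) (fun L => dFreeEnergy hw a L (M L)) := by
  have hs := sizeBound_nonneg a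
  have hα : 0 ≤ α := ge_of_tendsto' hM fun L => by positivity
  obtain ⟨m, hme⟩ : ∃ m, m = α + 1 := ⟨_, rfl⟩
  have hm : 0 ≤ m := by linarith
  have hMm : ∀ᶠ L : ℕ in atTop, 0 < L ∧ (M L : ℝ) ≤ m * L := by
    filter_upwards [hM.eventually_lt_const (show α < m by linarith), eventually_gt_atTop 0]
      with L h1 h2
    have h2' : (0 : ℝ) < L := by exact_mod_cast h2
    rw [div_lt_iff₀ h2'] at h1
    exact ⟨h2, h1.le⟩
  refine ⟨Eventually.of_forall fun L => isPotential hw a L (M L), ?_, ?_, ?_, ?_, ?_⟩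
  · refine ⟨fun g => -∑ k, w k * ∫ z, logZSection w a g k z ∂(stdGauss B), ?_⟩
    filter_upwards [eventually_gt_atTop 0] with L hL g
    have hL' : (L : ℝ) ≠ 0 := by exact_mod_cast hL.ne'
    rw [freeEnergy, meanLogZ_zero_meas]
    field_simp
  · intro H hH
    refine ⟨H * (4 * sizeBound a * m), by positivity, ?_⟩
    filter_upwards [hMm] with L hL h hh g
    exact dFreeEnergy_le hw a L (M L) hh.1 hh.2 g hL.1 hL.2
  · intro H hH G hG ε hε
    obtain ⟨A, hA⟩ := integral_corrFluct_div_le hw a (G := G) hH hm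
    have hl1 : Tendsto (fun L : ℕ => A / √√(L : ℝ)) atTop (𝓝 0) :=
      (Real.tendsto_sqrt_atTop.comp (Real.tendsto_sqrt_atTop.comp
        tendsto_natCast_atTop_atTop)).const_div_atTop A
    have hl2 : Tendsto (fun L : ℕ => |(M L : ℝ) / L - α|) atTop (𝓝 0) := by
      simpa using (hM.sub_const α).abs
    have hl : Tendsto (fun L : ℕ => H * (16 * sizeBound a) * (A / √√(L : ℝ)) +
        H * (H * (|(M L : ℝ) / L - α| * (4 * sizeBound a)))) atTop (𝓝 0) := by
      simpa using (hl1.const_mul (H * (16 * sizeBound a))).add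
        (((hl2.mul_const (4 * sizeBound a)).const_mul H).const_mul H)
    filter_upwards [hMm, hl.eventually_lt_const hε] with L hL hlt g hg
    set 𝒮 := sections hw a L (√L)⁻¹ with h𝒮
    have hcf : Continuous (fun h => 𝒮.corrFluct (Fin (M L)) (h, g)) := 𝒮.continuous_corrFluct g
    have hdc : Continuous (fun h => defect α (errPerSection hw a L (M L))
        (dFreeEnergy hw a L (M L)) (h, g)) :=
      (isPotential hw a L (M L)).continuous_defect.comp (by fun_prop)
    have hpt : ∀ h ∈ Set.Icc 0 H, |defect α (errPerSection hw a L (M L))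
        (dFreeEnergy hw a L (M L)) (h, g)| ≤
        H * (16 * sizeBound a) / L * 𝒮.corrFluct (Fin (M L)) (h, g) +
          H * (|(M L : ℝ) / L - α| * (4 * sizeBound a)) := by
      intro h hh
      refine (abs_defect_le hw a L (M L) α hL.1 hh.1 g).trans (add_le_add ?_ ?_)
      · have := 𝒮.corrFluct_nonneg (R := Fin (M L)) (h, g)
        calc h * (16 * sizeBound a * (𝒮.corrFluct (Fin (M L)) (h, g) / L)) ≤
              H * (16 * sizeBound a * (𝒮.corrFluct (Fin (M L)) (h, g) / L)) :=
              mul_le_mul_of_nonneg_right hh.2 (by positivity)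
          _ = _ := by ring
      · exact mul_le_mul_of_nonneg_right hh.2 (by positivity)
    have hi := intervalIntegral.integral_mono_on (μ := volume) hH
      (hdc.abs.intervalIntegrable 0 H)
      (Continuous.intervalIntegrable (by fun_prop) 0 H) hpt
    rw [intervalIntegral.integral_add (Continuous.intervalIntegrable (by fun_prop) _ _)
      (continuous_const.intervalIntegrable _ _), intervalIntegral.integral_const_mul,
      intervalIntegral.integral_const, smul_eq_mul, sub_zero] at hi
    have h1 := mul_le_mul_of_nonneg_left (hA L (M L) hL.1 hL.2 g hg)
      (show 0 ≤ H * (16 * sizeBound a) by positivity)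
    have e1 : H * (16 * sizeBound a) * ((∫ h in 0..H, 𝒮.corrFluct (Fin (M L)) (h, g)) / L) =
      H * (16 * sizeBound a) / L * ∫ h in 0..H, 𝒮.corrFluct (Fin (M L)) (h, g) := by ring
    rw [← h𝒮, e1] at h1
    linarith
  · exact Eventually.of_forall fun L h hh h' hh' hle => div_le_div_of_nonneg_right
      (antitoneOn_sigErr_meas _ 0 hh hh' hle) (Nat.cast_nonneg L)
  · exact Eventually.of_forall fun L h hh g => dFreeEnergy_nonneg hw a L (M L) hh g

end Sections

end Signal

/-! ### The random linear estimation problem in terms of standard Gaussian coordinates -/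

section Laws

variable {B : ℕ} (P : DiscretePrior B)

lemma DiscretePrior.isWeight : IsWeight P.weight := ⟨P.weight_nonneg, P.weight_sum⟩

/-- The signal whose sections have the given atoms. -/
def DiscretePrior.point (L : ℕ) (x : Fin L → Fin P.K) : Fin L → Fin B → ℝ := fun l => P.atom (x l)

instance : IsProbabilityMeasure P.sectionLaw where
  measure_univ := by
    simp only [DiscretePrior.sectionLaw, Measure.coe_finsetSum, Finset.sum_apply,
      Measure.smul_apply, measure_univ, smul_eq_mul, mul_one]
    rw [← ENNReal.ofReal_sum_of_nonneg fun k _ => P.weight_nonneg k, P.weight_sum,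
      ENNReal.ofReal_one]

lemma DiscretePrior.signalLaw_eq (L : ℕ) : P.signalLaw L =
    ∑ x : Fin L → Fin P.K, ENNReal.ofReal (prodWeight P.weight L x) •
      Measure.dirac (P.point L x) := by
  unfold DiscretePrior.signalLaw
  refine Measure.pi_eq (μ := fun _ : Fin L => P.sectionLaw) fun s hs => ?_
  simp only [DiscretePrior.sectionLaw, Measure.coe_finsetSum, Finset.sum_apply, Measure.smul_apply,
    smul_eq_mul]
  rw [Finset.prod_univ_sum, Fintype.piFinset_univ]
  refine Finset.sum_congr rfl fun x _ => ?_
  rw [Finset.prod_mul_distrib, prodWeight, ENNReal.ofReal_prod_of_nonneg fun l _ =>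
    P.weight_nonneg _]
  congr 1
  rw [Measure.dirac_apply' _ (MeasurableSet.univ_pi hs)]
  simp only [fun l => Measure.dirac_apply' (P.atom (x l)) (hs l)]
  by_cases h : ∀ l, P.atom (x l) ∈ s l
  · rw [Set.indicator_of_mem (by simpa [DiscretePrior.point] using h)]
    simp [h]
  · rw [Set.indicator_of_notMem (by simpa [DiscretePrior.point] using h)]
    push Not at h
    obtain ⟨l, hl⟩ := h
    exact (Finset.prod_eq_zero (Finset.mem_univ l) (by simp [hl])).symm

lemma DiscretePrior.integral_signalLaw (L : ℕ) (f : (Fin L → Fin B → ℝ) → ℝ) :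
    ∫ x, f x ∂(P.signalLaw L) = ∑ x, prodWeight P.weight L x * f (P.point L x) := by
  rw [P.signalLaw_eq, integral_finsetSum_measure fun x _ =>
    (integrable_dirac (by finiteness)).smul_measure ENNReal.ofReal_ne_top]
  refine Finset.sum_congr rfl fun x _ => ?_
  rw [integral_smul_measure, integral_dirac, ENNReal.toReal_ofReal
    ((isWeight_prodWeight P.isWeight L).nonneg x), smul_eq_mul]

lemma pi_map_curry {I J X : Type*} [Fintype I] [Fintype J] [MeasurableSpace X] (ν : Measure X)
    [IsProbabilityMeasure ν] :
    (Measure.pi fun _ : I × J => ν).map (fun φ i j => φ (i, j)) =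
      Measure.pi fun _ : I => Measure.pi fun _ : J => ν := by
  have h := Measure.infinitePi_map_curry (fun (_ : I) (_ : J) => ν)
  rw [Measure.infinitePi_eq_pi, Measure.infinitePi_eq_pi] at h
  simp only [Measure.infinitePi_eq_pi] at h
  exact h

/-- The measurement matrix as a function of standard Gaussian coordinates. -/
def matrixOf {L M : ℕ} (φ : Fin M × (Fin L × Fin B) → ℝ) : Fin M → Fin L → Fin B → ℝ :=
  fun μ l b => (√L)⁻¹ * φ (μ, (l, b))

lemma measurable_matrixOf {L M : ℕ} : Measurable (matrixOf (B := B) (L := L) (M := M)) := by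
  unfold matrixOf
  fun_prop

lemma stdGauss_map_matrixOf (L M : ℕ) :
    (stdGauss (Fin M × (Fin L × Fin B))).map matrixOf = matrixLaw M L B := by
  have h1 : (stdGauss (Fin M × (Fin L × Fin B))).map (fun φ j => (√(L : ℝ))⁻¹ * φ j) =
      Measure.pi fun _ => gaussianReal 0 (1 / (L : NNReal)) := by
    unfold stdGauss
    rw [Measure.pi_map_pi (f := fun _ t => (√(L : ℝ))⁻¹ * t) fun _ => by fun_prop]
    congr 1
    funext _
    rw [gaussianReal_map_const_mul, mul_zero]
    congr 1
    ext
    simp [inv_pow, Real.sq_sqrt]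
  have h2 := pi_map_curry (I := Fin M) (J := Fin L × Fin B) (gaussianReal 0 (1 / (L : NNReal)))
  have h3 := pi_map_curry (I := Fin L) (J := Fin B) (gaussianReal 0 (1 / (L : NNReal)))
  unfold matrixLaw
  have m3 : Measurable (fun (φ : Fin L × Fin B → ℝ) (l : Fin L) (b : Fin B) => φ (l, b)) :=
    measurable_pi_lambda _ fun _ => measurable_pi_lambda _ fun _ => measurable_pi_apply _
  have m2 : Measurable (fun (φ : Fin M × (Fin L × Fin B) → ℝ) (μ : Fin M) (j : Fin L × Fin B) =>
      φ (μ, j)) :=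
    measurable_pi_lambda _ fun _ => measurable_pi_lambda _ fun _ => measurable_pi_apply _
  have m4 : Measurable (fun (φ : Fin M → Fin L × Fin B → ℝ) (μ : Fin M) (l : Fin L) (b : Fin B) =>
      φ μ (l, b)) :=
    measurable_pi_lambda _ fun _ => m3.comp (measurable_pi_apply _)
  have h4 := Measure.pi_map_pi
    (μ := fun _ : Fin M => Measure.pi fun _ : Fin L × Fin B => gaussianReal 0 (1 / (L : NNReal)))
    (f := fun _ φ (l : Fin L) (b : Fin B) => φ (l, b)) fun _ => m3.aemeasurable
  rw [h3] at h4
  rw [← h4, ← h2, ← h1, Measure.map_map m2 (by fun_prop),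
    Measure.map_map m4 (m2.comp (by fun_prop))]
  rfl

/-- The matrix and the noise, as functions of the coordinates of the model with side channel. -/
def dataOf {L M : ℕ} (ω : Coord (Fin M) (Fin L × Fin B) → ℝ) :
    (Fin M → Fin L → Fin B → ℝ) × (Fin M → ℝ) :=
  (matrixOf fun j => ω (.inl j), fun μ => ω (.inr (.inl μ)))

lemma measurable_dataOf {L M : ℕ} : Measurable (dataOf (B := B) (L := L) (M := M)) := by
  unfold dataOf
  exact (measurable_matrixOf.comp (by fun_prop)).prodMk (by fun_prop)

lemma stdGauss_map_dataOf (L M : ℕ) :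
    (stdGauss (Coord (Fin M) (Fin L × Fin B))).map dataOf =
      (matrixLaw M L B).prod (noiseLaw M) := by
  have h1 : (stdGauss (Fin M × (Fin L × Fin B) ⊕ Fin M)).map
      (fun ω => ((fun j => ω (.inl j)), fun μ => ω (.inr μ))) =
      (stdGauss (Fin M × (Fin L × Fin B))).prod (stdGauss (Fin M)) :=
    (measurePreserving_sumPiEquivProdPi (X := fun _ : Fin M × (Fin L × Fin B) ⊕ Fin M => ℝ)
      (fun _ => gaussianReal 0 1)).map_eq
  have h2 := stdGauss_map_comp_injective
    (σ := (Sum.map id Sum.inl : Fin M × (Fin L × Fin B) ⊕ Fin M → Coord (Fin M) (Fin L × Fin B)))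
    (Function.injective_id.sumMap Sum.inl_injective)
  have h3 : noiseLaw M = stdGauss (Fin M) := rfl
  have h4 := Measure.map_prod_map (stdGauss (Fin M × (Fin L × Fin B))) (stdGauss (Fin M))
    measurable_matrixOf measurable_id
  have m1 : Measurable (fun ω : Fin M × (Fin L × Fin B) ⊕ Fin M → ℝ =>
      ((fun j => ω (.inl j)), fun μ => ω (.inr μ))) := by fun_prop
  have m2 : Measurable (fun (ω : Coord (Fin M) (Fin L × Fin B) → ℝ)
      (i : Fin M × (Fin L × Fin B) ⊕ Fin M) => ω (Sum.map id Sum.inl i)) :=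
    measurable_pi_lambda _ fun _ => measurable_pi_apply _
  rw [Measure.map_id, stdGauss_map_matrixOf, ← h1, ← h2, Measure.map_map m1 m2,
    Measure.map_map (measurable_matrixOf.prodMap measurable_id) (m1.comp m2)] at h4
  rw [h3, h4]
  rfl

/-- Integrals over the joint law of matrix, signal and noise are expectations over a finite signal
and standard Gaussian coordinates. -/
lemma integral_jointLaw (L M : ℕ)
    {f : (Fin M → Fin L → Fin B → ℝ) × (Fin L → Fin B → ℝ) × (Fin M → ℝ) → ℝ} (hf : Measurable f)
    (hP : ∀ x, PolyGrowth (fun ω : Coord (Fin M) (Fin L × Fin B) → ℝ =>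
      f ((dataOf ω).1, P.point L x, (dataOf ω).2))) :
    ∫ v, f v ∂(jointLaw P L M) = expect (prodWeight P.weight L)
      (fun x (ω : Coord (Fin M) (Fin L × Fin B) → ℝ) =>
        f ((dataOf ω).1, P.point L x, (dataOf ω).2)) := by
  have hins : ∀ x : Fin L → Fin P.K, Measurable (fun ω : Coord (Fin M) (Fin L × Fin B) → ℝ =>
      ((dataOf ω).1, P.point L x, (dataOf ω).2)) := fun x =>
    (measurable_dataOf.fst).prodMk (measurable_const.prodMk measurable_dataOf.snd)
  have : IsProbabilityMeasure (noiseLaw M) := by unfold noiseLaw; infer_instance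
  have : IsProbabilityMeasure (matrixLaw M L B) := by unfold matrixLaw; infer_instance
  have hlaw : jointLaw P L M = ∑ x, ENNReal.ofReal (prodWeight P.weight L x) •
      (stdGauss (Coord (Fin M) (Fin L × Fin B))).map
        (fun ω => ((dataOf ω).1, P.point L x, (dataOf ω).2)) := by
    have hx : ∀ x, (matrixLaw M L B).prod ((Measure.dirac (P.point L x)).prod (noiseLaw M)) =
        (stdGauss (Coord (Fin M) (Fin L × Fin B))).map
          (fun ω => ((dataOf ω).1, P.point L x, (dataOf ω).2)) := by
      intro x
      rw [Measure.dirac_prod]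
      conv_lhs => rw [← Measure.map_id (μ := matrixLaw M L B)]
      rw [Measure.map_prod_map _ _ measurable_id (by fun_prop), ← stdGauss_map_dataOf,
        Measure.map_map (by fun_prop) measurable_dataOf]
      rfl
    unfold jointLaw
    rw [P.signalLaw_eq, ← Measure.sum_fintype, Measure.prod_sum_left]
    simp only [Measure.prod_smul_left]
    have hs : ∀ x, SFinite (ENNReal.ofReal (prodWeight P.weight L x) •
        (Measure.dirac (P.point L x)).prod (noiseLaw M)) := fun x => inferInstance
    rw [Measure.prod_sum_right, Measure.sum_fintype]
    refine Finset.sum_congr rfl fun x _ => ?_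
    rw [← hx]
    exact Measure.prod_smul_right _
  rw [hlaw, integral_finsetSum_measure]
  · refine Finset.sum_congr rfl fun x _ => ?_
    rw [integral_smul_measure, ENNReal.toReal_ofReal
      ((isWeight_prodWeight P.isWeight L).nonneg x), smul_eq_mul,
      integral_map (hins x).aemeasurable hf.aestronglyMeasurable]
  · intro x _
    refine Integrable.smul_measure ?_ ENNReal.ofReal_ne_top
    rw [integrable_map_measure hf.aestronglyMeasurable (hins x).aemeasurable]
    exact (hP x).integrable _

end Laws

section Posterior

variable {B : ℕ} (P : DiscretePrior B) {L M : ℕ}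

/-- The signal attached to a prior, with the scaling of the measurement matrix. -/
def DiscretePrior.signal (L : ℕ) : Signal (Fin L → Fin P.K) (Fin L × Fin B) :=
  Signal.sections P.isWeight P.atom L (√L)⁻¹

lemma project_matrixOf (ω : Coord (Fin M) (Fin L × Fin B) → ℝ) (x : Fin L → Fin P.K) (μ : Fin M) :
    project (dataOf ω).1 (P.point L x) μ = field (√L)⁻¹ ((P.signal L).X x) ω μ := by
  simp only [project, dataOf, matrixOf, field, Fintype.sum_prod_type, Finset.mul_sum]
  refine Finset.sum_congr rfl fun l _ => Finset.sum_congr rfl fun b _ => ?_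
  simp only [DiscretePrior.signal, Signal.sections, DiscretePrior.point]
  ring

/-- The likelihood of the configuration `x` for data produced by the signal `s`. -/
lemma likelihood_eq {Δ : ℝ} (hΔ : 0 < Δ) (ω : Coord (Fin M) (Fin L × Fin B) → ℝ)
    (s x : Fin L → Fin P.K) :
    likelihood Δ (dataOf ω).1 (measurement Δ (dataOf ω).1 (P.point L s) (dataOf ω).2)
      (P.point L x) = ((2 * Real.pi * Δ) ^ (-(M : ℝ) / 2) *
        Real.exp (-∑ μ : Fin M, ω (.inr (.inl μ)) ^ 2 / 2)) *
        Real.exp (expo (√L)⁻¹ ((√Δ)⁻¹, 0) ω ((P.signal L).disp s x)) := by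
  unfold likelihood
  rw [mul_assoc ((2 * Real.pi * Δ) ^ (-(M : ℝ) / 2)), ← Real.exp_add]
  congr 2
  have hfd : ∀ μ : Fin M, field (√L)⁻¹ ((P.signal L).disp s x) ω μ =
      field (√L)⁻¹ ((P.signal L).X x) ω μ - field (√L)⁻¹ ((P.signal L).X s) ω μ := fun μ =>
    (P.signal L).field_disp s x ω μ
  simp only [expo, measurement, project_matrixOf, hfd]
  simp only [zero_mul, ne_eq, OfNat.ofNat_ne_zero, not_false_eq_true, zero_pow, zero_div, sub_zero,
    Finset.sum_const_zero, add_zero]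
  rw [← Finset.sum_neg_distrib, ← Finset.sum_neg_distrib, Finset.sum_div, ← Finset.sum_add_distrib]
  refine Finset.sum_congr rfl fun μ _ => ?_
  have h1 : (√Δ) ^ 2 = Δ := Real.sq_sqrt hΔ.le
  have h2 : √Δ ≠ 0 := (Real.sqrt_pos.2 hΔ).ne'
  simp only [dataOf]
  obtain ⟨u, hu⟩ : ∃ u, u = √Δ := ⟨_, rfl⟩
  rw [← hu] at h1 h2 ⊢
  rw [← h1]
  field_simp
  ring

lemma evidence_eq {Δ : ℝ} (hΔ : 0 < Δ) (ω : Coord (Fin M) (Fin L × Fin B) → ℝ)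
    (s : Fin L → Fin P.K) :
    evidence P Δ (dataOf ω).1 (measurement Δ (dataOf ω).1 (P.point L s) (dataOf ω).2) =
      ((2 * Real.pi * Δ) ^ (-(M : ℝ) / 2) *
        Real.exp (-∑ μ : Fin M, ω (.inr (.inl μ)) ^ 2 / 2)) *
        partitionFn (P.signal L).p
          (fun x => expo (√L)⁻¹ ((√Δ)⁻¹, 0) ω ((P.signal L).disp s x)) := by
  unfold evidence partitionFn
  rw [P.integral_signalLaw, Finset.mul_sum]
  refine Finset.sum_congr rfl fun x _ => ?_
  rw [likelihood_eq P hΔ]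
  simp only [DiscretePrior.signal, Signal.sections]
  ring

lemma log_likelihood_div_evidence {Δ : ℝ} (hΔ : 0 < Δ) (ω : Coord (Fin M) (Fin L × Fin B) → ℝ)
    (s : Fin L → Fin P.K) :
    Real.log (likelihood Δ (dataOf ω).1 (measurement Δ (dataOf ω).1 (P.point L s) (dataOf ω).2)
      (P.point L s) / evidence P Δ (dataOf ω).1
        (measurement Δ (dataOf ω).1 (P.point L s) (dataOf ω).2)) =
      -(P.signal L).logZ ((√Δ)⁻¹, 0) s ω := by
  have hK : 0 < (2 * Real.pi * Δ) ^ (-(M : ℝ) / 2) *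
      Real.exp (-∑ μ : Fin M, ω (.inr (.inl μ)) ^ 2 / 2) := by positivity
  rw [likelihood_eq P hΔ, evidence_eq P hΔ, mul_div_mul_left _ _ hK.ne']
  have h0 : expo (√L)⁻¹ ((√Δ)⁻¹, 0) ω ((P.signal L).disp s s) = 0 := by
    simp [expo, field, Signal.disp]
  rw [h0, Real.exp_zero, one_div, Real.log_inv]
  rfl

lemma posteriorMean_eq {Δ : ℝ} (hΔ : 0 < Δ) (ω : Coord (Fin M) (Fin L × Fin B) → ℝ)
    (s : Fin L → Fin P.K) (l : Fin L) (b : Fin B) :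
    posteriorMean P Δ (dataOf ω).1 (measurement Δ (dataOf ω).1 (P.point L s) (dataOf ω).2) l b =
      (P.signal L).post ((√Δ)⁻¹, 0) s ω fun x => (P.signal L).X x (l, b) := by
  have hK : 0 < (2 * Real.pi * Δ) ^ (-(M : ℝ) / 2) *
      Real.exp (-∑ μ : Fin M, ω (.inr (.inl μ)) ^ 2 / 2) := by positivity
  unfold posteriorMean Signal.post gibbs
  rw [P.integral_signalLaw, evidence_eq P hΔ]
  have h1 : ∑ x, prodWeight P.weight L x * (likelihood Δ (dataOf ω).1
      (measurement Δ (dataOf ω).1 (P.point L s) (dataOf ω).2) (P.point L x) * P.point L x l b) =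
      ((2 * Real.pi * Δ) ^ (-(M : ℝ) / 2) *
        Real.exp (-∑ μ : Fin M, ω (.inr (.inl μ)) ^ 2 / 2)) *
      ∑ x, (P.signal L).p x * Real.exp (expo (√L)⁻¹ ((√Δ)⁻¹, 0) ω ((P.signal L).disp s x)) *
        (P.signal L).X x (l, b) := by
    rw [Finset.mul_sum]
    refine Finset.sum_congr rfl fun x _ => ?_
    rw [likelihood_eq P hΔ]
    simp only [DiscretePrior.signal, Signal.sections, DiscretePrior.point]
    ring
  rw [h1, mul_div_mul_left _ _ hK.ne']
  rfl

lemma measurable_likelihood (Δ : ℝ) (x : Fin L → Fin B → ℝ) :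
    Measurable (fun v : (Fin M → Fin L → Fin B → ℝ) × (Fin L → Fin B → ℝ) × (Fin M → ℝ) =>
      likelihood Δ v.1 (measurement Δ v.1 v.2.1 v.2.2) x) := by
  unfold likelihood measurement project
  fun_prop

lemma measurable_evidence (Δ : ℝ) :
    Measurable (fun v : (Fin M → Fin L → Fin B → ℝ) × (Fin L → Fin B → ℝ) × (Fin M → ℝ) =>
      evidence P Δ v.1 (measurement Δ v.1 v.2.1 v.2.2)) := by
  unfold evidence
  simp only [P.integral_signalLaw]
  exact Finset.measurable_fun_sum _ fun x _ => (measurable_likelihood Δ _).const_mul _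

lemma measurable_posteriorMean (Δ : ℝ) (l : Fin L) (b : Fin B) :
    Measurable (fun v : (Fin M → Fin L → Fin B → ℝ) × (Fin L → Fin B → ℝ) × (Fin M → ℝ) =>
      posteriorMean P Δ v.1 (measurement Δ v.1 v.2.1 v.2.2) l b) := by
  unfold posteriorMean
  simp only [P.integral_signalLaw]
  exact (Finset.measurable_fun_sum _ fun x _ =>
    ((measurable_likelihood Δ _).mul_const _).const_mul _).div (measurable_evidence P Δ)

lemma measurable_likelihood_self (Δ : ℝ) :
    Measurable (fun v : (Fin M → Fin L → Fin B → ℝ) × (Fin L → Fin B → ℝ) × (Fin M → ℝ) =>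
      likelihood Δ v.1 (measurement Δ v.1 v.2.1 v.2.2) v.2.1) := by
  unfold likelihood measurement project
  fun_prop

/-- The mutual information is the free energy without side channel. -/
lemma mutualInfo_eq {Δ : ℝ} (hΔ : 0 < Δ) (L M : ℕ) :
    mutualInfo P L M Δ = Signal.freeEnergy P.isWeight P.atom L M ((√Δ)⁻¹, 0) := by
  have hm : Measurable (fun v : (Fin M → Fin L → Fin B → ℝ) × (Fin L → Fin B → ℝ) × (Fin M → ℝ) =>
      Real.log (likelihood Δ v.1 (measurement Δ v.1 v.2.1 v.2.2) v.2.1 /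
        evidence P Δ v.1 (measurement Δ v.1 v.2.1 v.2.2))) :=
    Real.measurable_log.comp ((measurable_likelihood_self Δ).div (measurable_evidence P Δ))
  have hlog : ∀ s, PolyGrowth (fun ω : Coord (Fin M) (Fin L × Fin B) → ℝ =>
      (P.signal L).logZ ((√Δ)⁻¹, 0) s ω) := fun s =>
    ((P.signal L).polyGrowth_logZ s).slice_left ((√Δ)⁻¹, (0 : ℝ))
  have h := integral_jointLaw P L M hm fun s => by
    simp only [log_likelihood_div_evidence P hΔ]
    exact (hlog s).neg
  simp only [log_likelihood_div_evidence P hΔ] at h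
  unfold mutualInfo
  rw [h]
  have e := expect_const_mul (p := prodWeight P.weight L)
    (f := fun s (ω : Coord (Fin M) (Fin L × Fin B) → ℝ) => (P.signal L).logZ ((√Δ)⁻¹, 0) s ω) (-1)
  simp only [neg_mul, one_mul] at e
  rw [e, Signal.freeEnergy, one_div, ← div_eq_inv_mul]
  rfl

/-- The mean square error is that of the model without side channel. -/
lemma mmse_eq {Δ : ℝ} (hΔ : 0 < Δ) (L M : ℕ) :
    mmse P L M Δ = Signal.errPerSection P.isWeight P.atom L M ((√Δ)⁻¹, 0) := by
  have hm : Measurable (fun v : (Fin M → Fin L → Fin B → ℝ) × (Fin L → Fin B → ℝ) × (Fin M → ℝ) =>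
      ∑ l, ∑ b, (v.2.1 l b - posteriorMean P Δ v.1 (measurement Δ v.1 v.2.1 v.2.2) l b) ^ 2) :=
    Finset.measurable_fun_sum _ fun l _ => Finset.measurable_fun_sum _ fun b _ =>
      ((by fun_prop : Measurable fun v : (Fin M → Fin L → Fin B → ℝ) × (Fin L → Fin B → ℝ) ×
        (Fin M → ℝ) => v.2.1 l b).sub (measurable_posteriorMean P Δ l b)).pow_const 2
  have hpt : ∀ s (ω : Coord (Fin M) (Fin L × Fin B) → ℝ),
      ∑ l, ∑ b, (P.point L s l b - posteriorMean P Δ (dataOf ω).1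
        (measurement Δ (dataOf ω).1 (P.point L s) (dataOf ω).2) l b) ^ 2 =
      ∑ i, ((P.signal L).post ((√Δ)⁻¹, 0) s ω fun x => (P.signal L).disp s x i) ^ 2 := by
    intro s ω
    rw [Fintype.sum_prod_type]
    refine Finset.sum_congr rfl fun l _ => Finset.sum_congr rfl fun b _ => ?_
    rw [posteriorMean_eq P hΔ, Signal.post_disp, ← neg_sq, neg_sub]
    rfl
  have h := integral_jointLaw P L M hm fun s => by
    simp only [hpt]
    exact .sum _ fun i _ =>
      (((P.signal L).polyGrowth_post_disp s i).slice_left ((√Δ)⁻¹, (0 : ℝ))).pow 2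
  simp only [hpt] at h
  unfold mmse
  rw [h, Signal.errPerSection, one_div, ← div_eq_inv_mul]
  rfl

end Posterior

end RLE

end

theorem theorem1 (B : ℕ) (hB : 0 < B) (P : RLE.DiscretePrior B) (α : ℝ) (hα : 0 < α)
    (M : ℕ → ℕ)
    (hM : Tendsto (fun L : ℕ => (M L : ℝ) / ((L : ℝ) * (B : ℝ))) atTop (𝓝 α)) :
    ∃ i : ℝ → ℝ,
      (∀ Δ : ℝ, 0 < Δ → Tendsto (fun L : ℕ => RLE.mutualInfo P L (M L) Δ) atTop (𝓝 (i Δ))) ∧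
      ∀ᵐ Δ ∂(volume.restrict (Set.Ioi (0 : ℝ))), ∃ E : ℝ,
        Tendsto (fun L : ℕ => RLE.mmse P L (M L) Δ) atTop (𝓝 E) ∧
        HasDerivAt (fun r : ℝ => i r⁻¹) (α * (B : ℝ) / 2 * (E / (1 + E / Δ))) Δ⁻¹ := by
  have hB' : (0 : ℝ) < B := by exact_mod_cast hB
  have hM' : Tendsto (fun L : ℕ => (M L : ℝ) / L) atTop (𝓝 (α * B)) := by
    refine (hM.mul_const (B : ℝ)).congr fun L => ?_
    rw [div_mul_eq_div_div, div_mul_cancel₀ _ hB'.ne']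
  obtain ⟨i, hi, hE⟩ := (RLE.Signal.isApproxSolution P.isWeight P.atom hM').limit
    (mul_nonneg (by norm_num) (RLE.Signal.sizeBound_nonneg _)) (mul_pos hα hB')
  refine ⟨i, fun Δ hΔ => ?_, ?_⟩
  · simp only [RLE.mutualInfo_eq P hΔ]
    exact hi Δ hΔ
  · filter_upwards [hE, ae_restrict_mem measurableSet_Ioi] with Δ ⟨E, hlim, hderiv⟩ hΔ
    refine ⟨E, ?_, hderiv⟩
    simp only [RLE.mmse_eq P hΔ]
    exact hlim
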